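/- Let $\mu>0$, $v>0$, $\tau\in\mathbb{R}\setminus\{0,\pm1\}$ and $\omega>\frac{v^2}{(\tau^2+1)^2}$. Let $H^1_\tau$ be the set of complex-valued $u\in H^1(\mathbb{R}\setminus\{0\})=H^1(\mathbb{R}_-)\oplus H^1(\mathbb{R}_+)$ with $u(0+)=\tau u(0-)$, and write $\|u'\|_2^2=\|u'\|_{L^2(\mathbb{R}_-)}^2+\|u'\|_{L^2(\mathbb{R}_+)}^2$. For $u\in H^1_\tau$ put $$S_\omega(u)=\tfrac12\|u'\|_2^2-\tfrac1{2\mu+2}\|u\|_{2\mu+2}^{2\mu+2}-\tfrac v2|u(0-)|^2+\tfrac\omega2\|u\|_2^2,\qquad \widetilde S(u)=\tfrac{\mu}{2(\mu+1)}\|u\|_{2\mu+2}^{2\mu+2},$$ $$I_\omega(u)=\|u'\|_2^2-\|u\|_{2\mu+2}^{2\mu+2}-v|u(0-)|^2+\omega\|u\|_2^2 .$$ A *ground state* is a global minimizer of $S_\omega$ on the Nehari manifold $\{u\in H^1_\tau\setminus\{0\}: I_\omega(u)=0\}$. A *stationary state* is a $u\in H^2(\mathbb{R}\setminus\{0\})$,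 $u\neq0$, with $-u''-|u|^{2\mu}u+\omega u=0$ for $x\ne0$, $u(0+)=\tau u(0-)$ and $u'(0-)-\tau u'(0+)=v\,u(0-)$. Let $\phi_\omega(x)=(\omega(\mu+1))^{\frac1{2\mu}}\cosh^{-\frac1\mu}(\mu\sqrt\omega\,x)$, $A=\frac{v^2}{\omega}|\tau|^{2\mu}+(|\tau|^{2\mu+4}-1)(|\tau|^{2\mu}-1)$, and $$\widetilde T_-=\frac{\frac{v}{\sqrt\omega}-\tau^2\sqrt A}{|\tau|^{2\mu+4}-1},\quad \widetilde T_+=\frac{|\tau|^{2\mu+2}\frac{v}{\sqrt\omega}-\sqrt A}{|\tau|^{2\mu+4}-1},\quad \widehat T_-=\frac{\frac{v}{\sqrt\omega}+\tau^2\sqrt A}{|\tau|^{2\mu+4}-1},\quad \widehat T_+=\frac{|\tau|^{2\mu+2}\frac{v}{\sqrt\omega}+\sqrt A}{|\tau|^{2\mu+4}-1}.$$ For $(T_-,T_+)\in(-1,1)^2$ let $u_T(x)=\phi_\omega(x+x_-)$ for $x<0$ and $u_T(x)=\operatorname{sgn}(\tau)\,\phi_\omega(x+x_+)$ for $x>0$,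 where $\tanh(\mu\sqrt\omega\,x_\pm)=T_\pm$; write $u_{\widetilde T}$, $u_{\widehat T}$ for the functions obtained from $(\widetilde T_-,\widetilde T_+)$, $(\widehat T_-,\widehat T_+)$. Theorem. 1. $(\widetilde T_-,\widetilde T_+)\in(-1,1)^2$ solves the system $T_+=\frac1{\tau^2}\big(T_-+\frac v{\sqrt\omega}\big)$, $\ \frac{T_-^2}{1-|\tau|^{-2\mu}}-\frac{T_+^2}{|\tau|^{2\mu}-1}=1$, and $u_{\widetilde T}$ is a stationary state. 2. $u_{\widetilde T}$ is a ground state, and it is the only one up to a constant phase: the ground states are exactly the functions $e^{i\theta}u_{\widetilde T}$, $\theta\in\mathbb{R}$. 3. If moreover $\omega>\frac{v^2}{(\tau^2-1)^2}$, then $(\widehat T_-,\widehat T_+)\in(-1,1)^2$ also solves this system, $u_{\widehat T}$ is also a stationary state, and $\widetilde S(u_{\widetilde T})<\widetilde S(u_{\widehat T})$. 4. For $u=u_{\widetilde T}$, and for $u=u_{\widehat T}$ when $\omega>\frac{v^2}{(\tau^2-1)^2}$, with the corresponding $T_\pm$, $$\|u'\|_2^2=\tfrac{(\mu+1)^{1/\mu}}{2}\,\omega^{\frac1\mu+\frac12}\Big(\int_{-1}^1(1-t^2)^{\frac1\mu}dt-\int_{T_-}^{T_+}(1-t^2)^{\frac1\mu}dt+T_+(1-T_+^2)^{\frac1\mu}-T_-(1-T_-^2)^{\frac1\mu}\Big),$$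 $$\|u\|_2^2=\tfrac{(\mu+1)^{1/\mu}}{\mu}\,\omega^{\frac1\mu-\frac12}\Big(\int_{-1}^1(1-t^2)^{\frac1\mu-1}dt-\int_{T_-}^{T_+}(1-t^2)^{\frac1\mu-1}dt\Big),$$ $$\|u\|_{2\mu+2}^{2\mu+2}=\tfrac{(\mu+1)^{1/\mu+1}}{\mu}\,\omega^{\frac1\mu+\frac12}\Big(\int_{-1}^1(1-t^2)^{\frac1\mu}dt-\int_{T_-}^{T_+}(1-t^2)^{\frac1\mu}dt\Big),\qquad |u(0-)|^2=(\mu+1)^{\frac1\mu}\omega^{\frac1\mu}(1-T_-^2)^{\frac1\mu}.$$ -/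

import Mathlib

open MeasureTheory Set Filter Topology

namespace FulopTsutsui

noncomputable section

/-! Functions `u : ℝ → ℂ` represent their classes modulo Lebesgue-a.e. equality. -/

/-- `g` is a weak derivative of `u` on `ℝ ∖ {0}`. -/
def IsWeakDeriv (u g : ℝ → ℂ) : Prop :=
  ∀ φ : ℝ → ℝ, ContDiff ℝ ((⊤ : ℕ∞) : WithTop ℕ∞) φ → HasCompactSupport φ → tsupport φ ⊆ {0}ᶜ →
    ∫ x, deriv φ x • u x = -∫ x, φ x • g x

/-- `u ∈ H¹(ℝ ∖ {0}) = H¹(ℝ₋) ⊕ H¹(ℝ₊)`. -/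
def MemH1 (u : ℝ → ℂ) : Prop :=
  MemLp u 2 volume ∧ ∃ g : ℝ → ℂ, MemLp g 2 volume ∧ IsWeakDeriv u g

open Classical in
/-- The (a.e. unique) square-integrable weak derivative `u'` on `ℝ ∖ {0}` of a function
`u ∈ H¹(ℝ ∖ {0})`; it is `0` by convention for other functions. -/
def weakDeriv (u : ℝ → ℂ) : ℝ → ℂ :=
  if h : ∃ g : ℝ → ℂ, MemLp g 2 volume ∧ IsWeakDeriv u g then h.choose else 0

/-- `u ∈ H²(ℝ ∖ {0})`. -/
def MemH2 (u : ℝ → ℂ) : Prop :=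
  MemH1 u ∧ MemH1 (weakDeriv u)

/-- The one-sided trace `u(0-)`: the essential limit of `u(x)` as `x → 0`, `x < 0`. -/
def traceLeft (u : ℝ → ℂ) : ℂ := limUnder (𝓝[<] (0 : ℝ) ⊓ ae volume) u

/-- The one-sided trace `u(0+)`: the essential limit of `u(x)` as `x → 0`, `x > 0`. -/
def traceRight (u : ℝ → ℂ) : ℂ := limUnder (𝓝[>] (0 : ℝ) ⊓ ae volume) u

/-- The energy space `H¹_τ`. -/
def MemH1tau (τ : ℝ) (u : ℝ → ℂ) : Prop :=
  MemH1 u ∧ traceRight u = (τ : ℂ) * traceLeft u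

/-- `‖u‖₂²`. -/
def normSq (u : ℝ → ℂ) : ℝ := ∫ x, ‖u x‖ ^ 2

/-- `‖u'‖₂² = ‖u'‖²_{L²(ℝ₋)} + ‖u'‖²_{L²(ℝ₊)}`. -/
def derivNormSq (u : ℝ → ℂ) : ℝ := ∫ x, ‖weakDeriv u x‖ ^ 2

/-- `‖u‖_{2μ+2}^{2μ+2}`. -/
def powNorm (μ : ℝ) (u : ℝ → ℂ) : ℝ := ∫ x, ‖u x‖ ^ (2 * μ + 2)

/-- The energy `E`. -/
def energy (μ v : ℝ) (u : ℝ → ℂ) : ℝ :=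
  1 / 2 * derivNormSq u - 1 / (2 * μ + 2) * powNorm μ u - v / 2 * ‖traceLeft u‖ ^ 2

/-- The action `S_ω`. -/
def action (μ v ω : ℝ) (u : ℝ → ℂ) : ℝ :=
  energy μ v u + ω / 2 * normSq u

/-- Nehari's functional `I_ω`. -/
def nehari (μ v ω : ℝ) (u : ℝ → ℂ) : ℝ :=
  derivNormSq u - powNorm μ u - v * ‖traceLeft u‖ ^ 2 + ω * normSq u

/-- The reduced action `S̃`. -/
def reducedAction (μ : ℝ) (u : ℝ → ℂ) : ℝ :=
  μ / (2 * (μ + 1)) * powNorm μ u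

/-- The Nehari manifold: nonzero elements of `H¹_τ` with `I_ω(u) = 0`. -/
def MemNehari (μ v τ ω : ℝ) (u : ℝ → ℂ) : Prop :=
  MemH1tau τ u ∧ ¬ u =ᵐ[volume] 0 ∧ nehari μ v ω u = 0

/-- A ground state: a global minimizer of `S_ω` on the Nehari manifold. -/
def IsGroundState (μ v τ ω : ℝ) (u : ℝ → ℂ) : Prop :=
  MemNehari μ v τ ω u ∧ ∀ w : ℝ → ℂ, MemNehari μ v τ ω w → action μ v ω u ≤ action μ v ω w

/-- A stationary state: a nonzero `u ∈ H²(ℝ ∖ {0})` with `-u'' - |u|^{2μ} u + ω u = 0` for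
`x ≠ 0`, `u(0+) = τ u(0-)` and `u'(0-) - τ u'(0+) = v u(0-)`. -/
def IsStationaryState (μ v τ ω : ℝ) (u : ℝ → ℂ) : Prop :=
  MemH2 u ∧ ¬ u =ᵐ[volume] 0 ∧
    (∀ᵐ x, -weakDeriv (weakDeriv u) x - ((‖u x‖ ^ (2 * μ) : ℝ) : ℂ) * u x + (ω : ℂ) * u x = 0) ∧
    traceRight u = (τ : ℂ) * traceLeft u ∧
    traceLeft (weakDeriv u) - (τ : ℂ) * traceRight (weakDeriv u) = (v : ℂ) * traceLeft u

/-- The soliton `φ_ω`. -/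
def soliton (μ ω x : ℝ) : ℝ :=
  (ω * (μ + 1)) ^ (1 / (2 * μ)) * Real.cosh (μ * √ω * x) ^ (-(1 / μ))

/-- The quantity under the square root in the explicit roots. -/
def rootDisc (μ v τ ω : ℝ) : ℝ :=
  v ^ 2 / ω * |τ| ^ (2 * μ) + (|τ| ^ (2 * μ + 4) - 1) * (|τ| ^ (2 * μ) - 1)

/-- `T̃₋`. -/
def tildeMinus (μ v τ ω : ℝ) : ℝ :=
  1 / (|τ| ^ (2 * μ + 4) - 1) * (v / √ω - |τ| ^ 2 * √(rootDisc μ v τ ω))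

/-- `T̃₊`. -/
def tildePlus (μ v τ ω : ℝ) : ℝ :=
  1 / (|τ| ^ (2 * μ + 4) - 1) * (|τ| ^ (2 * μ + 2) * (v / √ω) - √(rootDisc μ v τ ω))

/-- `T̂₋`. -/
def hatMinus (μ v τ ω : ℝ) : ℝ :=
  1 / (|τ| ^ (2 * μ + 4) - 1) * (v / √ω + |τ| ^ 2 * √(rootDisc μ v τ ω))

/-- `T̂₊`. -/
def hatPlus (μ v τ ω : ℝ) : ℝ :=
  1 / (|τ| ^ (2 * μ + 4) - 1) * (|τ| ^ (2 * μ + 2) * (v / √ω) + √(rootDisc μ v τ ω))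

/-- `(T₋, T₊)` lies in the open square `(-1,1)²` and solves the algebraic system
`T₊ = τ⁻² (T₋ + v/√ω)`, `T₋² / (1 - |τ|^{-2μ}) - T₊² / (|τ|^{2μ} - 1) = 1`. -/
def IsRootPair (μ v τ ω Tm Tp : ℝ) : Prop :=
  Tm ∈ Ioo (-1 : ℝ) 1 ∧ Tp ∈ Ioo (-1 : ℝ) 1 ∧
    Tp = 1 / τ ^ 2 * (Tm + v / √ω) ∧
    Tm ^ 2 / (1 - 1 / |τ| ^ (2 * μ)) - Tp ^ 2 / (|τ| ^ (2 * μ) - 1) = 1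

/-- The shift `x` with `tanh (μ √ω x) = T`, for `T ∈ (-1,1)`. -/
def shift (μ ω T : ℝ) : ℝ :=
  1 / (2 * μ * √ω) * Real.log ((1 + T) / (1 - T))

/-- The two-piece profile `φ_ω(x + x₋)` for `x < 0`, `sgn(τ) φ_ω(x + x₊)` for `x > 0`, where
`tanh (μ √ω x_±) = T_±`. The sign is `1` for `τ > 0`; for `τ < 0` it accounts for the reflection
`u ↦ -u` on the positive half-line, which exchanges `H¹_τ` and `H¹_{-τ}`. -/
def profile (μ τ ω Tm Tp : ℝ) (x : ℝ) : ℂ :=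
  if x < 0 then ((soliton μ ω (x + shift μ ω Tm) : ℝ) : ℂ)
  else ((Real.sign τ * soliton μ ω (x + shift μ ω Tp) : ℝ) : ℂ)

/-- The state `u_{T̃}`. -/
def uTilde (μ v τ ω : ℝ) : ℝ → ℂ :=
  profile μ τ ω (tildeMinus μ v τ ω) (tildePlus μ v τ ω)

/-- The state `u_{T̂}`. -/
def uHat (μ v τ ω : ℝ) : ℝ → ℂ :=
  profile μ τ ω (hatMinus μ v τ ω) (hatPlus μ v τ ω)

/-- The explicit integral formulas for the norms of the profile with parameters `(T₋, T₊)`. -/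
def NormIdentities (μ ω Tm Tp : ℝ) (u : ℝ → ℂ) : Prop :=
  derivNormSq u = (μ + 1) ^ (1 / μ) / 2 * ω ^ (1 / μ + 1 / 2) *
      ((∫ t in (-1 : ℝ)..1, (1 - t ^ 2) ^ (1 / μ)) - (∫ t in Tm..Tp, (1 - t ^ 2) ^ (1 / μ))
        + Tp * (1 - Tp ^ 2) ^ (1 / μ) - Tm * (1 - Tm ^ 2) ^ (1 / μ)) ∧
  normSq u = (μ + 1) ^ (1 / μ) / μ * ω ^ (1 / μ - 1 / 2) *
      ((∫ t in (-1 : ℝ)..1, (1 - t ^ 2) ^ (1 / μ - 1))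
        - ∫ t in Tm..Tp, (1 - t ^ 2) ^ (1 / μ - 1)) ∧
  powNorm μ u = (μ + 1) ^ (1 / μ + 1) / μ * ω ^ (1 / μ + 1 / 2) *
      ((∫ t in (-1 : ℝ)..1, (1 - t ^ 2) ^ (1 / μ)) - ∫ t in Tm..Tp, (1 - t ^ 2) ^ (1 / μ)) ∧
  ‖traceLeft u‖ ^ 2 = (μ + 1) ^ (1 / μ) * ω ^ (1 / μ) * (1 - Tm ^ 2) ^ (1 / μ)

end

end FulopTsutsui

/-! On the Nehari manifold the action is a positive multiple of the mass `powNorm`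
(`action_eq_of_nehari`), so ground states are the elements of least mass. No compactness argument is
needed: the explicit profile is compared directly with any competitor through a sharp inequality on
each half-line.

Write κ for `massConst` and F for `halfMass`. If f on (0,∞) has mass κF(θ₀), then ∫(|f'|² + ω|f|²)
is at least its mass minus √ω θ₀|f(0)|² (`halfLine_inequality`). The proof is a transport argument:
let θ(x) be determined by κF(θ(x)) = ∫ₓ^∞ |f|^{2μ+2}. Then |f'|² + ω|f|² - |f|^{2μ+2} - √ω(θ|f|²)'
is the sum of the square |f' - √ωθf|² and the defect in a Young inequality, both nonnegative
(`density_eq`). Equality forces f' = √ωθf and |f|^{2μ} = ω(μ+1)(1-θ²); then θ solves a Riccati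
equation, θ is minus a translated tanh, and f is a translated soliton up to a phase
(`halfLine_rigidity`).

Apply this to the two halves of an element w of the Nehari manifold, with parameters x = θ on the
left and y = -θ' on the right. Since |w(0+)|² = τ²|w(0-)|², adding the two inequalities and using
I_ω(w) = 0 gives √ω(-x + τ²y)|w(0-)|² ≤ v|w(0-)|².

What remains is a problem in two real variables. On the line -x + τ²y = V, with V = v/√ω, the
derivative of the mass F(x) + F(-y) has the sign of a quadratic in x with roots T̃₋ and T̂₋
(`RootData.factor`). This, with a look at the ends of the admissible segment, makes T̃ the strict
minimum (`RootData.lineMass_lt`). Moreover a pair in the square with mass at most this minimum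
satisfies V ≤ -x + τ²y, with equality only at T̃ (`RootData.jump_le_of_mass_le`). Hence if w has no
more mass than u_T̃, every inequality above is an equality and w is u_T̃ up to a phase
(`eq_phase_of_powNorm_le`). Minimality and uniqueness follow together, and the strict minimum on the
line also gives the comparison with T̂.

The norm formulas come from the substitution t = tanh and one integration by parts. -/

namespace FulopTsutsui

noncomputable section

/-! ### Primitives of locally integrable functions and the fundamental theorem of calculus -/

/-- The primitive of `g` with value `a` at the origin. -/
def prim (a : ℂ) (g : ℝ → ℂ) (x : ℝ) : ℂ := a + ∫ t in (0 : ℝ)..x, g t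

lemma prim_zero (a : ℂ) (g : ℝ → ℂ) : prim a g 0 = a := by simp [prim]

lemma intervalIntegrable_of_locallyIntegrable {g : ℝ → ℂ} (hg : LocallyIntegrable g) (x y : ℝ) :
    IntervalIntegrable g volume x y :=
  (hg.integrableOn_isCompact isCompact_uIcc).intervalIntegrable

lemma continuous_prim {g : ℝ → ℂ} (hg : LocallyIntegrable g) (a : ℂ) : Continuous (prim a g) :=
  continuous_const.add (intervalIntegral.continuous_primitive
    (intervalIntegrable_of_locallyIntegrable hg) 0)

lemma ae_hasDerivAt_prim {g : ℝ → ℂ} (hg : LocallyIntegrable g) (a : ℂ) :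
    ∀ᵐ x, HasDerivAt (prim a g) (g x) x := by
  filter_upwards [_root_.LocallyIntegrable.ae_hasDerivAt_integral hg] with x hx
  exact (hx 0).const_add a

lemma absolutelyContinuousOnInterval_const {E : Type*} [NormedAddCommGroup E] (c : E) (x y : ℝ) :
    AbsolutelyContinuousOnInterval (fun _ : ℝ => c) x y :=
  ((LipschitzWith.const c).lipschitzOnWith (s := uIcc x y)).absolutelyContinuousOnInterval

lemma absolutelyContinuousOnInterval_integral {h : ℝ → ℝ} (hh : LocallyIntegrable h) (x y : ℝ) :
    AbsolutelyContinuousOnInterval (fun z => ∫ t in (0 : ℝ)..z, h t) x y := by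
  have h1 : IntervalIntegrable h volume (min 0 (min x y)) (max 0 (max x y)) :=
    (hh.integrableOn_isCompact isCompact_uIcc).intervalIntegrable
  refine (h1.absolutelyContinuousOnInterval_intervalIntegral (c := 0) ?_).mono ?_
  · rw [uIcc_of_le (by simp)]; simp
  · rw [uIcc_of_le (a := min 0 (min x y)) (by simp), uIcc]
    exact Icc_subset_Icc (min_le_right _ _) (le_max_right _ _)

lemma locallyIntegrable_re {g : ℝ → ℂ} (hg : LocallyIntegrable g) :
    LocallyIntegrable fun x => (g x).re := fun x => by
  obtain ⟨U, hU, h⟩ := hg x; exact ⟨U, hU, h.re⟩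

lemma locallyIntegrable_im {g : ℝ → ℂ} (hg : LocallyIntegrable g) :
    LocallyIntegrable fun x => (g x).im := fun x => by
  obtain ⟨U, hU, h⟩ := hg x; exact ⟨U, hU, h.im⟩

lemma prim_re {g : ℝ → ℂ} (hg : LocallyIntegrable g) (a : ℂ) (x : ℝ) :
    (prim a g x).re = a.re + ∫ t in (0 : ℝ)..x, (g t).re := by
  have := Complex.reCLM.intervalIntegral_comp_comm
    (intervalIntegrable_of_locallyIntegrable hg 0 x)
  simp only [Complex.reCLM_apply] at this
  rw [prim, Complex.add_re, this]

lemma prim_im {g : ℝ → ℂ} (hg : LocallyIntegrable g) (a : ℂ) (x : ℝ) :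
    (prim a g x).im = a.im + ∫ t in (0 : ℝ)..x, (g t).im := by
  have := Complex.imCLM.intervalIntegral_comp_comm
    (intervalIntegrable_of_locallyIntegrable hg 0 x)
  simp only [Complex.imCLM_apply] at this
  rw [prim, Complex.add_im, this]

lemma absolutelyContinuousOnInterval_prim_re {g : ℝ → ℂ} (hg : LocallyIntegrable g) (a : ℂ)
    (x y : ℝ) : AbsolutelyContinuousOnInterval (fun z => (prim a g z).re) x y := by
  simp_rw [prim_re hg]
  exact (absolutelyContinuousOnInterval_const _ _ _).fun_add
    (absolutelyContinuousOnInterval_integral (locallyIntegrable_re hg) x y)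

lemma absolutelyContinuousOnInterval_prim_im {g : ℝ → ℂ} (hg : LocallyIntegrable g) (a : ℂ)
    (x y : ℝ) : AbsolutelyContinuousOnInterval (fun z => (prim a g z).im) x y := by
  simp_rw [prim_im hg]
  exact (absolutelyContinuousOnInterval_const _ _ _).fun_add
    (absolutelyContinuousOnInterval_integral (locallyIntegrable_im hg) x y)

lemma absolutelyContinuousOnInterval_prim {g : ℝ → ℂ} (hg : LocallyIntegrable g) (a : ℂ)
    (x y : ℝ) : AbsolutelyContinuousOnInterval (prim a g) x y := by
  have h := ((absolutelyContinuousOnInterval_prim_re hg a x y).fun_smul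
    (absolutelyContinuousOnInterval_const (1 : ℂ) x y)).fun_add
    ((absolutelyContinuousOnInterval_prim_im hg a x y).fun_smul
    (absolutelyContinuousOnInterval_const Complex.I x y))
  have he : prim a g = fun z => (prim a g z).re • (1 : ℂ) + (prim a g z).im • Complex.I := by
    funext z
    simp
  rw [he]
  exact h

/-- Fundamental theorem of calculus for an absolutely continuous function with a known
integrable a.e. derivative. -/
lemma sub_eq_integral_of_ae_hasDerivAt {H h : ℝ → ℂ} {x y : ℝ}
    (hH : AbsolutelyContinuousOnInterval H x y) (hh : LocallyIntegrable h)
    (hd : ∀ᵐ z, z ∈ uIcc x y → HasDerivAt H (h z) z) :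
    H y - H x = ∫ z in x..y, h z := by
  have hac : AbsolutelyContinuousOnInterval (fun z => H z - prim 0 h z) x y :=
    hH.fun_sub (absolutelyContinuousOnInterval_prim hh 0 x y)
  obtain ⟨C, hC⟩ := hac.const_of_ae_hasDerivAt_zero (by
    filter_upwards [hd, ae_hasDerivAt_prim hh 0] with z hz hz' hm
    simpa using (hz hm).fun_sub hz')
  have h1 := hC x left_mem_uIcc
  have h2 := hC y right_mem_uIcc
  have h3 := intervalIntegral.integral_add_adjacent_intervals
    (intervalIntegrable_of_locallyIntegrable hh 0 x) (intervalIntegrable_of_locallyIntegrable hh x y)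
  simp only [prim, zero_add] at h1 h2
  linear_combination h2 - h1 - h3

lemma sub_eq_integral_of_ae_hasDerivAt_real {H h : ℝ → ℝ} {x y : ℝ}
    (hH : AbsolutelyContinuousOnInterval H x y)
    (hd : ∀ᵐ z, z ∈ uIcc x y → HasDerivAt H (h z) z) :
    H y - H x = ∫ z in x..y, h z := by
  rw [← hH.integral_deriv_eq_sub]
  apply intervalIntegral.integral_congr_ae
  filter_upwards [hd] with z hz hm
  exact (hz (uIoc_subset_uIcc hm)).deriv

/-- Absolute continuity survives products, so the fundamental theorem applies to ψ|f|² even though f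
is differentiable only almost everywhere. It is used with ψ constant and with ψ the transported
slope, which is C¹ only on part of the line. -/
lemma weighted_normSq_prim_sub {g : ℝ → ℂ} (hg : LocallyIntegrable g) (a : ℂ) {ψ ψ' : ℝ → ℝ}
    {x y : ℝ} (hψ : ContDiffOn ℝ 1 ψ (uIcc x y))
    (hψ' : ∀ᵐ z, z ∈ uIcc x y → HasDerivAt ψ (ψ' z) z) :
    ψ y * ‖prim a g y‖ ^ 2 - ψ x * ‖prim a g x‖ ^ 2 =
      ∫ z in x..y, (ψ' z * ‖prim a g z‖ ^ 2 +
        ψ z * (2 * ((prim a g z).re * (g z).re + (prim a g z).im * (g z).im))) := by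
  have hsq : ∀ w : ℂ, ‖w‖ ^ 2 = w.re * w.re + w.im * w.im := fun w => by
    rw [Complex.sq_norm, Complex.normSq_apply]
  have hR := absolutelyContinuousOnInterval_prim_re hg a x y
  have hI := absolutelyContinuousOnInterval_prim_im hg a x y
  have hac := hψ.absolutelyContinuousOnInterval.fun_mul ((hR.fun_mul hR).fun_add (hI.fun_mul hI))
  simp_rw [hsq]
  refine sub_eq_integral_of_ae_hasDerivAt_real hac ?_
  filter_upwards [hψ', ae_hasDerivAt_prim hg a] with z hz hz' hm
  have h1 : HasDerivAt (fun t => (prim a g t).re) (g z).re z :=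
    Complex.reCLM.hasFDerivAt.comp_hasDerivAt z hz'
  have h2 : HasDerivAt (fun t => (prim a g t).im) (g z).im z :=
    Complex.imCLM.hasFDerivAt.comp_hasDerivAt z hz'
  refine ((hz hm).fun_mul ((h1.fun_mul h1).fun_add (h2.fun_mul h2))).congr_deriv ?_
  ring

/-! ### Weak derivatives on the punctured line -/

lemma integrable_test_smul {φ : ℝ → ℝ} (hφ : Continuous φ) (hc : HasCompactSupport φ) {g : ℝ → ℂ}
    (hg : LocallyIntegrable g) : Integrable fun x => φ x • g x :=
  hg.integrable_smul_left_of_hasCompactSupport hφ hc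

lemma continuous_deriv_of_smooth {φ : ℝ → ℝ} (hφ : ContDiff ℝ ((⊤ : ℕ∞) : WithTop ℕ∞) φ) :
    Continuous (deriv φ) := hφ.continuous_deriv (by exact_mod_cast le_top)

/-- The fundamental lemma of the calculus of variations on the open set {0}ᶜ, which has full
measure. It makes the choice in `weakDeriv` harmless. -/
lemma IsWeakDeriv.ae_eq {u g g' : ℝ → ℂ} (h : IsWeakDeriv u g) (h' : IsWeakDeriv u g')
    (hg : LocallyIntegrable g) (hg' : LocallyIntegrable g') : g =ᵐ[volume] g' := by
  have key := isOpen_compl_singleton (x := (0 : ℝ)).ae_eq_zero_of_integral_contDiff_smul_eq_zero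
    (μ := volume) ((hg.sub hg').locallyIntegrableOn _) (fun φ hφ hc hs => by
      have h1 := h φ hφ hc hs
      have h2 := h' φ hφ hc hs
      simp only [Pi.sub_apply, smul_sub]
      rw [integral_sub (integrable_test_smul hφ.continuous hc hg)
        (integrable_test_smul hφ.continuous hc hg'), sub_eq_zero]
      exact neg_injective (h1.symm.trans h2))
  have h0 : ∀ᵐ x : ℝ, x ∈ ({0}ᶜ : Set ℝ) := by simp [ae_iff]
  filter_upwards [key, h0] with x hx hx0
  exact sub_eq_zero.1 (hx hx0)

lemma IsWeakDeriv.congr {u u' g g' : ℝ → ℂ} (h : IsWeakDeriv u g) (hu : u =ᵐ[volume] u')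
    (hg : g =ᵐ[volume] g') : IsWeakDeriv u' g' := by
  intro φ h1 h2 h3
  have e1 : ∫ x, deriv φ x • u' x = ∫ x, deriv φ x • u x :=
    integral_congr_ae (by filter_upwards [hu] with x hx; rw [hx])
  have e2 : ∫ x, φ x • g' x = ∫ x, φ x • g x :=
    integral_congr_ae (by filter_upwards [hg] with x hx; rw [hx])
  rw [e1, e2]
  exact h φ h1 h2 h3

lemma IsWeakDeriv.const_mul {u g : ℝ → ℂ} (h : IsWeakDeriv u g) (c : ℂ) :
    IsWeakDeriv (fun x => c * u x) (fun x => c * g x) := by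
  intro φ h1 h2 h3
  have e : ∀ (r : ℝ → ℝ) (w : ℝ → ℂ), ∫ x, r x • (c * w x) = c * ∫ x, r x • w x := fun r w => by
    rw [← integral_const_mul]; simp only [mul_smul_comm]
  rw [e, e, h φ h1 h2 h3, mul_neg]

lemma IsWeakDeriv.comp_neg {u g : ℝ → ℂ} (h : IsWeakDeriv u g) :
    IsWeakDeriv (fun x => u (-x)) (fun x => -g (-x)) := by
  intro φ h1 h2 h3
  have hk := h (fun x => φ (-x)) (h1.comp contDiff_neg)
    (h2.comp_homeomorph (Homeomorph.neg ℝ)) (by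
      intro x hx
      have h4 : tsupport (fun x => φ (-x)) = (Homeomorph.neg ℝ) ⁻¹' tsupport φ :=
        tsupport_comp_eq_preimage φ (Homeomorph.neg ℝ)
      rw [h4] at hx
      have := h3 hx
      simpa using this)
  have hd : ∀ x, deriv (fun x => φ (-x)) x = -deriv φ (-x) := fun x => deriv_comp_neg φ x
  simp_rw [hd] at hk
  rw [← integral_neg_eq_self, ← integral_neg_eq_self (fun x => φ x • -g (-x))]
  simp only [neg_smul, smul_neg, neg_neg, integral_neg] at hk ⊢
  rw [neg_injective hk]

lemma isWeakDeriv_of_hasDerivAt {u g : ℝ → ℂ} (hu : LocallyIntegrable u)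
    (hg : LocallyIntegrable g) (h : ∀ x, x ≠ 0 → HasDerivAt u (g x) x) : IsWeakDeriv u g := by
  intro φ h1 h2 h3
  have i1 := integrable_test_smul (continuous_deriv_of_smooth h1) h2.deriv hu
  have i2 := integrable_test_smul h1.continuous h2 hg
  have i3 := integrable_test_smul h1.continuous h2 hu
  have hd : ∀ x, HasDerivAt (fun x => φ x • u x) (φ x • g x + deriv φ x • u x) x := by
    intro x
    -- A jump of u at the origin is invisible: the test function vanishes in a neighbourhood of it,
    -- so the product is differentiable everywhere.
    by_cases hx : x = 0
    · have h0 : x ∉ tsupport φ := fun hm => h3 hm hx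
      have he := notMem_tsupport_iff_eventuallyEq.1 h0
      have h4 : (fun x => φ x • u x) =ᶠ[𝓝 x] fun _ => 0 := by
        filter_upwards [he] with y hy
        simp [hy]
      rw [he.deriv_eq, he.eq_of_nhds]
      simpa using (hasDerivAt_const x (0 : ℂ)).congr_of_eventuallyEq h4
    · exact ((h1.differentiable (by simp)) x).hasDerivAt.smul (h x hx)
  have := integral_eq_zero_of_hasDerivAt_of_integrable hd (i2.add i1) i3
  rw [integral_add i2 i1] at this
  linear_combination this

lemma exists_uIcc_of_compactSupport {φ : ℝ → ℝ} (hc : HasCompactSupport φ) :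
    ∃ R : ℝ, 0 < R ∧ ∀ x, R ≤ |x| → φ x = 0 ∧ deriv φ x = 0 := by
  obtain ⟨R, hR⟩ := hc.isBounded.subset_closedBall 0
  refine ⟨max R 0 + 1, by positivity, fun x hx => ?_⟩
  have hx' : x ∉ tsupport φ := fun hm => by
    have := hR hm
    simp only [mem_closedBall_zero_iff, Real.norm_eq_abs] at this
    linarith [le_max_left R 0]
  exact ⟨image_eq_zero_of_notMem_tsupport hx',
    Function.notMem_support.1 fun hm => hx' (support_deriv_subset hm)⟩

lemma integral_deriv_smul_prim {g : ℝ → ℂ} (hg : LocallyIntegrable g) (a : ℂ) {φ : ℝ → ℝ}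
    (h1 : ContDiff ℝ ((⊤ : ℕ∞) : WithTop ℕ∞) φ) (h2 : HasCompactSupport φ) :
    ∫ x, deriv φ x • prim a g x = -∫ x, φ x • g x := by
  obtain ⟨R, hR, hz⟩ := exists_uIcc_of_compactSupport h2
  have hp := (continuous_prim hg a).locallyIntegrable (μ := volume)
  have i1 := integrable_test_smul (continuous_deriv_of_smooth h1) h2.deriv hp
  have i2 := integrable_test_smul h1.continuous h2 hg
  have hac : AbsolutelyContinuousOnInterval (fun x => φ x • prim a g x) (-R) R :=
    ((h1.of_le (by exact_mod_cast le_top)).contDiffOn.absolutelyContinuousOnInterval).fun_smul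
      (absolutelyContinuousOnInterval_prim hg a _ _)
  have hF := sub_eq_integral_of_ae_hasDerivAt hac (i2.add i1).locallyIntegrable (by
    filter_upwards [ae_hasDerivAt_prim hg a] with x hx _
    exact ((h1.differentiable (by simp)) x).hasDerivAt.smul hx)
  rw [(hz R (le_abs_self R)).1, (hz (-R) (by simp [le_abs_self])).1] at hF
  simp only [zero_smul, sub_zero] at hF
  have hs : Function.support (fun x => φ x • g x + deriv φ x • prim a g x) ⊆ Ioc (-R) R := by
    intro x hx
    by_contra hm
    apply hx
    have : R ≤ |x| := by
      by_contra hlt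
      rw [not_le, abs_lt] at hlt
      exact hm ⟨hlt.1, hlt.2.le⟩
    simp [hz x this]
  have hI := intervalIntegral.integral_eq_integral_of_support_subset hs (μ := volume)
  have : ∫ x, (φ x • g x + deriv φ x • prim a g x) = 0 := by rw [← hI]; exact hF.symm
  rw [integral_add i2 i1] at this
  linear_combination this

/-- The du Bois-Reymond lemma on the positive half-line. -/
lemma exists_ae_eq_const_of_integral_deriv_smul_eq_zero {h : ℝ → ℂ} (hh : LocallyIntegrable h)
    (h0 : ∀ φ : ℝ → ℝ, ContDiff ℝ ((⊤ : ℕ∞) : WithTop ℕ∞) φ → HasCompactSupport φ →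
      tsupport φ ⊆ Ioi 0 → ∫ x, deriv φ x • h x = 0) :
    ∃ C : ℂ, ∀ᵐ x : ℝ, 0 < x → h x = C := by
  -- A reference bump supported in [1,3], inside the open half-line; pairing h with its
  -- normalization picks out the constant.
  let b : ContDiffBump (2 : ℝ) := ⟨1 / 2, 1, by norm_num, by norm_num⟩
  set η : ℝ → ℝ := b.normed volume with hη
  have hη1 : ContDiff ℝ ((⊤ : ℕ∞) : WithTop ℕ∞) η := b.contDiff_normed
  have hη2 : HasCompactSupport η := b.hasCompactSupport_normed
  have hη3 : ∫ x, η x = 1 := b.integral_normed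
  have hη4 : ∀ x, x < 1 → η x = 0 := fun x hx => by
    apply image_eq_zero_of_notMem_tsupport
    rw [hη, b.tsupport_normed_eq, Metric.mem_closedBall, not_le, Real.dist_eq, abs_sub_comm]
    exact lt_of_lt_of_le (show (1 : ℝ) < 2 - x by linarith) (le_abs_self _)
  refine ⟨∫ x, η x • h x, ?_⟩
  have key := isOpen_Ioi (a := (0 : ℝ)).ae_eq_zero_of_integral_contDiff_smul_eq_zero
    (μ := volume) (f := fun x => h x - ∫ x, η x • h x)
    ((hh.sub (locallyIntegrable_const _)).locallyIntegrableOn _) (fun ψ hψ hc hs => ?_)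
  · filter_upwards [key] with x hx hx0
    exact sub_eq_zero.1 (hx hx0)
  set k : ℝ := ∫ x, ψ x
  -- Subtracting k times the bump makes the mean zero, so the primitive of θ is again compactly
  -- supported in (0,∞) and may be used as a test function.
  set θ : ℝ → ℝ := fun x => ψ x - k * η x with hθ
  have hθ1 : ContDiff ℝ ((⊤ : ℕ∞) : WithTop ℕ∞) θ := hψ.sub (contDiff_const.mul hη1)
  have hθ2 : HasCompactSupport θ := hc.sub hη2.mul_left
  have hθ3 : ∫ x, θ x = 0 := by
    rw [hθ, integral_sub (hψ.continuous.integrable_of_hasCompactSupport hc)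
      ((hη1.continuous.integrable_of_hasCompactSupport hη2).const_mul k), integral_const_mul, hη3]
    simp [k]
  obtain ⟨α, hα, hα'⟩ : ∃ α > 0, ∀ x, x < α → θ x = 0 := by
    obtain ⟨α, hα, hα'⟩ : ∃ α > 0, ∀ x, x < α → ψ x = 0 := by
      rcases (tsupport ψ).eq_empty_or_nonempty with he | hne
      · exact ⟨1, one_pos, fun x _ => image_eq_zero_of_notMem_tsupport (by simp [he])⟩
      · obtain ⟨α, hm, hmin⟩ := hc.exists_isLeast hne
        exact ⟨α, hs hm, fun x hx => image_eq_zero_of_notMem_tsupport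
          fun hx' => absurd (hmin hx') (not_le.2 hx)⟩
    exact ⟨min α 1, by simp [hα], fun x hx => by
      simp [hθ, hα' x (hx.trans_le (min_le_left _ _)), hη4 x (hx.trans_le (min_le_right _ _))]⟩
  obtain ⟨R, hR, hRz⟩ := exists_uIcc_of_compactSupport hθ2
  set φ : ℝ → ℝ := fun x => ∫ t in (0 : ℝ)..x, θ t with hφ
  have hφd : ∀ x, HasDerivAt φ (θ x) x := fun x =>
    intervalIntegral.integral_hasDerivAt_right (hθ1.continuous.intervalIntegrable _ _)
      (hθ1.continuous.stronglyMeasurableAtFilter _ _) hθ1.continuous.continuousAt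
  have hφd' : deriv φ = θ := funext fun x => (hφd x).deriv
  have hφ1 : ContDiff ℝ ((⊤ : ℕ∞) : WithTop ℕ∞) φ := by
    rw [contDiff_infty_iff_deriv]
    exact ⟨fun x => (hφd x).differentiableAt, hφd' ▸ hθ1⟩
  have hφl : ∀ x, x ≤ α → φ x = 0 := fun x hx => by
    have : ∀ t ∈ uIoc 0 x, t ≠ α → θ t = 0 := fun t ht hne => hα' t (lt_of_le_of_ne (by
      rcases mem_uIoc.1 ht with h | h
      · exact h.2.trans hx
      · exact h.2.trans hα.le) hne)
    rw [hφ]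
    exact intervalIntegral.integral_zero_ae (by
      have : ∀ᵐ t : ℝ, t ≠ α := by simp [ae_iff]
      filter_upwards [this] with t h1 h2
      exact ‹∀ t ∈ uIoc 0 x, t ≠ α → θ t = 0› t h2 h1)
  have hφr : ∀ x, R ≤ x → φ x = 0 := fun x hx => by
    have hs' : Function.support θ ⊆ Ioc 0 x := by
      intro t ht
      refine ⟨?_, ?_⟩
      · by_contra hle
        exact ht (hα' t (lt_of_le_of_lt (not_lt.1 hle) hα))
      · by_contra hle
        exact ht (hRz t (hx.trans ((not_le.1 hle).le.trans (le_abs_self _)))).1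
    rw [hφ]
    exact (intervalIntegral.integral_eq_integral_of_support_subset hs').trans hθ3
  have hsub : tsupport φ ⊆ Icc α R := by
    refine closure_minimal (fun x hx => ⟨?_, ?_⟩) isClosed_Icc
    · by_contra hle; exact hx (hφl x (not_le.1 hle).le)
    · by_contra hle; exact hx (hφr x (not_le.1 hle).le)
  have hres := h0 φ hφ1 (isCompact_Icc.of_isClosed_subset (isClosed_tsupport _) hsub)
    (hsub.trans fun x hx => lt_of_lt_of_le hα hx.1)
  have i1 := integrable_test_smul hψ.continuous hc hh
  have i2 := integrable_test_smul hη1.continuous hη2 hh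
  rw [hφd'] at hres
  simp only [hθ, sub_smul, mul_smul] at hres
  have i3 : Integrable fun x => k • η x • h x := i2.smul k
  rw [integral_sub i1 i3, integral_smul] at hres
  simp only [smul_sub]
  rw [integral_sub i1 ((hψ.continuous.integrable_of_hasCompactSupport hc).smul_const _),
    integral_smul_const]
  exact hres

/-- The difference between u and a primitive of g has zero weak derivative on (0,∞), hence is
constant there by du Bois-Reymond. -/
lemma IsWeakDeriv.exists_eq_prim_right {u g : ℝ → ℂ} (h : IsWeakDeriv u g)
    (hu : LocallyIntegrable u) (hg : LocallyIntegrable g) :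
    ∃ a : ℂ, ∀ᵐ x : ℝ, 0 < x → u x = prim a g x := by
  have hp := (continuous_prim hg 0).locallyIntegrable (μ := volume)
  obtain ⟨C, hC⟩ := exists_ae_eq_const_of_integral_deriv_smul_eq_zero (hu.sub hp)
    (fun φ h1 h2 h3 => by
      have e1 := h φ h1 h2 (h3.trans fun x hx => ne_of_gt hx)
      have e2 := integral_deriv_smul_prim hg 0 h1 h2
      simp only [Pi.sub_apply, smul_sub]
      rw [integral_sub (integrable_test_smul (continuous_deriv_of_smooth h1) h2.deriv hu)
        (integrable_test_smul (continuous_deriv_of_smooth h1) h2.deriv hp), e1, e2, sub_self])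
  refine ⟨C, ?_⟩
  filter_upwards [hC] with x hx hx0
  have := hx hx0
  simp only [Pi.sub_apply, prim, zero_add] at this
  rw [prim]
  linear_combination this

lemma ae_comp_neg {p : ℝ → Prop} (h : ∀ᵐ x : ℝ, p x) : ∀ᵐ x : ℝ, p (-x) :=
  (Measure.measurePreserving_neg (volume : Measure ℝ)).quasiMeasurePreserving.ae h

lemma LocallyIntegrable.comp_neg_real {g : ℝ → ℂ} (hg : LocallyIntegrable g) :
    LocallyIntegrable fun x => g (-x) := fun x => by
  obtain ⟨U, hU, h⟩ := hg (-x)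
  refine ⟨Neg.neg ⁻¹' U, continuous_neg.continuousAt hU, ?_⟩
  exact ((Measure.measurePreserving_neg (volume : Measure ℝ)).integrableOn_comp_preimage
    (Homeomorph.neg ℝ).measurableEmbedding).2 h

/-- Reflection turns the left half into a function on (0,∞), so that the variational analysis is
only done on the positive half-line. -/
lemma IsWeakDeriv.exists_eq_prim_left {u g : ℝ → ℂ} (h : IsWeakDeriv u g)
    (hu : LocallyIntegrable u) (hg : LocallyIntegrable g) :
    ∃ a : ℂ, ∀ᵐ x : ℝ, 0 < x → u (-x) = prim a (fun y => -g (-y)) x :=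
  h.comp_neg.exists_eq_prim_right (LocallyIntegrable.comp_neg_real hu)
    (LocallyIntegrable.comp_neg_real hg).neg

/-! ### One-sided traces and continuous representatives -/

/-- Every interval (l,0) has positive measure. Nontriviality of the filter is what makes essential
limits unique, so that `limUnder` computes them. -/
instance neBot_left : NeBot (𝓝[<] (0 : ℝ) ⊓ ae volume) := by
  rw [inf_neBot_iff]
  intro s hs t ht
  obtain ⟨l, hl, hls⟩ := (mem_nhdsLT_iff_exists_Ioo_subset).1 hs
  by_contra hne
  have h1 : Ioo l 0 ⊆ tᶜ := fun x hx hxt => hne ⟨x, hls hx, hxt⟩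
  have h2 : volume (Ioo l 0) = 0 := measure_mono_null h1 (mem_ae_iff.1 ht)
  simp at h2
  exact absurd hl (not_lt.2 h2)

instance neBot_right : NeBot (𝓝[>] (0 : ℝ) ⊓ ae volume) := by
  rw [inf_neBot_iff]
  intro s hs t ht
  obtain ⟨l, hl, hls⟩ := (mem_nhdsGT_iff_exists_Ioo_subset).1 hs
  by_contra hne
  have h1 : Ioo 0 l ⊆ tᶜ := fun x hx hxt => hne ⟨x, hls hx, hxt⟩
  have h2 : volume (Ioo 0 l) = 0 := measure_mono_null h1 (mem_ae_iff.1 ht)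
  simp at h2
  exact absurd hl (not_lt.2 h2)

lemma traceLeft_eq {u U : ℝ → ℂ} {a : ℂ} (hu : ∀ᵐ x : ℝ, x < 0 → u x = U x)
    (hU : Tendsto U (𝓝[<] 0) (𝓝 a)) : traceLeft u = a := by
  refine Tendsto.limUnder_eq ?_
  refine (hU.mono_left (inf_le_left (b := ae volume))).congr' ?_
  have h1 : ∀ᶠ x in 𝓝[<] (0 : ℝ) ⊓ ae volume, x < 0 :=
    (eventually_mem_nhdsWithin).filter_mono inf_le_left
  filter_upwards [h1, hu.filter_mono inf_le_right] with x hx hx'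
  exact (hx' hx).symm

lemma traceRight_eq {u U : ℝ → ℂ} {a : ℂ} (hu : ∀ᵐ x : ℝ, 0 < x → u x = U x)
    (hU : Tendsto U (𝓝[>] 0) (𝓝 a)) : traceRight u = a := by
  refine Tendsto.limUnder_eq ?_
  refine (hU.mono_left (inf_le_left (b := ae volume))).congr' ?_
  have h1 : ∀ᶠ x in 𝓝[>] (0 : ℝ) ⊓ ae volume, 0 < x :=
    (eventually_mem_nhdsWithin).filter_mono inf_le_left
  filter_upwards [h1, hu.filter_mono inf_le_right] with x hx hx'
  exact (hx' hx).symm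

lemma traceLeft_congr {u w : ℝ → ℂ} (h : u =ᵐ[volume] w) : traceLeft u = traceLeft w := by
  have : u =ᶠ[𝓝[<] (0 : ℝ) ⊓ ae volume] w := h.filter_mono inf_le_right
  rw [traceLeft, traceLeft, limUnder, limUnder, map_congr this]

lemma traceRight_congr {u w : ℝ → ℂ} (h : u =ᵐ[volume] w) : traceRight u = traceRight w := by
  have : u =ᶠ[𝓝[>] (0 : ℝ) ⊓ ae volume] w := h.filter_mono inf_le_right
  rw [traceRight, traceRight, limUnder, limUnder, map_congr this]

lemma MemH1.weakDeriv_spec {u : ℝ → ℂ} (h : MemH1 u) :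
    MemLp (weakDeriv u) 2 volume ∧ IsWeakDeriv u (weakDeriv u) := by
  rw [weakDeriv, dif_pos h.2]
  exact h.2.choose_spec

lemma locallyIntegrable_of_memLp_two {g : ℝ → ℂ} (h : MemLp g 2 volume) : LocallyIntegrable g :=
  h.locallyIntegrable (by norm_num)

lemma weakDeriv_ae_eq {u g : ℝ → ℂ} (hu : MemLp u 2 volume) (hg : MemLp g 2 volume)
    (h : IsWeakDeriv u g) : weakDeriv u =ᵐ[volume] g := by
  have hs := MemH1.weakDeriv_spec (u := u) ⟨hu, g, hg, h⟩
  exact hs.2.ae_eq h (locallyIntegrable_of_memLp_two hs.1) (locallyIntegrable_of_memLp_two hg)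

/-- One-sided continuous representatives of an `H¹(ℝ ∖ {0})` function, and its traces. -/
lemma MemH1.exists_prim {u : ℝ → ℂ} (h : MemH1 u) :
    (∀ᵐ x : ℝ, 0 < x → u x = prim (traceRight u) (weakDeriv u) x) ∧
      ∀ᵐ x : ℝ, 0 < x → u (-x) = prim (traceLeft u) (fun y => -weakDeriv u (-y)) x := by
  obtain ⟨h1, h2⟩ := h.weakDeriv_spec
  have hu := locallyIntegrable_of_memLp_two h.1
  have hg := locallyIntegrable_of_memLp_two h1
  obtain ⟨a, ha⟩ := h2.exists_eq_prim_right hu hg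
  obtain ⟨b, hb⟩ := h2.exists_eq_prim_left hu hg
  have ta : traceRight u = a := traceRight_eq ha (by
    have := (continuous_prim hg a).tendsto 0
    rw [prim_zero] at this
    exact this.mono_left nhdsWithin_le_nhds)
  have tb : traceLeft u = b := by
    refine traceLeft_eq (U := fun x => prim b (fun y => -weakDeriv u (-y)) (-x)) ?_ ?_
    · filter_upwards [ae_comp_neg hb] with x hx hx0
      simpa using hx (by linarith)
    · have hc := (continuous_prim (LocallyIntegrable.comp_neg_real hg).neg b).comp continuous_neg
      have := hc.tendsto 0
      simp only [Function.comp_apply, neg_zero, prim_zero] at this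
      exact this.mono_left nhdsWithin_le_nhds
  exact ⟨ta ▸ ha, tb ▸ hb⟩

/-! ### The soliton expressed through tanh -/

lemma one_sub_tanh_sq (x : ℝ) : 1 - Real.tanh x ^ 2 = (Real.cosh x ^ 2)⁻¹ := by
  have h := (Real.cosh_pos x).ne'
  rw [Real.tanh_eq_sinh_div_cosh]
  field_simp
  linarith [Real.cosh_sq x]

lemma one_sub_tanh_sq_pos (x : ℝ) : 0 < 1 - Real.tanh x ^ 2 := by
  linarith [Real.tanh_sq_lt_one x]

lemma hasDerivAt_tanh (x : ℝ) : HasDerivAt Real.tanh (1 - Real.tanh x ^ 2) x := by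
  have h := (Real.cosh_pos x).ne'
  have h1 := (Real.hasDerivAt_sinh x).fun_div (Real.hasDerivAt_cosh x) h
  simp_rw [← Real.tanh_eq_sinh_div_cosh] at h1
  refine h1.congr_deriv ?_
  rw [Real.tanh_eq_sinh_div_cosh]
  field_simp

lemma one_sub_sq_pos {t : ℝ} (ht : t ∈ Ioo (-1 : ℝ) 1) : 0 < 1 - t ^ 2 := by
  nlinarith [ht.1, ht.2]

section Soliton

variable {μ ω : ℝ}

lemma soliton_eq (hμ : 0 < μ) (hω : 0 < ω) (x : ℝ) :
    soliton μ ω x = (ω * (μ + 1) * (1 - Real.tanh (μ * √ω * x) ^ 2)) ^ (1 / (2 * μ)) := by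
  have hc := Real.cosh_pos (μ * √ω * x)
  rw [soliton, one_sub_tanh_sq,
    Real.mul_rpow (x := ω * (μ + 1)) (y := (Real.cosh (μ * √ω * x) ^ 2)⁻¹) (by positivity)
      (by positivity),
    Real.inv_rpow (by positivity), ← Real.rpow_natCast, ← Real.rpow_mul hc.le,
    ← Real.rpow_neg hc.le]
  congr 2
  push_cast
  field_simp

lemma soliton_pos (hμ : 0 < μ) (hω : 0 < ω) (x : ℝ) : 0 < soliton μ ω x := by
  rw [soliton_eq hμ hω]
  have := one_sub_tanh_sq_pos (μ * √ω * x)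
  positivity

lemma soliton_rpow (hμ : 0 < μ) (hω : 0 < ω) (x r : ℝ) :
    soliton μ ω x ^ r = (ω * (μ + 1) * (1 - Real.tanh (μ * √ω * x) ^ 2)) ^ (r / (2 * μ)) := by
  have := one_sub_tanh_sq_pos (μ * √ω * x)
  rw [soliton_eq hμ hω, ← Real.rpow_mul (by positivity)]
  congr 1
  ring

lemma soliton_rpow_two_mul (hμ : 0 < μ) (hω : 0 < ω) (x : ℝ) :
    soliton μ ω x ^ (2 * μ) = ω * (μ + 1) * (1 - Real.tanh (μ * √ω * x) ^ 2) := by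
  rw [soliton_rpow hμ hω, div_self (by positivity), Real.rpow_one]

/-- The logarithmic derivative is -√ω tanh: the soliton solves the linear equation f' = √ωθf with θ
= -tanh, which is the equality condition of the half-line inequality. -/
lemma hasDerivAt_soliton (hμ : 0 < μ) (x : ℝ) :
    HasDerivAt (soliton μ ω) (-(√ω * Real.tanh (μ * √ω * x)) * soliton μ ω x) x := by
  have hc := Real.cosh_pos (μ * √ω * x)
  have h1 : HasDerivAt (fun x => μ * √ω * x) (μ * √ω) x := by
    simpa using (hasDerivAt_id x).const_mul (μ * √ω)
  have h2 := ((((Real.hasDerivAt_cosh (μ * √ω * x)).comp x h1).rpow_const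
    (p := -(1 / μ)) (Or.inl hc.ne'))).const_mul ((ω * (μ + 1)) ^ (1 / (2 * μ)))
  refine h2.congr_deriv ?_
  simp only [Function.comp_apply]
  rw [soliton, Real.rpow_sub hc, Real.rpow_one, Real.tanh_eq_sinh_div_cosh]
  field_simp

lemma continuous_soliton (hμ : 0 < μ) : Continuous (soliton μ ω) :=
  continuous_iff_continuousAt.2 fun x => (hasDerivAt_soliton hμ x).continuousAt

lemma mul_shift (hμ : 0 < μ) (hω : 0 < ω) {T : ℝ} (hT : T ∈ Ioo (-1 : ℝ) 1) :
    μ * √ω * shift μ ω T = Real.artanh T := by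
  have := Real.sqrt_pos.2 hω
  rw [shift, Real.artanh_eq_half_log (Ioo_subset_Icc_self hT)]
  field_simp

lemma tanh_mul_shift (hμ : 0 < μ) (hω : 0 < ω) {T : ℝ} (hT : T ∈ Ioo (-1 : ℝ) 1) :
    Real.tanh (μ * √ω * shift μ ω T) = T := by
  rw [mul_shift hμ hω hT, Real.tanh_artanh hT]

lemma soliton_neg (x : ℝ) : soliton μ ω (-x) = soliton μ ω x := by
  simp [soliton]

lemma shift_neg {T : ℝ} : shift μ ω (-T) = -shift μ ω T := by
  rw [shift, shift, ← mul_neg, ← Real.log_inv, inv_div]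
  ring_nf

end Soliton

/-! ### The mass function of a truncated soliton and its inverse -/

section HalfMass

variable {μ : ℝ}

/-- `∫_{-1}^t (1 - r²)^{1/μ} dr`. -/
def halfMass (μ t : ℝ) : ℝ := ∫ r in (-1 : ℝ)..t, (1 - r ^ 2) ^ (1 / μ)

lemma continuous_massDensity (hμ : 0 < μ) : Continuous fun r : ℝ => (1 - r ^ 2) ^ (1 / μ) :=
  (by fun_prop : Continuous fun r : ℝ => 1 - r ^ 2).rpow_const
    fun _ => Or.inr (by positivity)

lemma hasDerivAt_halfMass (hμ : 0 < μ) (t : ℝ) :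
    HasDerivAt (halfMass μ) ((1 - t ^ 2) ^ (1 / μ)) t :=
  intervalIntegral.integral_hasDerivAt_right ((continuous_massDensity hμ).intervalIntegrable _ _)
    ((continuous_massDensity hμ).stronglyMeasurableAtFilter _ _)
    (continuous_massDensity hμ).continuousAt

lemma continuous_halfMass (hμ : 0 < μ) : Continuous (halfMass μ) :=
  continuous_iff_continuousAt.2 fun x => (hasDerivAt_halfMass hμ x).continuousAt

lemma strictMonoOn_halfMass (hμ : 0 < μ) : StrictMonoOn (halfMass μ) (Icc (-1) 1) := by
  refine strictMonoOn_of_deriv_pos (convex_Icc _ _) (continuous_halfMass hμ).continuousOn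
    fun x hx => ?_
  rw [interior_Icc] at hx
  rw [(hasDerivAt_halfMass hμ x).deriv]
  exact Real.rpow_pos_of_pos (one_sub_sq_pos hx) _

lemma halfMass_neg_one : halfMass μ (-1) = 0 := by simp [halfMass]

lemma halfMass_nonneg (hμ : 0 < μ) {t : ℝ} (ht : t ∈ Icc (-1 : ℝ) 1) : 0 ≤ halfMass μ t := by
  rw [← halfMass_neg_one (μ := μ)]
  exact (strictMonoOn_halfMass hμ).monotoneOn (by simp) ht ht.1

lemma halfMass_add_halfMass_neg (hμ : 0 < μ) (t : ℝ) :
    halfMass μ t + halfMass μ (-t) = halfMass μ 1 := by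
  have hi := fun a b => (continuous_massDensity hμ).intervalIntegrable (μ := volume) a b
  have h1 : halfMass μ (-t) = ∫ r in t..1, (1 - r ^ 2) ^ (1 / μ) := by
    have := intervalIntegral.integral_comp_neg (a := t) (b := 1)
      (fun r : ℝ => (1 - r ^ 2) ^ (1 / μ))
    simp only [neg_sq] at this
    rw [halfMass, ← this]
  rw [h1, halfMass, halfMass, intervalIntegral.integral_add_adjacent_intervals (hi _ _) (hi _ _)]

lemma halfMass_add_halfMass_neg' (hμ : 0 < μ) (a b : ℝ) :
    halfMass μ a + halfMass μ (-b) =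
      (∫ t in (-1 : ℝ)..1, (1 - t ^ 2) ^ (1 / μ)) - ∫ t in a..b, (1 - t ^ 2) ^ (1 / μ) := by
  have hi := fun a b => (continuous_massDensity hμ).intervalIntegrable (μ := volume) a b
  have h1 := halfMass_add_halfMass_neg hμ b
  have h2 := intervalIntegral.integral_add_adjacent_intervals (hi (-1) a) (hi a b)
  simp only [halfMass] at *
  linarith

lemma exists_halfMass_eq (hμ : 0 < μ) {y : ℝ} (h0 : 0 ≤ y) (h1 : y < halfMass μ 1) :
    ∃ t ∈ Ico (-1 : ℝ) 1, halfMass μ t = y := by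
  have := intermediate_value_Ico (show (-1 : ℝ) ≤ 1 by norm_num)
    (continuous_halfMass hμ).continuousOn
  rw [halfMass_neg_one] at this
  exact this ⟨h0, h1⟩

/-- Strict monotonicity gives the inverse, surjectivity onto the open interval gives its continuity,
and the positive derivative of `halfMass` gives its differentiability. The transported slope is this
inverse applied to the remaining mass. -/
lemma exists_halfMass_inverse (hμ : 0 < μ) :
    ∃ k : ℝ → ℝ, (∀ t ∈ Ioo (-1 : ℝ) 1, k (halfMass μ t) = t) ∧
      ∀ y ∈ Ioo 0 (halfMass μ 1), k y ∈ Ioo (-1 : ℝ) 1 ∧ halfMass μ (k y) = y ∧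
        HasDerivAt k ((1 - k y ^ 2) ^ (1 / μ))⁻¹ y := by
  have hmono := (strictMonoOn_halfMass hμ).mono (Ioo_subset_Icc_self (a := (-1 : ℝ)) (b := 1))
  have hsurj : SurjOn (halfMass μ) (Ioo (-1) 1) (Ioo 0 (halfMass μ 1)) := fun y hy => by
    obtain ⟨t, ht, rfl⟩ := exists_halfMass_eq hμ hy.1.le hy.2
    refine ⟨t, ⟨lt_of_le_of_ne ht.1 fun he => ?_, ht.2⟩, rfl⟩
    rw [← he, halfMass_neg_one] at hy
    exact lt_irrefl _ hy.1
  have hmaps : ∀ t ∈ Ioo (-1 : ℝ) 1, halfMass μ t ∈ Ioo 0 (halfMass μ 1) := fun t ht => by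
    have h1 := strictMonoOn_halfMass hμ (a := -1) (b := t) (by simp) (Ioo_subset_Icc_self ht) ht.1
    have h2 := strictMonoOn_halfMass hμ (a := t) (b := 1) (Ioo_subset_Icc_self ht) (by simp) ht.2
    rw [halfMass_neg_one] at h1
    exact ⟨h1, h2⟩
  set k := Function.invFunOn (halfMass μ) (Ioo (-1) 1) with hk
  have hk1 : ∀ y ∈ Ioo 0 (halfMass μ 1), k y ∈ Ioo (-1 : ℝ) 1 ∧ halfMass μ (k y) = y :=
    fun y hy => ⟨Function.invFunOn_mem (hsurj hy), Function.invFunOn_eq (hsurj hy)⟩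
  have hk2 : ∀ t ∈ Ioo (-1 : ℝ) 1, k (halfMass μ t) = t := fun t ht =>
    hmono.injOn (hk1 _ (hmaps t ht)).1 ht (hk1 _ (hmaps t ht)).2
  refine ⟨k, hk2, fun y hy => ⟨(hk1 y hy).1, (hk1 y hy).2, ?_⟩⟩
  have hkm : StrictMonoOn k (Ioo 0 (halfMass μ 1)) := fun a ha b hb hab => by
    refine (hmono.lt_iff_lt (hk1 a ha).1 (hk1 b hb).1).1 ?_
    rwa [(hk1 a ha).2, (hk1 b hb).2]
  have himg : k '' Ioo 0 (halfMass μ 1) = Ioo (-1) 1 := by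
    refine Subset.antisymm ?_ fun t ht => ⟨_, hmaps t ht, hk2 t ht⟩
    rintro _ ⟨y, hy, rfl⟩
    exact (hk1 y hy).1
  have hcont : ContinuousAt k y := hkm.continuousAt_of_image_mem_nhds (Ioo_mem_nhds hy.1 hy.2) (by
    rw [himg]; exact Ioo_mem_nhds (hk1 y hy).1.1 (hk1 y hy).1.2)
  refine HasDerivAt.of_local_left_inverse hcont (hasDerivAt_halfMass hμ _)
    (Real.rpow_pos_of_pos (one_sub_sq_pos (hk1 y hy).1) _).ne' ?_
  filter_upwards [Ioo_mem_nhds hy.1 hy.2] with z hz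
  exact (hk1 z hz).2

end HalfMass

/-! ### The pointwise Young inequality -/

section Young

variable {μ ω : ℝ}

/-- The factor relating `∫ φ_ω^{2μ+2}` to `∫ (1-t²)^{1/μ}`. -/
def massConst (μ ω : ℝ) : ℝ := (μ + 1) ^ (1 / μ + 1) / μ * ω ^ (1 / μ + 1 / 2)

lemma massConst_pos (hμ : 0 < μ) (hω : 0 < ω) : 0 < massConst μ ω := by
  unfold massConst; positivity

lemma massConst_mul_rpow (hμ : 0 < μ) (hω : 0 < ω) {z : ℝ} (hz : 0 < z) :
    massConst μ ω * z ^ (1 / μ) = √ω * ((μ + 1) / μ) * (ω * (μ + 1) * z) ^ (1 / μ) := by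
  rw [massConst, Real.mul_rpow (by positivity) hz.le, Real.mul_rpow hω.le (by positivity),
    Real.rpow_add hω, Real.rpow_add (by positivity), Real.rpow_one, ← Real.sqrt_eq_rpow]
  ring

/-- Bernoulli's inequality for (1 + (η - 1))^p; its strict form gives the equality case in
`eq_one_of_young_one`. -/
lemma le_young_one {p η : ℝ} (hp : 1 < p) (hη : 0 ≤ η) : η ≤ 1 / p * η ^ p + (1 - 1 / p) := by
  have h := one_add_mul_self_le_rpow_one_add (s := η - 1) (by linarith) hp.le
  rw [add_sub_cancel] at h
  have hp0 : 0 < p := by linarith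
  have : 1 / p * (1 + p * (η - 1)) ≤ 1 / p * η ^ p := by gcongr
  have e : 1 / p * (1 + p * (η - 1)) = η - (1 - 1 / p) := by field_simp; ring
  linarith

lemma eq_one_of_young_one {p η : ℝ} (hp : 1 < p) (hη : 0 ≤ η)
    (h : 1 / p * η ^ p + (1 - 1 / p) ≤ η) : η = 1 := by
  by_contra hne
  have h' := one_add_mul_self_lt_rpow_one_add (s := η - 1) (by linarith) (sub_ne_zero.2 hne) hp
  rw [add_sub_cancel] at h'
  have hp0 : 0 < p := by linarith
  have : 1 / p * (1 + p * (η - 1)) < 1 / p * η ^ p := by gcongr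
  have e : 1 / p * (1 + p * (η - 1)) = η - (1 - 1 / p) := by field_simp; ring
  linarith

/-- The defect in the pointwise Young inequality. -/
def youngGap (μ ω y z : ℝ) : ℝ :=
  √ω * y ^ 2 * (y ^ (2 * μ + 2) / (massConst μ ω * z ^ (1 / μ))) + ω * z * y ^ 2 - y ^ (2 * μ + 2)

/-- With p = 1 + 1/μ and η = y^{2μ}/(ω(μ+1)z), the gap is a positive factor times the one-variable
Young defect. The equality η = 1 is the relation between the soliton and 1 - tanh² found in
`soliton_rpow_two_mul`. -/
lemma youngGap_eq (hμ : 0 < μ) (hω : 0 < ω) {y z : ℝ} (hy : 0 < y) (hz : 0 < z) :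
    youngGap μ ω y z = y ^ 2 * (ω * (μ + 1) * z) *
      (1 / (1 / μ + 1) * (y ^ (2 * μ) / (ω * (μ + 1) * z)) ^ (1 / μ + 1) + (1 - 1 / (1 / μ + 1))
        - y ^ (2 * μ) / (ω * (μ + 1) * z)) := by
  have hW : 0 < ω * (μ + 1) * z := by positivity
  have hY : 0 < y ^ (2 * μ) := by positivity
  have e1 : y ^ (2 * μ + 2) = y ^ (2 * μ) * y ^ 2 := by
    rw [Real.rpow_add hy]; norm_num
  have e2 : (y ^ (2 * μ)) ^ (1 / μ) = y ^ 2 := by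
    rw [← Real.rpow_mul hy.le, ← Real.rpow_natCast]; congr 1; field_simp; norm_num
  have hs := Real.sqrt_pos.2 hω
  rw [youngGap, massConst_mul_rpow hμ hω hz, e1, Real.rpow_add (by positivity), Real.rpow_one,
    Real.div_rpow hY.le hW.le, e2]
  have hP : 0 < (ω * (μ + 1) * z) ^ (1 / μ) := by positivity
  generalize (ω * (μ + 1) * z) ^ (1 / μ) = P at hP ⊢
  field_simp
  ring

lemma youngGap_nonneg (hμ : 0 < μ) (hω : 0 < ω) {y z : ℝ} (hy : 0 ≤ y) (hz : 0 < z) :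
    0 ≤ youngGap μ ω y z := by
  rcases hy.eq_or_lt with rfl | hy
  · rw [youngGap, Real.zero_rpow (by positivity)]; simp
  · rw [youngGap_eq hμ hω hy hz]
    have := le_young_one (p := 1 / μ + 1) (η := y ^ (2 * μ) / (ω * (μ + 1) * z))
      (by linarith [one_div_pos.2 hμ]) (by positivity)
    exact mul_nonneg (by positivity) (by linarith)

lemma eq_of_youngGap_eq_zero (hμ : 0 < μ) (hω : 0 < ω) {y z : ℝ} (hy : 0 < y) (hz : 0 < z)
    (h : youngGap μ ω y z = 0) : y ^ (2 * μ) = ω * (μ + 1) * z := by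
  rw [youngGap_eq hμ hω hy hz] at h
  have hW : 0 < ω * (μ + 1) * z := by positivity
  have h' := (mul_eq_zero.1 h).resolve_left (by positivity)
  have := eq_one_of_young_one (p := 1 / μ + 1) (η := y ^ (2 * μ) / (ω * (μ + 1) * z))
      (by linarith [one_div_pos.2 hμ]) (by positivity) (by linarith)
  rwa [div_eq_one_iff_eq hW.ne'] at this

end Young

lemma norm_sq_add_real_mul (w z : ℂ) (r : ℝ) :
    ‖w - (r : ℂ) * z‖ ^ 2 = ‖w‖ ^ 2 - r * (2 * (z.re * w.re + z.im * w.im)) + r ^ 2 * ‖z‖ ^ 2 := by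
  simp only [Complex.sq_norm, Complex.normSq_apply, Complex.sub_re, Complex.sub_im,
    Complex.mul_re, Complex.mul_im, Complex.ofReal_re, Complex.ofReal_im]
  ring

/-! ### The sharp half-line inequality by mass transport -/

section HalfLine

variable {μ ω : ℝ} {a : ℂ} {g : ℝ → ℂ}

/-- The energy density of the half-line problem. -/
def density (ω : ℝ) (a : ℂ) (g : ℝ → ℂ) (x : ℝ) : ℝ := ‖g x‖ ^ 2 + ω * ‖prim a g x‖ ^ 2

lemma density_nonneg (hω : 0 < ω) (x : ℝ) : 0 ≤ density ω a g x := by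
  unfold density; positivity

lemma integrableOn_density (hg : MemLp g 2 volume)
    (hf : MemLp (prim a g) 2 (volume.restrict (Ioi 0))) :
    IntegrableOn (density ω a g) (Ioi 0) :=
  (hg.restrict _).integrable_norm_pow (by norm_num) |>.add
    ((hf.integrable_norm_pow (by norm_num)).const_mul ω)

/-- Nonnegativity of |f' + √ωf|² bounds the density below by -√ω(|f|²)'; integrate from X to a far
point where |f|² is small. This is the slope θ = -1, and it serves three times: as a sup bound, as
the estimate of the discarded tail, and as the zero-mass case. -/
lemma sqrt_mul_normSq_le (hω : 0 < ω) (hg : MemLp g 2 volume)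
    (hf : MemLp (prim a g) 2 (volume.restrict (Ioi 0))) {X : ℝ} (hX : 0 ≤ X) :
    √ω * ‖prim a g X‖ ^ 2 ≤ ∫ x in Ioi X, density ω a g x := by
  have hs := Real.sqrt_pos.2 hω
  have hgl := locallyIntegrable_of_memLp_two hg
  have hi : IntegrableOn (density ω a g) (Ioi X) :=
    (integrableOn_density hg hf).mono_set (Ioi_subset_Ioi hX)
  have hn : IntegrableOn (fun x => ‖prim a g x‖ ^ 2) (Ioi X) :=
    IntegrableOn.mono_set (hf.integrable_norm_pow (p := 2) (by norm_num)) (Ioi_subset_Ioi hX)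
  refine le_of_forall_pos_le_add fun ε hε => ?_
  -- If no such point existed, |f|² would dominate a positive constant on a half-line, contradicting
  -- square integrability.
  obtain ⟨Y, hY, hYε⟩ : ∃ Y, X < Y ∧ √ω * ‖prim a g Y‖ ^ 2 < ε := by
    by_contra! hcon
    have hc : IntegrableOn (fun _ => ε / √ω) (Ioi X) := by
      refine Integrable.mono' hn aestronglyMeasurable_const ?_
      filter_upwards [ae_restrict_mem measurableSet_Ioi] with x hx
      rw [Real.norm_of_nonneg (by positivity), div_le_iff₀ hs]
      linarith [hcon x hx]
    rw [integrableOn_const_iff] at hc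
    simp [(div_pos hε hs).ne'] at hc
  have h1 := weighted_normSq_prim_sub hgl a (ψ := fun _ => √ω) (ψ' := fun _ => 0) (x := X) (y := Y)
    contDiffOn_const (Eventually.of_forall fun z _ => hasDerivAt_const z _)
  have hiY : IntervalIntegrable (density ω a g) volume X Y :=
    (intervalIntegrable_iff_integrableOn_Ioc_of_le hY.le).2 (hi.mono_set Ioc_subset_Ioi_self)
  have hpt : ∀ z, -density ω a g z ≤ 0 * ‖prim a g z‖ ^ 2 +
      √ω * (2 * ((prim a g z).re * (g z).re + (prim a g z).im * (g z).im)) := fun z => by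
    have e := norm_sq_add_real_mul (g z) (prim a g z) (-√ω)
    have : 0 ≤ ‖g z - ((-√ω : ℝ) : ℂ) * prim a g z‖ ^ 2 := by positivity
    rw [e, neg_sq, Real.sq_sqrt hω.le] at this
    unfold density
    linarith
  have h2 : -∫ z in X..Y, density ω a g z ≤ √ω * ‖prim a g Y‖ ^ 2 - √ω * ‖prim a g X‖ ^ 2 := by
    rw [h1, ← intervalIntegral.integral_neg]
    refine intervalIntegral.integral_mono_on hY.le hiY.neg ?_ fun z _ => hpt z
    have hc := continuous_prim hgl a
    have j1 : IntervalIntegrable (fun z => (g z).re) volume X Y :=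
      intervalIntegrable_iff.2 (intervalIntegrable_iff.1
        (intervalIntegrable_of_locallyIntegrable hgl X Y)).re
    have j2 : IntervalIntegrable (fun z => (g z).im) volume X Y :=
      intervalIntegrable_iff.2 (intervalIntegrable_iff.1
        (intervalIntegrable_of_locallyIntegrable hgl X Y)).im
    simp only [zero_mul, zero_add]
    exact (((j1.continuousOn_mul (Complex.continuous_re.comp hc).continuousOn).add
      (j2.continuousOn_mul (Complex.continuous_im.comp hc).continuousOn)).const_mul 2).const_mul _
  have h3 : ∫ z in X..Y, density ω a g z ≤ ∫ z in Ioi X, density ω a g z := by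
    rw [intervalIntegral.integral_of_le hY.le]
    exact setIntegral_mono_set hi (Eventually.of_forall fun z => density_nonneg hω z)
      Ioc_subset_Ioi_self.eventuallyLE
  linarith

lemma continuous_norm_prim_rpow (hμ : 0 < μ) (hg : LocallyIntegrable g) :
    Continuous fun x => ‖prim a g x‖ ^ (2 * μ + 2) :=
  (continuous_prim hg a).norm.rpow_const fun _ => Or.inr (by positivity)

/-- The case ω = 1 of `sqrt_mul_normSq_le` bounds |f|² by a constant C, whence |f|^{2μ+2} ≤ C^μ|f|².
-/
lemma integrableOn_norm_prim_rpow (hμ : 0 < μ) (hg : MemLp g 2 volume)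
    (hf : MemLp (prim a g) 2 (volume.restrict (Ioi 0))) :
    IntegrableOn (fun x => ‖prim a g x‖ ^ (2 * μ + 2)) (Ioi 0) := by
  have hgl := locallyIntegrable_of_memLp_two hg
  set C := ∫ x in Ioi 0, density 1 a g x with hC
  have hb : ∀ x ∈ Ioi (0 : ℝ), ‖prim a g x‖ ^ 2 ≤ C := fun x hx => by
    have h1 := sqrt_mul_normSq_le one_pos hg hf (le_of_lt hx)
    rw [Real.sqrt_one, one_mul] at h1
    exact h1.trans (setIntegral_mono_set (integrableOn_density hg hf)
      (Eventually.of_forall fun z => density_nonneg one_pos z)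
      (Ioi_subset_Ioi (le_of_lt hx)).eventuallyLE)
  refine Integrable.mono' ((hf.integrable_norm_pow (by norm_num)).const_mul (C ^ μ))
    (continuous_norm_prim_rpow hμ hgl).aestronglyMeasurable ?_
  filter_upwards [ae_restrict_mem measurableSet_Ioi] with x hx
  rw [Real.norm_of_nonneg (by positivity), Real.rpow_add_of_nonneg (norm_nonneg _)
    (by positivity) (by norm_num), Real.rpow_mul (norm_nonneg _)]
  norm_num
  gcongr
  exact hb x hx

/-- The remaining mass `∫_x^∞ ‖f‖^{2μ+2}`, extended to negative `x`. -/
def tailMass (μ : ℝ) (a : ℂ) (g : ℝ → ℂ) (x : ℝ) : ℝ :=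
  (∫ y in Ioi 0, ‖prim a g y‖ ^ (2 * μ + 2)) - ∫ y in (0 : ℝ)..x, ‖prim a g y‖ ^ (2 * μ + 2)

lemma hasDerivAt_tailMass (hμ : 0 < μ) (hg : LocallyIntegrable g) (x : ℝ) :
    HasDerivAt (tailMass μ a g) (-‖prim a g x‖ ^ (2 * μ + 2)) x := by
  have hc := continuous_norm_prim_rpow (a := a) hμ hg
  exact (intervalIntegral.integral_hasDerivAt_right (hc.intervalIntegrable _ _)
    (hc.stronglyMeasurableAtFilter _ _) hc.continuousAt).const_sub _

lemma continuous_tailMass (hμ : 0 < μ) (hg : LocallyIntegrable g) :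
    Continuous (tailMass μ a g) :=
  continuous_iff_continuousAt.2 fun x => (hasDerivAt_tailMass hμ hg x).continuousAt

lemma tailMass_zero : tailMass μ a g 0 = ∫ y in Ioi 0, ‖prim a g y‖ ^ (2 * μ + 2) := by
  simp [tailMass]

lemma tailMass_antitone (hμ : 0 < μ) (hg : LocallyIntegrable g) : Antitone (tailMass μ a g) :=
  antitone_of_deriv_nonpos (fun x => (hasDerivAt_tailMass hμ hg x).differentiableAt) fun x => by
    rw [(hasDerivAt_tailMass hμ hg x).deriv]
    have : 0 ≤ ‖prim a g x‖ ^ (2 * μ + 2) := by positivity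
    linarith

lemma tendsto_tailMass (hμ : 0 < μ) (hg : MemLp g 2 volume)
    (hf : MemLp (prim a g) 2 (volume.restrict (Ioi 0))) :
    Tendsto (tailMass μ a g) atTop (𝓝 0) := by
  have h := intervalIntegral_tendsto_integral_Ioi 0 (integrableOn_norm_prim_rpow hμ hg hf)
    tendsto_id
  have h' := h.const_sub (∫ y in Ioi 0, ‖prim a g y‖ ^ (2 * μ + 2))
  rw [sub_self] at h'
  exact h'

lemma exists_tailMass_eq (hμ : 0 < μ) (hg : MemLp g 2 volume)
    (hf : MemLp (prim a g) 2 (volume.restrict (Ioi 0))) {X ε : ℝ} (hε : 0 < ε)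
    (hεm : ε ≤ tailMass μ a g X) : ∃ Y, X ≤ Y ∧ tailMass μ a g Y = ε := by
  obtain ⟨Z, hZ, hXZ⟩ := (((tendsto_tailMass hμ hg hf).eventually_lt_const hε).and
    (eventually_ge_atTop X)).exists
  obtain ⟨Y, hY, hYe⟩ := intermediate_value_Icc' hXZ
    (continuous_tailMass hμ (locallyIntegrable_of_memLp_two hg)).continuousOn
    (show ε ∈ Icc (tailMass μ a g Z) (tailMass μ a g X) from ⟨hZ.le, hεm⟩)
  exact ⟨Y, hY.1, hYe⟩

end HalfLine

section HalfLine

variable {μ ω : ℝ} {a : ℂ} {g : ℝ → ℂ}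

/-- The defect of optimality of a half-line function with respect to the transported slope `θ`. -/
def defect (μ ω : ℝ) (a : ℂ) (g : ℝ → ℂ) (θ : ℝ → ℝ) (x : ℝ) : ℝ :=
  ‖g x - ((√ω * θ x : ℝ) : ℂ) * prim a g x‖ ^ 2 + youngGap μ ω ‖prim a g x‖ (1 - θ x ^ 2)

/-- Completing the square in f' - √ωθf. When θ is a transport slope, the last bracket is the
derivative of θ|f|², so integration leaves only the defect, the mass and boundary terms. -/
lemma density_eq (hω : 0 < ω) (θ : ℝ → ℝ) (x : ℝ) :
    density ω a g x = defect μ ω a g θ x + ‖prim a g x‖ ^ (2 * μ + 2) +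
      √ω * (-(‖prim a g x‖ ^ (2 * μ + 2) / (massConst μ ω * (1 - θ x ^ 2) ^ (1 / μ))) *
        ‖prim a g x‖ ^ 2 +
        θ x * (2 * ((prim a g x).re * (g x).re + (prim a g x).im * (g x).im))) := by
  rw [defect, norm_sq_add_real_mul, density, youngGap, mul_pow, Real.sq_sqrt hω.le]
  ring

lemma defect_nonneg (hμ : 0 < μ) (hω : 0 < ω) {θ : ℝ → ℝ} {x : ℝ} (h : θ x ∈ Ioo (-1 : ℝ) 1) :
    0 ≤ defect μ ω a g θ x :=
  add_nonneg (by positivity) (youngGap_nonneg hμ hω (norm_nonneg _) (one_sub_sq_pos h))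

/-- A slope function obtained by transporting the mass of `f` to that of a soliton. -/
structure IsTransportSlope (μ ω : ℝ) (a : ℂ) (g : ℝ → ℂ) (θ : ℝ → ℝ) (U : Set ℝ) : Prop where
  isOpen : IsOpen U
  mem_Ioo : ∀ x ∈ U, θ x ∈ Ioo (-1 : ℝ) 1
  mass_eq : ∀ x ∈ U, massConst μ ω * halfMass μ (θ x) = tailMass μ a g x
  hasDerivAt : ∀ x ∈ U, HasDerivAt θ
    (-(‖prim a g x‖ ^ (2 * μ + 2) / (massConst μ ω * (1 - θ x ^ 2) ^ (1 / μ)))) x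

lemma IsTransportSlope.continuousOn {θ : ℝ → ℝ} {U : Set ℝ} (h : IsTransportSlope μ ω a g θ U) :
    ContinuousOn θ U := fun x hx => (h.hasDerivAt x hx).continuousAt.continuousWithinAt

lemma IsTransportSlope.contDiffOn {θ : ℝ → ℝ} {U : Set ℝ} (h : IsTransportSlope μ ω a g θ U)
    (hμ : 0 < μ) (hω : 0 < ω) (hg : LocallyIntegrable g) : ContDiffOn ℝ 1 θ U := by
  have := (contDiffOn_succ_iff_deriv_of_isOpen (𝕜 := ℝ) (n := 0) (f := θ) h.isOpen).2
    ⟨fun x hx => (h.hasDerivAt x hx).differentiableAt.differentiableWithinAt, by simp, ?_⟩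
  · simpa using this
  rw [contDiffOn_zero]
  refine ContinuousOn.congr (f := fun x =>
    -(‖prim a g x‖ ^ (2 * μ + 2) / (massConst μ ω * (1 - θ x ^ 2) ^ (1 / μ)))) ?_
    fun x hx => (h.hasDerivAt x hx).deriv
  refine ((continuous_norm_prim_rpow hμ hg).continuousOn.div (continuousOn_const.mul
    (ContinuousOn.rpow_const (continuousOn_const.sub (h.continuousOn.pow 2)) fun x _ =>
      Or.inr (by positivity))) fun x hx => ?_).neg
  have := Real.rpow_pos_of_pos (one_sub_sq_pos (h.mem_Ioo x hx)) (1 / μ)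
  exact (mul_pos (massConst_pos hμ hω) this).ne'

/-- Apply the inverse of `halfMass` to the remaining mass divided by κ. Because `tailMass` is
extended to negative arguments and θ₀ < 1, the domain U is open and contains a two-sided
neighbourhood of 0 whenever the total mass is positive. -/
lemma exists_isTransportSlope (hμ : 0 < μ) (hω : 0 < ω) (hg : LocallyIntegrable g)
    {θ₀ : ℝ} (hθ₀ : θ₀ ∈ Ioo (-1 : ℝ) 1)
    (hm : tailMass μ a g 0 = massConst μ ω * halfMass μ θ₀) :
    ∃ (θ : ℝ → ℝ) (U : Set ℝ), IsTransportSlope μ ω a g θ U ∧ θ 0 = θ₀ ∧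
      ∀ x, 0 ≤ x → 0 < tailMass μ a g x → x ∈ U := by
  obtain ⟨k, hk1, hk2⟩ := exists_halfMass_inverse hμ
  have hκ := massConst_pos hμ hω
  have hc := continuous_tailMass (a := a) hμ hg
  refine ⟨fun x => k (tailMass μ a g x / massConst μ ω),
    (fun x => tailMass μ a g x / massConst μ ω) ⁻¹' Ioo 0 (halfMass μ 1),
    ⟨(isOpen_Ioo.preimage (hc.div_const _)), fun x hx => (hk2 _ hx).1, fun x hx => ?_,
      fun x hx => ?_⟩, ?_, fun x hx hxm => ⟨by positivity, ?_⟩⟩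
  · rw [(hk2 _ hx).2.1]; field_simp
  · have := (hk2 _ hx).2.2.comp x ((hasDerivAt_tailMass (a := a) hμ hg x).div_const (massConst μ ω))
    refine this.congr_deriv ?_
    beta_reduce
    ring
  · simp only [hm]
    rw [mul_div_cancel_left₀ _ hκ.ne', hk1 _ hθ₀]
  · show tailMass μ a g x / massConst μ ω < halfMass μ 1
    rw [div_lt_iff₀ hκ, mul_comm]
    refine (tailMass_antitone hμ hg hx).trans_lt ?_
    rw [hm]
    exact mul_lt_mul_of_pos_left (strictMonoOn_halfMass hμ (Ioo_subset_Icc_self hθ₀) (by simp)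
      hθ₀.2) hκ

lemma intervalIntegrable_defect (hμ : 0 < μ) (hω : 0 < ω) (hg : MemLp g 2 volume)
    {θ : ℝ → ℝ} {U : Set ℝ} (h : IsTransportSlope μ ω a g θ U) {X : ℝ} (hU : uIcc 0 X ⊆ U) :
    IntervalIntegrable (defect μ ω a g θ) volume 0 X := by
  have hgl := locallyIntegrable_of_memLp_two hg
  have hp := continuous_prim hgl a
  have hθ := h.continuousOn.mono hU
  have i1 : IntervalIntegrable (fun x => ‖g x - ((√ω * θ x : ℝ) : ℂ) * prim a g x‖ ^ 2)
      volume 0 X := by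
    have h1 : MemLp (fun x => ((√ω * θ x : ℝ) : ℂ) * prim a g x) 2
        (volume.restrict (uIcc 0 X)) := by
      have hcont : ContinuousOn (fun x => ((√ω * θ x : ℝ) : ℂ) * prim a g x) (uIcc 0 X) :=
        (Complex.continuous_ofReal.comp_continuousOn (continuousOn_const.mul hθ)).mul
          hp.continuousOn
      obtain ⟨C, hC⟩ := isCompact_uIcc.exists_bound_of_continuousOn hcont
      have : IsFiniteMeasure (volume.restrict (uIcc 0 X)) := ⟨by simp⟩
      refine MemLp.of_bound (hcont.aestronglyMeasurable measurableSet_uIcc) C ?_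
      filter_upwards [ae_restrict_mem measurableSet_uIcc] with x hx using hC x hx
    have h2 := ((hg.restrict (uIcc 0 X)).sub h1).integrable_norm_pow (p := 2) (by norm_num)
    exact IntegrableOn.intervalIntegrable h2
  refine i1.add (ContinuousOn.intervalIntegrable ?_)
  have hn := hp.norm.continuousOn (s := uIcc 0 X)
  have hq := (continuous_norm_prim_rpow (a := a) hμ hgl).continuousOn (s := uIcc 0 X)
  have hz : ContinuousOn (fun x => 1 - θ x ^ 2) (uIcc 0 X) := continuousOn_const.sub (hθ.pow 2)
  refine (((continuousOn_const.mul (hn.pow 2)).mul (hq.div (continuousOn_const.mul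
    (hz.rpow_const fun x _ => Or.inr (by positivity))) fun x hx => ?_)).add
    ((continuousOn_const.mul hz).mul (hn.pow 2))).sub hq
  have := Real.rpow_pos_of_pos (one_sub_sq_pos (h.mem_Ioo x (hU hx))) (1 / μ)
  exact (mul_pos (massConst_pos hμ hω) this).ne'

/-- Integrating `density_eq` over [0,X] leaves the boundary term √ωθ(X)|f(X)|². Since θ(X) > -1, it
is no less than -√ω|f(X)|², which the energy beyond X pays for. -/
lemma integral_defect_le (hμ : 0 < μ) (hω : 0 < ω) (hg : MemLp g 2 volume)
    (hf : MemLp (prim a g) 2 (volume.restrict (Ioi 0)))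
    {θ : ℝ → ℝ} {U : Set ℝ} (h : IsTransportSlope μ ω a g θ U) {X : ℝ} (hX : 0 ≤ X)
    (hU : uIcc 0 X ⊆ U) :
    ∫ x in (0 : ℝ)..X, defect μ ω a g θ x ≤ (∫ x in Ioi 0, density ω a g x)
      + √ω * θ 0 * ‖a‖ ^ 2 - (tailMass μ a g 0 - tailMass μ a g X) := by
  have hgl := locallyIntegrable_of_memLp_two hg
  have hs := Real.sqrt_pos.2 hω
  have hi := integrableOn_density (ω := ω) hg hf
  have iD := intervalIntegrable_defect hμ hω hg h hU
  have iq := (continuous_norm_prim_rpow (a := a) hμ hgl).intervalIntegrable (μ := volume) 0 X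
  have ie : IntervalIntegrable (density ω a g) volume 0 X :=
    (intervalIntegrable_iff_integrableOn_Ioc_of_le hX).2 (hi.mono_set Ioc_subset_Ioi_self)
  have h1 := weighted_normSq_prim_sub hgl a ((h.contDiffOn hμ hω hgl).mono hU)
    (Eventually.of_forall fun z hz => h.hasDerivAt z (hU hz))
  rw [prim_zero] at h1
  have h2 : ∫ x in (0 : ℝ)..X, √ω * (-(‖prim a g x‖ ^ (2 * μ + 2) /
        (massConst μ ω * (1 - θ x ^ 2) ^ (1 / μ))) * ‖prim a g x‖ ^ 2 +
        θ x * (2 * ((prim a g x).re * (g x).re + (prim a g x).im * (g x).im))) =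
      (∫ x in (0 : ℝ)..X, density ω a g x) - (∫ x in (0 : ℝ)..X, defect μ ω a g θ x) -
        ∫ x in (0 : ℝ)..X, ‖prim a g x‖ ^ (2 * μ + 2) := by
    rw [← intervalIntegral.integral_sub ie iD, ← intervalIntegral.integral_sub (ie.sub iD) iq]
    refine intervalIntegral.integral_congr fun x _ => ?_
    simp only [density_eq (μ := μ) hω θ x]
    ring
  rw [intervalIntegral.integral_const_mul, ← h1] at h2
  have h3 := sqrt_mul_normSq_le hω hg hf hX
  have h4 : (∫ x in (0 : ℝ)..X, density ω a g x) + ∫ x in Ioi X, density ω a g x =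
      ∫ x in Ioi 0, density ω a g x :=
    intervalIntegral.integral_interval_add_Ioi hi (hi.mono_set (Ioi_subset_Ioi hX))
  have h5 : tailMass μ a g 0 - tailMass μ a g X =
      ∫ x in (0 : ℝ)..X, ‖prim a g x‖ ^ (2 * μ + 2) := by simp [tailMass]
  have h6 : -(√ω * ‖prim a g X‖ ^ 2) ≤ √ω * (θ X * ‖prim a g X‖ ^ 2) := by
    have := (h.mem_Ioo X (hU right_mem_uIcc)).1
    have h7 : 0 ≤ √ω * ‖prim a g X‖ ^ 2 := by positivity
    nlinarith
  rw [h5]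
  nlinarith

/-- The sharp half-line inequality. -/
lemma halfLine_inequality (hμ : 0 < μ) (hω : 0 < ω) (hg : MemLp g 2 volume)
    (hf : MemLp (prim a g) 2 (volume.restrict (Ioi 0))) {θ₀ : ℝ} (hθ₀ : θ₀ ∈ Ico (-1 : ℝ) 1)
    (hm : (∫ x in Ioi 0, ‖prim a g x‖ ^ (2 * μ + 2)) = massConst μ ω * halfMass μ θ₀) :
    (∫ x in Ioi 0, ‖prim a g x‖ ^ (2 * μ + 2)) - √ω * θ₀ * ‖a‖ ^ 2 ≤
      ∫ x in Ioi 0, density ω a g x := by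
  have hgl := locallyIntegrable_of_memLp_two hg
  -- At θ₀ = -1 the mass is zero and there is nothing to transport; the elementary trace bound is
  -- the claim.
  rcases hθ₀.1.eq_or_lt with he | hlt
  · have h1 := sqrt_mul_normSq_le hω hg hf le_rfl
    rw [prim_zero] at h1
    rw [hm, ← he, halfMass_neg_one]
    linarith
  have hθ : θ₀ ∈ Ioo (-1 : ℝ) 1 := ⟨hlt, hθ₀.2⟩
  have hm0 : 0 < tailMass μ a g 0 := by
    rw [tailMass_zero, hm]
    refine mul_pos (massConst_pos hμ hω) ?_
    rw [← halfMass_neg_one (μ := μ)]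
    exact strictMonoOn_halfMass hμ (by simp) (Ioo_subset_Icc_self hθ) hlt
  obtain ⟨θ, U, hU, h0, hUm⟩ := exists_isTransportSlope hμ hω hgl hθ (tailMass_zero.trans hm)
  rw [← tailMass_zero]
  refine le_of_forall_pos_le_add fun ε hε => ?_
  -- The slope leaves (-1,1) where the remaining mass vanishes, possibly at a finite point. Stopping
  -- while a small positive mass remains costs at most ε.
  obtain ⟨X, hX, hXm⟩ := exists_tailMass_eq hμ hg hf (X := 0) (lt_min hε hm0) (min_le_right _ _)
  have hsub : uIcc 0 X ⊆ U := fun x hx => by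
    rw [uIcc_of_le hX] at hx
    refine hUm x hx.1 (lt_of_lt_of_le ?_ (tailMass_antitone hμ hgl hx.2))
    rw [hXm]; exact lt_min hε hm0
  have key := integral_defect_le hμ hω hg hf hU hX hsub
  have hnn : 0 ≤ ∫ x in (0 : ℝ)..X, defect μ ω a g θ x :=
    intervalIntegral.integral_nonneg hX fun x hx =>
      defect_nonneg hμ hω (hU.mem_Ioo x (hsub (by rwa [uIcc_of_le hX])))
  have : tailMass μ a g X ≤ ε := hXm ▸ min_le_left _ _
  rw [h0] at key
  linarith

end HalfLine

/-! ### Equality in the half-line inequality -/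

/-- Solution formula for a linear first-order equation on a compact interval. -/
lemma eq_exp_integral_smul {E : Type*} [NormedAddCommGroup E] [NormedSpace ℝ E] {y : ℝ → E}
    {b : ℝ → ℝ} {X : ℝ} (hX : 0 < X) (hy : ContinuousOn y (Icc 0 X))
    (hb : ContinuousOn b (Icc 0 X)) (hd : ∀ x ∈ Ioo 0 X, HasDerivAt y (b x • y x) x) {x : ℝ}
    (hx : x ∈ Icc 0 X) : y x = Real.exp (∫ t in (0 : ℝ)..x, b t) • y 0 := by
  set β : ℝ → ℝ := fun x => ∫ t in (0 : ℝ)..x, b t with hβ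
  have hbi : IntervalIntegrable b volume 0 X :=
    ContinuousOn.intervalIntegrable (by rwa [uIcc_of_le hX.le])
  have hβc : ContinuousOn β (Icc 0 X) := by
    have hbI := (intervalIntegrable_iff_integrableOn_Icc_of_le hX.le).1 hbi
    rw [← uIcc_of_le hX.le] at hbI ⊢
    exact intervalIntegral.continuousOn_primitive_interval hbI
  have hβd : ∀ x ∈ Ioo 0 X, HasDerivAt β (b x) x := fun x hx => by
    have hsub : uIcc 0 x ⊆ uIcc 0 X := by
      rw [uIcc_of_le hx.1.le, uIcc_of_le hX.le]; exact Icc_subset_Icc_right hx.2.le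
    refine intervalIntegral.integral_hasDerivAt_right (hbi.mono_set hsub) ?_
      (hb.continuousAt (Icc_mem_nhds hx.1 hx.2))
    exact (hb.mono Ioo_subset_Icc_self).stronglyMeasurableAtFilter isOpen_Ioo x hx
  -- The integrating factor makes h constant on the open interval; continuity extends this to the
  -- endpoints.
  set h : ℝ → E := fun x => Real.exp (-β x) • y x with hh
  have hhd : ∀ x ∈ Ioo 0 X, HasDerivAt h 0 x := fun x hx => by
    have := ((hβd x hx).neg.exp).smul (hd x hx)
    refine this.congr_deriv ?_
    simp only [smul_smul, Pi.neg_apply]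
    rw [← add_smul]
    ring_nf
    simp
  have hhc : ContinuousOn h (Icc 0 X) := (hβc.neg.rexp).smul hy
  obtain ⟨C, hC⟩ := isOpen_Ioo.exists_is_const_of_deriv_eq_zero (𝕜 := ℝ) isPreconnected_Ioo
    (fun x hx => (hhd x hx).differentiableAt.differentiableWithinAt)
    (fun x hx => (hhd x hx).deriv)
  have hE : EqOn h (fun _ => C) (Icc 0 X) :=
    EqOn.of_subset_closure (fun x hx => hC x hx) hhc continuousOn_const Ioo_subset_Icc_self
      (by rw [closure_Ioo hX.ne])
  have h0 : h 0 = y 0 := by simp [hh, hβ]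
  have h1 : h x = y 0 := by rw [hE hx, ← h0, hE (left_mem_Icc.2 hX.le)]
  rw [← h1, hh]
  simp only
  rw [smul_smul, ← Real.exp_add]
  simp [hβ]

/-- Minus tanh solves the Riccati equation θ' = -μ√ω(1 - θ²), the one satisfied by the slope of an
optimizer. -/
lemma tanh_shift_ode (μ ω x₀ x : ℝ) :
    HasDerivAt (fun x => -Real.tanh (μ * √ω * (x + x₀)))
      (-(μ * √ω) * (1 - (-Real.tanh (μ * √ω * (x + x₀))) ^ 2)) x := by
  have h1 : HasDerivAt (fun x => μ * √ω * (x + x₀)) (μ * √ω) x := by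
    simpa using ((hasDerivAt_id x).add_const x₀).const_mul (μ * √ω)
  refine ((hasDerivAt_tanh _).comp x h1).neg.congr_deriv ?_
  ring

section HalfLine

variable {μ ω : ℝ} {a : ℂ} {g : ℝ → ℂ}

/-- The defect is nonnegative, so its integral over [0,X] is at most that over a longer [0,Y];
equality in the energy bounds the latter by the mass remaining at Y, which can be made arbitrarily
small. -/
lemma integral_defect_eq_zero (hμ : 0 < μ) (hω : 0 < ω) (hg : MemLp g 2 volume)
    (hf : MemLp (prim a g) 2 (volume.restrict (Ioi 0)))
    {θ : ℝ → ℝ} {U : Set ℝ} (h : IsTransportSlope μ ω a g θ U)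
    (hUm : ∀ x, 0 ≤ x → 0 < tailMass μ a g x → x ∈ U)
    (heq : ∫ x in Ioi 0, density ω a g x ≤ tailMass μ a g 0 - √ω * θ 0 * ‖a‖ ^ 2)
    {X : ℝ} (hX : 0 ≤ X) (hXm : 0 < tailMass μ a g X) :
    ∫ x in (0 : ℝ)..X, defect μ ω a g θ x = 0 := by
  have hgl := locallyIntegrable_of_memLp_two hg
  have hsub : ∀ Y, 0 ≤ Y → 0 < tailMass μ a g Y → uIcc 0 Y ⊆ U := fun Y hY hYm x hx => by
    rw [uIcc_of_le hY] at hx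
    exact hUm x hx.1 (hYm.trans_le (tailMass_antitone hμ hgl hx.2))
  have hnn : ∀ Y, 0 ≤ Y → 0 < tailMass μ a g Y → ∀ x ∈ Icc 0 Y, 0 ≤ defect μ ω a g θ x :=
    fun Y hY hYm x hx => defect_nonneg hμ hω (h.mem_Ioo x (hsub Y hY hYm (by rwa [uIcc_of_le hY])))
  refine le_antisymm (le_of_forall_pos_le_add fun ε hε => ?_)
    (intervalIntegral.integral_nonneg hX (hnn X hX hXm))
  obtain ⟨Y, hXY, hYm⟩ := exists_tailMass_eq hμ hg hf (lt_min hε hXm) (min_le_right _ _)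
  have hY := hX.trans hXY
  have hYp : 0 < tailMass μ a g Y := by rw [hYm]; exact lt_min hε hXm
  have h1 := integral_defect_le hμ hω hg hf h hY (hsub Y hY hYp)
  have h2 : ∫ x in (0 : ℝ)..X, defect μ ω a g θ x ≤ ∫ x in (0 : ℝ)..Y, defect μ ω a g θ x := by
    refine intervalIntegral.integral_mono_interval le_rfl hX hXY ?_
      (intervalIntegrable_defect hμ hω hg h (hsub Y hY hYp))
    filter_upwards [ae_restrict_mem measurableSet_Ioc] with x hx
    exact hnn Y hY hYp x (Ioc_subset_Icc_self hx)
  have h3 : tailMass μ a g Y ≤ ε := hYm ▸ min_le_left _ _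
  linarith

/-- A nonnegative defect of zero integral vanishes almost everywhere, and so do both of its terms.
The first gives f' = √ωθf, whose continuous right side upgrades it to a classical equation;
continuity likewise makes the Young gap vanish at every interior point. -/
lemma rigidity_on_interval (hμ : 0 < μ) (hω : 0 < ω) (hg : MemLp g 2 volume)
    {θ : ℝ → ℝ} {U : Set ℝ} (h : IsTransportSlope μ ω a g θ U) {X : ℝ} (hX : 0 < X)
    (hU : uIcc 0 X ⊆ U) (h0 : ∫ x in (0 : ℝ)..X, defect μ ω a g θ x = 0) :
    (∀ x ∈ Icc 0 X, prim a g x = Real.exp (∫ t in (0 : ℝ)..x, √ω * θ t) • a) ∧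
    ∀ x ∈ Ioo 0 X, youngGap μ ω ‖prim a g x‖ (1 - θ x ^ 2) = 0 := by
  have hgl := locallyIntegrable_of_memLp_two hg
  have hp := continuous_prim hgl a
  have hU' : Icc 0 X ⊆ U := by rwa [uIcc_of_le hX.le] at hU
  have hθ : ContinuousOn θ (Icc 0 X) := h.continuousOn.mono hU'
  have hnn : ∀ x ∈ Icc 0 X, 0 ≤ youngGap μ ω ‖prim a g x‖ (1 - θ x ^ 2) := fun x hx =>
    youngGap_nonneg hμ hω (norm_nonneg _) (one_sub_sq_pos (h.mem_Ioo x (hU' hx)))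
  have hzero : ∀ᵐ x ∂volume.restrict (Ioc 0 X), defect μ ω a g θ x = 0 := by
    refine (intervalIntegral.integral_eq_zero_iff_of_le_of_nonneg_ae hX.le ?_
      (intervalIntegrable_defect hμ hω hg h hU)).1 h0
    filter_upwards [ae_restrict_mem measurableSet_Ioc] with x hx
    exact defect_nonneg hμ hω (h.mem_Ioo x (hU' (Ioc_subset_Icc_self hx)))
  have hsplit : ∀ᵐ x ∂volume.restrict (Ioc 0 X),
      g x = ((√ω * θ x : ℝ) : ℂ) * prim a g x ∧
        youngGap μ ω ‖prim a g x‖ (1 - θ x ^ 2) = 0 := by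
    filter_upwards [hzero, ae_restrict_mem measurableSet_Ioc] with x hx hm
    have h1 := hnn x (Ioc_subset_Icc_self hm)
    have h2 : 0 ≤ ‖g x - ((√ω * θ x : ℝ) : ℂ) * prim a g x‖ ^ 2 := by positivity
    rw [defect] at hx
    refine ⟨?_, by linarith⟩
    have h3 : ‖g x - ((√ω * θ x : ℝ) : ℂ) * prim a g x‖ ^ 2 = 0 := by linarith
    exact sub_eq_zero.1 (norm_eq_zero.1 (pow_eq_zero_iff (two_ne_zero) |>.1 h3))
  constructor
  · have hbF : ContinuousOn (fun t => ((√ω * θ t : ℝ) : ℂ) * prim a g t) (Icc 0 X) :=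
      (Complex.continuous_ofReal.comp_continuousOn (continuousOn_const.mul hθ)).mul hp.continuousOn
    have hrep : ∀ x ∈ Icc 0 X, prim a g x =
        a + ∫ t in (0 : ℝ)..x, ((√ω * θ t : ℝ) : ℂ) * prim a g t := fun x hx => by
      conv_lhs => rw [prim]
      congr 1
      refine intervalIntegral.integral_congr_ae ?_
      filter_upwards [(ae_restrict_iff' measurableSet_Ioc).1 hsplit] with t ht hm
      rw [uIoc_of_le hx.1] at hm
      exact (ht ⟨hm.1, hm.2.trans hx.2⟩).1
    intro x hx
    have := eq_exp_integral_smul (y := prim a g) (b := fun t => √ω * θ t) hX hp.continuousOn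
      (continuousOn_const.mul hθ) (fun z hz => ?_) hx
    · rwa [prim_zero] at this
    have hd : HasDerivAt (fun x => a + ∫ t in (0 : ℝ)..x, ((√ω * θ t : ℝ) : ℂ) * prim a g t)
        (((√ω * θ z : ℝ) : ℂ) * prim a g z) z := by
      refine (intervalIntegral.integral_hasDerivAt_right ?_ ?_ ?_).const_add a
      · refine ContinuousOn.intervalIntegrable (hbF.mono ?_)
        rw [uIcc_of_le hz.1.le]; exact Icc_subset_Icc_right hz.2.le
      · exact (hbF.mono Ioo_subset_Icc_self).stronglyMeasurableAtFilter isOpen_Ioo z hz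
      · exact hbF.continuousAt (Icc_mem_nhds hz.1 hz.2)
    rw [Complex.real_smul]
    refine hd.congr_of_eventuallyEq ?_
    filter_upwards [Icc_mem_nhds hz.1 hz.2] with t ht using hrep t ht
  · have hz : ContinuousOn (fun x => 1 - θ x ^ 2) (Ioo 0 X) :=
      continuousOn_const.sub ((hθ.mono Ioo_subset_Icc_self).pow 2)
    have hq := (continuous_norm_prim_rpow (a := a) hμ hgl).continuousOn (s := Ioo 0 X)
    have hn := hp.norm.continuousOn (s := Ioo 0 X)
    have hc : ContinuousOn (fun x => youngGap μ ω ‖prim a g x‖ (1 - θ x ^ 2)) (Ioo 0 X) := by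
      refine (((continuousOn_const.mul (hn.pow 2)).mul (hq.div (continuousOn_const.mul
        (hz.rpow_const fun x _ => Or.inr (by positivity))) fun x hx => ?_)).add
        ((continuousOn_const.mul hz).mul (hn.pow 2))).sub hq
      have := Real.rpow_pos_of_pos
        (one_sub_sq_pos (h.mem_Ioo x (hU' (Ioo_subset_Icc_self hx)))) (1 / μ)
      exact (mul_pos (massConst_pos hμ hω) this).ne'
    have hae : (fun x => youngGap μ ω ‖prim a g x‖ (1 - θ x ^ 2)) =ᵐ[volume.restrict (Ioo 0 X)]
        fun _ => 0 := by
      filter_upwards [ae_restrict_of_ae_restrict_of_subset Ioo_subset_Ioc_self hsplit] with x hx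
      exact hx.2
    exact fun x hx => Measure.eqOn_open_of_ae_eq hae isOpen_Ioo hc continuousOn_const hx

/-- Uniqueness of the optimizers in the sharp half-line inequality. -/
lemma halfLine_rigidity (hμ : 0 < μ) (hω : 0 < ω) (hg : MemLp g 2 volume)
    (hf : MemLp (prim a g) 2 (volume.restrict (Ioi 0))) {θ₀ : ℝ} (hθ₀ : θ₀ ∈ Ioo (-1 : ℝ) 1)
    (hm : (∫ x in Ioi 0, ‖prim a g x‖ ^ (2 * μ + 2)) = massConst μ ω * halfMass μ θ₀)
    (heq : ∫ x in Ioi 0, density ω a g x ≤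
      (∫ x in Ioi 0, ‖prim a g x‖ ^ (2 * μ + 2)) - √ω * θ₀ * ‖a‖ ^ 2) :
    ∃ C : ℂ, ‖C‖ = 1 ∧
      ∀ x, 0 ≤ x → prim a g x = C * (soliton μ ω (x + shift μ ω (-θ₀)) : ℂ) := by
  have hgl := locallyIntegrable_of_memLp_two hg
  have hs := Real.sqrt_pos.2 hω
  have hκ := massConst_pos hμ hω
  set x₀ := shift μ ω (-θ₀) with hx₀
  have hnegθ : -θ₀ ∈ Ioo (-1 : ℝ) 1 := ⟨by linarith [hθ₀.2], by linarith [hθ₀.1]⟩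
  have hm0 : 0 < tailMass μ a g 0 := by
    rw [tailMass_zero, hm]
    refine mul_pos hκ ?_
    rw [← halfMass_neg_one (μ := μ)]
    exact strictMonoOn_halfMass hμ (by simp) (Ioo_subset_Icc_self hθ₀) hθ₀.1
  obtain ⟨θ, U, hU, h0, hUm⟩ := exists_isTransportSlope hμ hω hgl hθ₀ (tailMass_zero.trans hm)
  rw [← tailMass_zero, ← h0] at heq
  have hsub : ∀ X, 0 < X → 0 < tailMass μ a g X → Icc 0 X ⊆ U := fun Y hY hYm x hx =>
    hUm x hx.1 (hYm.trans_le (tailMass_antitone hμ hgl hx.2))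
  have hrig := fun (X : ℝ) (hX : 0 < X) (hXm : 0 < tailMass μ a g X) =>
    rigidity_on_interval hμ hω hg hU hX (by rw [uIcc_of_le hX.le]; exact hsub X hX hXm)
      (integral_defect_eq_zero hμ hω hg hf hU hUm heq hX.le hXm)
  obtain ⟨X₁, hX₁, hX₁m⟩ := exists_tailMass_eq hμ hg hf (X := 0) (half_pos hm0) (by linarith)
  have hX₁pos : 0 < X₁ := lt_of_le_of_ne hX₁ fun he => by rw [← he] at hX₁m; linarith
  have hX₁p : 0 < tailMass μ a g X₁ := by rw [hX₁m]; linarith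
  -- With a = 0 the linear equation forces f = 0 on [0,X₁], although half the mass is spent there.
  have ha : a ≠ 0 := by
    rintro rfl
    have : ∫ y in (0 : ℝ)..X₁, ‖prim 0 g y‖ ^ (2 * μ + 2) = 0 := by
      rw [intervalIntegral.integral_congr (g := fun _ => (0 : ℝ)), intervalIntegral.integral_zero]
      intro y hy
      rw [uIcc_of_le hX₁] at hy
      simp only [(hrig X₁ hX₁pos hX₁p).1 y hy, smul_zero, norm_zero]
      exact Real.zero_rpow (by positivity)
    have h1 : tailMass μ 0 g X₁ = tailMass μ 0 g 0 := by simp [tailMass, this]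
    linarith
  have hne : ∀ X, 0 < X → 0 < tailMass μ a g X → ∀ x ∈ Icc 0 X, 0 < ‖prim a g x‖ :=
    fun X hX hXm x hx => by
      rw [(hrig X hX hXm).1 x hx, norm_pos_iff]
      exact smul_ne_zero (Real.exp_pos _).ne' ha
  have hY : ∀ X, 0 < X → 0 < tailMass μ a g X → ∀ x ∈ Ioo 0 X,
      ‖prim a g x‖ ^ (2 * μ) = ω * (μ + 1) * (1 - θ x ^ 2) := fun X hX hXm x hx =>
    eq_of_youngGap_eq_zero hμ hω (hne X hX hXm x (Ioo_subset_Icc_self hx))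
      (one_sub_sq_pos (hU.mem_Ioo x (hsub X hX hXm (Ioo_subset_Icc_self hx))))
      ((hrig X hX hXm).2 x hx)
  -- Inserting the Young equality relation into the transport formula for θ' eliminates f and leaves
  -- an autonomous Riccati equation.
  have hθd : ∀ X, 0 < X → 0 < tailMass μ a g X → ∀ x ∈ Ioo 0 X,
      HasDerivAt θ (-(μ * √ω) * (1 - θ x ^ 2)) x := fun X hX hXm x hx => by
    have hxI := Ioo_subset_Icc_self hx
    have hpos := hne X hX hXm x hxI
    have hz := one_sub_sq_pos (hU.mem_Ioo x (hsub X hX hXm hxI))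
    refine (hU.hasDerivAt x (hsub X hX hXm hxI)).congr_deriv ?_
    have e2 : (‖prim a g x‖ ^ (2 * μ)) ^ (1 / μ) = ‖prim a g x‖ ^ 2 := by
      rw [← Real.rpow_mul hpos.le, ← Real.rpow_natCast]; congr 1; field_simp; norm_num
    have e1 : ‖prim a g x‖ ^ (2 * μ + 2) = ‖prim a g x‖ ^ (2 * μ) * ‖prim a g x‖ ^ 2 := by
      rw [Real.rpow_add hpos]; norm_num
    rw [massConst_mul_rpow hμ hω hz, e1, ← e2, hY X hX hXm x hx]
    have hW : 0 < (ω * (μ + 1) * (1 - θ x ^ 2)) ^ (1 / μ) := by positivity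
    have hsq := Real.sq_sqrt hω.le
    field_simp
    rw [hsq]
  have hθeq : ∀ X, 0 < X → 0 < tailMass μ a g X → ∀ x ∈ Icc 0 X,
      θ x = -Real.tanh (μ * √ω * (x + x₀)) := fun X hX hXm x hx => by
    have hθc : ContinuousOn θ (Icc 0 X) := hU.continuousOn.mono (hsub X hX hXm)
    have htc : ContinuousOn (fun x => -Real.tanh (μ * √ω * (x + x₀))) (Icc 0 X) := fun z _ =>
      (tanh_shift_ode μ ω x₀ z).continuousAt.continuousWithinAt
    -- The difference of two Riccati solutions solves a linear homogeneous equation, and it vanishes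
    -- at 0 by the choice of x₀.
    have := eq_exp_integral_smul (y := fun x => θ x - -Real.tanh (μ * √ω * (x + x₀)))
      (b := fun x => μ * √ω * (θ x + -Real.tanh (μ * √ω * (x + x₀)))) hX (hθc.sub htc)
      (continuousOn_const.mul (hθc.add htc)) (fun z hz => ?_) hx
    · have e : θ 0 - -Real.tanh (μ * √ω * (0 + x₀)) = 0 := by
        rw [zero_add, hx₀, tanh_mul_shift hμ hω hnegθ, h0]; ring
      simp only [e, smul_zero] at this
      linarith
    · refine ((hθd X hX hXm z hz).sub (tanh_shift_ode μ ω x₀ z)).congr_deriv ?_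
      simp only [smul_eq_mul]
      ring
  -- The mass cannot run out by a finite X: before it did, θ = -tanh would stay above its value T >
  -- -1 at X, keeping the remaining mass at least κF(T) > 0, against a point Y where it is at most
  -- half of that.
  have hall : ∀ X, 0 ≤ X → 0 < tailMass μ a g X := by
    intro X hX
    by_contra hcon
    set T := -Real.tanh (μ * √ω * (X + x₀)) with hT
    have hTm : T ∈ Ioo (-1 : ℝ) 1 :=
      ⟨by linarith [Real.tanh_lt_one (μ * √ω * (X + x₀))],
        by linarith [Real.neg_one_lt_tanh (μ * √ω * (X + x₀))]⟩
    have hδ : 0 < massConst μ ω * halfMass μ T := by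
      refine mul_pos hκ ?_
      rw [← halfMass_neg_one (μ := μ)]
      exact strictMonoOn_halfMass hμ (by simp) (Ioo_subset_Icc_self hTm) hTm.1
    obtain ⟨Y, hY0, hYm⟩ := exists_tailMass_eq hμ hg hf (X := 0)
      (lt_min (half_pos hδ) (half_pos hm0)) ((min_le_right _ _).trans (by linarith))
    have hYp : 0 < tailMass μ a g Y := by
      rw [hYm]; exact lt_min (half_pos hδ) (half_pos hm0)
    have hYpos : 0 < Y := lt_of_le_of_ne hY0 fun he => by
      rw [← he] at hYm
      linarith [min_le_right (massConst μ ω * halfMass μ T / 2) (tailMass μ a g 0 / 2)]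
    have hYX : Y ≤ X := by
      by_contra hlt
      exact hcon (hYp.trans_le (tailMass_antitone hμ hgl (not_le.1 hlt).le))
    have h1 := hU.mass_eq Y (hUm Y hY0 hYp)
    rw [hθeq Y hYpos hYp Y (right_mem_Icc.2 hY0)] at h1
    have h2 : T ≤ -Real.tanh (μ * √ω * (Y + x₀)) := by
      rw [hT, neg_le_neg_iff]
      have hmono : StrictMono Real.tanh := strictMono_of_deriv_pos fun x => by
        rw [(hasDerivAt_tanh x).deriv]; exact one_sub_tanh_sq_pos x
      refine hmono.monotone ?_
      gcongr
    have h3 : halfMass μ T ≤ halfMass μ (-Real.tanh (μ * √ω * (Y + x₀))) :=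
      (strictMonoOn_halfMass hμ).monotoneOn (Ioo_subset_Icc_self hTm)
        ⟨by linarith [hTm.1], by linarith [Real.neg_one_lt_tanh (μ * √ω * (Y + x₀))]⟩ h2
    have h4 := mul_le_mul_of_nonneg_left h3 hκ.le
    linarith [min_le_left (massConst μ ω * halfMass μ T / 2) (tailMass μ a g 0 / 2)]
  have hsol0 := soliton_pos hμ hω x₀
  have hform : ∀ x, 0 ≤ x →
      prim a g x = (a / (soliton μ ω x₀ : ℂ)) * (soliton μ ω (x + x₀) : ℂ) := by
    intro x hx
    have hX : 0 < x + 1 := by linarith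
    have hXm := hall (x + 1) hX.le
    have hxI : x ∈ Icc 0 (x + 1) := ⟨hx, by linarith⟩
    have hsd : ∀ z, HasDerivAt (fun x => soliton μ ω (x + x₀))
        (-(√ω * Real.tanh (μ * √ω * (z + x₀))) • soliton μ ω (z + x₀)) z := fun z =>
      (hasDerivAt_soliton hμ (z + x₀)).comp_add_const z x₀
    have h1 := eq_exp_integral_smul (y := fun x => soliton μ ω (x + x₀))
      (b := fun x => -(√ω * Real.tanh (μ * √ω * (x + x₀)))) hX
      (fun z _ => (hsd z).continuousAt.continuousWithinAt)
      (fun z _ => ((tanh_shift_ode μ ω x₀ z).continuousAt.const_mul √ω).continuousWithinAt.congr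
        (fun _ _ => by ring) (by ring)) (fun z _ => hsd z) hxI
    have h2 : ∫ t in (0 : ℝ)..x, √ω * θ t =
        ∫ t in (0 : ℝ)..x, -(√ω * Real.tanh (μ * √ω * (t + x₀))) := by
      refine intervalIntegral.integral_congr fun t ht => ?_
      rw [uIcc_of_le hx] at ht
      simp only [hθeq (x + 1) hX hXm t ⟨ht.1, by linarith [ht.2]⟩]
      ring
    rw [(hrig (x + 1) hX hXm).1 x hxI, h2, h1, zero_add, smul_eq_mul, Complex.real_smul]
    have : (soliton μ ω x₀ : ℂ) ≠ 0 := by exact_mod_cast hsol0.ne'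
    push_cast
    field_simp
  refine ⟨_, ?_, hform⟩
  -- The modulus of the constant is read off at an interior point, since the Young relation is
  -- available only on open intervals.
  have hz : (1 : ℝ) ∈ Ioo (0 : ℝ) 2 := by norm_num
  have h2p : (0 : ℝ) < 2 := by norm_num
  have h1 := hY 2 h2p (hall 2 h2p.le) 1 hz
  rw [hθeq 2 h2p (hall 2 h2p.le) 1 (Ioo_subset_Icc_self hz), neg_sq,
    ← soliton_rpow_two_mul hμ hω] at h1
  have hsol1 := soliton_pos hμ hω (1 + x₀)
  have h2 : ‖prim a g 1‖ = soliton μ ω (1 + x₀) :=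
    (Real.rpow_left_inj (norm_nonneg _) hsol1.le (by positivity)).1 h1
  rw [hform 1 zero_le_one, norm_mul, Complex.norm_real, Real.norm_of_nonneg hsol1.le] at h2
  exact mul_right_cancel₀ hsol1.ne' (h2.trans (one_mul _).symm)

end HalfLine

/-! ### The two-parameter algebraic problem -/

/-- The normalized parameters `s = τ²`, `p = |τ|^{2μ}`, `V = v/√ω`, the square root `r` of the
discriminant, the leading coefficient `D` and the root `T` of the quadratic equation for the first
component. -/
structure RootData (s p V r D T : ℝ) : Prop where
  s_pos : 0 < s
  p_pos : 0 < p
  V_pos : 0 < V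
  V_lt : V < 1 + s
  r_pos : 0 < r
  r_sq : r ^ 2 = V ^ 2 * p + D * (p - 1)
  D_eq : D = p * s ^ 2 - 1
  D_mul : D * T = V - s * r
  cases : (1 < s ∧ 1 < p ∧ 0 < D) ∨ (s < 1 ∧ p < 1 ∧ D < 0)

namespace RootData

variable {s p V r D T H : ℝ}

lemma D_ne (h : RootData s p V r D T) : D ≠ 0 := by
  rcases h.cases with h1 | h1
  · exact h1.2.2.ne'
  · exact h1.2.2.ne

/-- The difference p(1 - x²) - (1 - y²) on the line y = (x + V)/s is a quadratic in x vanishing at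
T. Its second root is H with DH = V + sr; the form here avoids naming H. Its sign governs the
monotonicity of the mass. -/
lemma factor (h : RootData s p V r D T) (x : ℝ) :
    s ^ 2 * (p * (1 - x ^ 2) - (1 - ((x + V) / s) ^ 2)) =
      (x - T) * (2 * s * r - D * (x - T)) := by
  have hD := h.D_eq
  have hT := h.D_mul
  have h2 := h.s_pos
  have h5 : s ^ 2 * (p * (1 - x ^ 2) - (1 - ((x + V) / s) ^ 2)) =
      s ^ 2 * (p * (1 - x ^ 2) - 1) + (x + V) ^ 2 := by
    have : s ^ 2 * ((x + V) / s) ^ 2 = (x + V) ^ 2 := by rw [← mul_pow, mul_div_cancel₀ _ h2.ne']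
    linear_combination this
  -- The product of the roots, multiplied by D.
  have h6 : T * (V + s * r) = -(V ^ 2 + s ^ 2 * (p - 1)) := by
    apply mul_left_cancel₀ h.D_ne
    linear_combination (V + s * r) * hT - s ^ 2 * h.r_sq + V ^ 2 * hD
  rw [h5]
  linear_combination (-2 * x + T) * hT + h6 + x ^ 2 * hD

lemma factor_zero (h : RootData s p V r D T) :
    p * (1 - T ^ 2) = 1 - ((T + V) / s) ^ 2 := by
  have := h.factor T
  rw [sub_self, zero_mul] at this
  have h2 := (mul_eq_zero.1 this).resolve_left (pow_pos h.s_pos 2).ne'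
  linarith

lemma eq_add_of_hat (h : RootData s p V r D T) (hH : D * H = V + s * r) :
    2 * s * r = D * (H - T) := by
  linear_combination h.D_mul - hH

lemma factor_hat (h : RootData s p V r D T) (hH : D * H = V + s * r) (x : ℝ) :
    s ^ 2 * (p * (1 - x ^ 2) - (1 - ((x + V) / s) ^ 2)) = (x - T) * (D * (H - x)) := by
  rw [h.factor, h.eq_add_of_hat hH]; ring

lemma factor_hat_zero (h : RootData s p V r D T) (hH : D * H = V + s * r) :
    p * (1 - H ^ 2) = 1 - ((H + V) / s) ^ 2 := by
  have := h.factor_hat hH H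
  rw [sub_self, mul_zero, mul_zero] at this
  have h2 := (mul_eq_zero.1 this).resolve_left (pow_pos h.s_pos 2).ne'
  linarith

lemma at_one (h : RootData s p V r D T) :
    (1 + V) ^ 2 - s ^ 2 = (1 - T) * (2 * s * r - D * (1 - T)) := by
  rw [← h.factor]
  have := h.s_pos
  field_simp
  ring

lemma at_neg_one (h : RootData s p V r D T) :
    (1 - V) ^ 2 - s ^ 2 = (-1 - T) * (2 * s * r - D * (-1 - T)) := by
  rw [← h.factor]
  have := h.s_pos
  field_simp
  ring

/-- At x = ±1 the term p(1 - x²) drops out, so the sign of the quadratic there is known from V, s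
alone; a root outside the interval would give it the wrong sign. The hypothesis V < 1 + s is what
fixes the sign at -1. -/
lemma mem_Ioo (h : RootData s p V r D T) : T ∈ Ioo (-1 : ℝ) 1 := by
  have hs := h.s_pos
  have hV := h.V_pos
  have hr := h.r_pos
  have hVs := h.V_lt
  have hsr : 0 < s * r := mul_pos hs hr
  have h1 := h.at_one
  have h2 := h.at_neg_one
  have hT := h.D_mul
  rcases h.cases with ⟨hs1, hp1, hD⟩ | ⟨hs1, hp1, hD⟩
  · have hneg : T < 0 := by
      have h3 : V ^ 2 < (s * r) ^ 2 := by
        have e : (s * r) ^ 2 - V ^ 2 = D * (V ^ 2 + s ^ 2 * (p - 1)) := by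
          linear_combination s ^ 2 * h.r_sq - V ^ 2 * h.D_eq
        have : 0 < D * (V ^ 2 + s ^ 2 * (p - 1)) := by
          have : 0 < p - 1 := by linarith
          positivity
        linarith
      have h4 := lt_of_pow_lt_pow_left₀ 2 hsr.le h3
      by_contra hcon
      have := mul_nonneg hD.le (not_lt.1 hcon)
      linarith
    refine ⟨?_, by linarith⟩
    by_contra hcon
    rw [not_lt] at hcon
    have h5 : (1 - V) ^ 2 - s ^ 2 < 0 := by nlinarith
    have h6 : 0 < 2 * s * r - D * (-1 - T) := by nlinarith
    have h7 : 0 ≤ (-1 - T) * (2 * s * r - D * (-1 - T)) := mul_nonneg (by linarith) h6.le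
    linarith
  · constructor
    -- For V ≤ 1 - s the sign at -1 gives no contradiction, but then V + D < 0, so DT < -D, which is
    -- T > -1.
    · rcases le_or_gt V (1 - s) with hc | hc
      · have hps : p * s < 1 := by nlinarith [h.p_pos]
        have h8 : V + D < 0 := by rw [h.D_eq]; nlinarith
        nlinarith
      · by_contra hcon
        rw [not_lt] at hcon
        have h5 : (1 - V) ^ 2 - s ^ 2 < 0 := by nlinarith
        have h6 : 0 < 2 * s * r - D * (-1 - T) := by nlinarith
        have h7 : 0 ≤ (-1 - T) * (2 * s * r - D * (-1 - T)) := mul_nonneg (by linarith) h6.le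
        linarith
    · by_contra hcon
      rw [not_lt] at hcon
      have h5 : 0 < (1 + V) ^ 2 - s ^ 2 := by nlinarith
      have h6 : 0 < 2 * s * r - D * (1 - T) := by nlinarith
      have h7 : (1 - T) * (2 * s * r - D * (1 - T)) ≤ 0 :=
        mul_nonpos_of_nonpos_of_nonneg (by linarith) h6.le
      linarith

lemma snd_mem_Ioo (hp : 0 < p) (hx : T ∈ Ioo (-1 : ℝ) 1) {y : ℝ}
    (h : p * (1 - T ^ 2) = 1 - y ^ 2) : y ∈ Ioo (-1 : ℝ) 1 := by
  have := mul_pos hp (one_sub_sq_pos hx)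
  have h1 : y ^ 2 < 1 := by linarith
  exact abs_lt.1 ((sq_lt_one_iff_abs_lt_one y).1 h1)

/-- H has the sign of D, so only the endpoint on that side matters. The bound V < |s - 1| fixes the
sign of the quadratic at this endpoint, and a root H at or beyond it would give the opposite weak
sign. -/
lemma hat_mem_Ioo (h : RootData s p V r D T) (hH : D * H = V + s * r) (hV : V < |s - 1|) :
    H ∈ Ioo (-1 : ℝ) 1 := by
  have hs := h.s_pos
  have hV0 := h.V_pos
  have hsr : 0 < s * r := mul_pos hs h.r_pos
  have h1 := h.at_one
  have h2 := h.at_neg_one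
  have he := h.eq_add_of_hat hH
  have hT := h.mem_Ioo
  rcases h.cases with ⟨hs1, hp1, hD⟩ | ⟨hs1, hp1, hD⟩
  · rw [abs_of_pos (by linarith)] at hV
    have hpos : 0 < H := by
      by_contra hcon
      have := mul_nonpos_of_nonneg_of_nonpos hD.le (not_lt.1 hcon)
      linarith
    refine ⟨by linarith, ?_⟩
    by_contra hcon
    rw [not_lt] at hcon
    have h6 : 0 ≤ 2 * s * r - D * (1 - T) := by
      rw [he]; nlinarith
    have h7 := mul_nonneg (by linarith [hT.2] : 0 ≤ 1 - T) h6
    nlinarith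
  · rw [abs_of_neg (by linarith)] at hV
    have hneg : H < 0 := by
      by_contra hcon
      have := mul_nonpos_of_nonpos_of_nonneg hD.le (not_lt.1 hcon)
      linarith
    refine ⟨?_, by linarith⟩
    by_contra hcon
    rw [not_lt] at hcon
    have h6 : 0 ≤ 2 * s * r - D * (-1 - T) := by
      rw [he]; nlinarith
    have h7 := mul_nonneg (by linarith [hT.1] : 0 ≤ -(-1 - T)) h6
    nlinarith

lemma lt_snd (h : RootData s p V r D T) : T < (T + V) / s := by
  have hs := h.s_pos
  have hr := h.r_pos
  have hV := h.V_pos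
  rw [lt_div_iff₀ hs]
  have e : D * (T + V - T * s) = s * ((s * p - 1) * V + (s - 1) * r) := by
    linear_combination (1 - s) * h.D_mul + V * h.D_eq
  rcases h.cases with ⟨hs1, hp1, hD⟩ | ⟨hs1, hp1, hD⟩
  · have h1 : 0 < s * p - 1 := by nlinarith
    have h2 : 0 < s - 1 := by linarith
    have : 0 < D * (T + V - T * s) := by rw [e]; positivity
    have := (pos_iff_pos_of_mul_pos this).1 hD
    linarith
  · have h1 : 0 < 1 - s * p := by nlinarith [h.p_pos]
    have h2 : 0 < 1 - s := by linarith
    have h3 : 0 < s * ((1 - s * p) * V + (1 - s) * r) := by positivity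
    by_contra hcon
    have : 0 ≤ D * (T + V - T * s) := mul_nonneg_of_nonpos_of_nonpos hD.le (by linarith)
    linarith

variable {μ : ℝ}

/-- The mass of the profile with first parameter `x` on the line `-x + s y = V`. -/
def lineMass (μ s V x : ℝ) : ℝ := halfMass μ x + halfMass μ (-((x + V) / s))

lemma hasDerivAt_lineMass (hμ : 0 < μ) (s V x : ℝ) :
    HasDerivAt (lineMass μ s V)
      ((1 - x ^ 2) ^ (1 / μ) - (1 - ((x + V) / s) ^ 2) ^ (1 / μ) / s) x := by
  have h1 : HasDerivAt (fun x => -((x + V) / s)) (-(1 / s)) x :=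
    (((hasDerivAt_id x).add_const V).div_const s).neg
  refine ((hasDerivAt_halfMass hμ x).add
    ((hasDerivAt_halfMass hμ (-((x + V) / s))).comp x h1)).congr_deriv ?_
  rw [neg_sq]
  ring

/-- Because p = s^μ, taking the power 1/μ turns the comparison of b with pa into that of b^{1/μ}/s
with a^{1/μ}. Thus the derivative of `lineMass` has the sign of the quadratic. -/
lemma mass_rpow_lt (hμ : 0 < μ) (hs : 0 < s) (hp : p = s ^ μ) {a b : ℝ} (ha : 0 ≤ a)
    (hb : 0 ≤ b) : (b < p * a → b ^ (1 / μ) / s < a ^ (1 / μ)) ∧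
      (p * a < b → a ^ (1 / μ) < b ^ (1 / μ) / s) := by
  have hpa : (p * a) ^ (1 / μ) = s * a ^ (1 / μ) := by
    rw [hp, Real.mul_rpow (by positivity) ha, ← Real.rpow_mul hs.le, mul_one_div_cancel hμ.ne',
      Real.rpow_one]
  have hp0 : 0 < p := by rw [hp]; positivity
  refine ⟨fun h => ?_, fun h => ?_⟩
  · rw [div_lt_iff₀ hs, mul_comm, ← hpa]
    exact Real.rpow_lt_rpow hb h (by positivity)
  · rw [lt_div_iff₀ hs, mul_comm, ← hpa]
    exact Real.rpow_lt_rpow (by positivity) h (by positivity)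

lemma lineMass_strictMonoOn (h : RootData s p V r D T) (hμ : 0 < μ) (hp : p = s ^ μ) {a b : ℝ}
    (ha : a ∈ Icc (-1 : ℝ) 1) (hb : b ∈ Icc (-1 : ℝ) 1) (ha' : (a + V) / s ∈ Icc (-1 : ℝ) 1)
    (hb' : (b + V) / s ∈ Icc (-1 : ℝ) 1)
    (hq : ∀ x ∈ Ioo a b, 0 < (x - T) * (2 * s * r - D * (x - T))) :
    StrictMonoOn (lineMass μ s V) (Icc a b) := by
  have hs := h.s_pos
  refine strictMonoOn_of_deriv_pos (convex_Icc _ _)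
    (fun x _ => (hasDerivAt_lineMass hμ s V x).continuousAt.continuousWithinAt) fun x hx => ?_
  rw [interior_Icc] at hx
  rw [(hasDerivAt_lineMass hμ s V x).deriv, sub_pos]
  have h1 : (x + V) / s ∈ Icc (-1 : ℝ) 1 :=
    ⟨ha'.1.trans (by have := hx.1.le; gcongr), le_trans (by have := hx.2.le; gcongr) hb'.2⟩
  have h2 : x ∈ Icc (-1 : ℝ) 1 := ⟨ha.1.trans hx.1.le, hx.2.le.trans hb.2⟩
  refine (mass_rpow_lt hμ hs hp (by nlinarith [h2.1, h2.2]) (by nlinarith [h1.1, h1.2])).1 ?_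
  have := hq x hx
  rw [← h.factor] at this
  linarith [(pos_iff_pos_of_mul_pos this).1 (pow_pos hs 2)]

lemma lineMass_strictAntiOn (h : RootData s p V r D T) (hμ : 0 < μ) (hp : p = s ^ μ) {a b : ℝ}
    (ha : a ∈ Icc (-1 : ℝ) 1) (hb : b ∈ Icc (-1 : ℝ) 1) (ha' : (a + V) / s ∈ Icc (-1 : ℝ) 1)
    (hb' : (b + V) / s ∈ Icc (-1 : ℝ) 1)
    (hq : ∀ x ∈ Ioo a b, (x - T) * (2 * s * r - D * (x - T)) < 0) :
    StrictAntiOn (lineMass μ s V) (Icc a b) := by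
  have hs := h.s_pos
  refine strictAntiOn_of_deriv_neg (convex_Icc _ _)
    (fun x _ => (hasDerivAt_lineMass hμ s V x).continuousAt.continuousWithinAt) fun x hx => ?_
  rw [interior_Icc] at hx
  rw [(hasDerivAt_lineMass hμ s V x).deriv, sub_neg]
  have h1 : (x + V) / s ∈ Icc (-1 : ℝ) 1 :=
    ⟨ha'.1.trans (by have := hx.1.le; gcongr), le_trans (by have := hx.2.le; gcongr) hb'.2⟩
  have h2 : x ∈ Icc (-1 : ℝ) 1 := ⟨ha.1.trans hx.1.le, hx.2.le.trans hb.2⟩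
  refine (mass_rpow_lt hμ hs hp (by nlinarith [h2.1, h2.2]) (by nlinarith [h1.1, h1.2])).2 ?_
  have := hq x hx
  rw [← h.factor] at this
  by_contra hcon
  have h3 : 0 ≤ s ^ 2 * (p * (1 - x ^ 2) - (1 - ((x + V) / s) ^ 2)) :=
    mul_nonneg (by positivity) (by linarith)
  linarith

lemma snd_mem (h : RootData s p V r D T) : (T + V) / s ∈ Ioo (-1 : ℝ) 1 :=
  snd_mem_Ioo h.p_pos h.mem_Ioo h.factor_zero

/-- As T < (T + V)/s, the profile has less mass than a whole soliton. This rules out the ends of the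
segment as minima and keeps the half-masses of competitors in the range of `halfMass`. -/
lemma lineMass_lt_full (h : RootData s p V r D T) (hμ : 0 < μ) :
    lineMass μ s V T < halfMass μ 1 := by
  have h1 := halfMass_add_halfMass_neg hμ ((T + V) / s)
  have h2 := strictMonoOn_halfMass hμ (Ioo_subset_Icc_self h.mem_Ioo)
    (Ioo_subset_Icc_self h.snd_mem) h.lt_snd
  rw [lineMass]
  linarith

/-- On the admissible segment, the mass is minimal exactly at the root `T`. -/
lemma lineMass_lt (h : RootData s p V r D T) (hμ : 0 < μ) (hp : p = s ^ μ) {x : ℝ}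
    (hx : x ∈ Icc (-1 : ℝ) 1) (hx' : (x + V) / s ∈ Icc (-1 : ℝ) 1) (hne : x ≠ T) :
    lineMass μ s V T < lineMass μ s V x := by
  have hs := h.s_pos
  have hV := h.V_pos
  have hsr : 0 < s * r := mul_pos hs h.r_pos
  have hT := Ioo_subset_Icc_self h.mem_Ioo
  have hT' := Ioo_subset_Icc_self h.snd_mem
  -- In the first case x does not lie beyond the second root, so the mass is strictly monotone
  -- between x and T. Beyond that root the mass falls towards the end of the segment, where it is at
  -- least that of a whole soliton.
  rcases le_or_gt 0 (2 * s * r - D * (x - T)) with hl | hl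
  · rcases lt_or_gt_of_ne hne with hlt | hgt
    · refine h.lineMass_strictAntiOn hμ hp hx hT hx' hT' (fun z hz => ?_)
        (left_mem_Icc.2 hlt.le) (right_mem_Icc.2 hlt.le) hlt
      refine mul_neg_of_neg_of_pos (by linarith [hz.2]) ?_
      rcases le_or_gt 0 D with hD | hD
      · nlinarith [hz.2]
      · nlinarith [hz.1, mul_pos_of_neg_of_neg hD (by linarith [hz.1] : x - z < 0)]
    · refine h.lineMass_strictMonoOn hμ hp hT hx hT' hx' (fun z hz => ?_)
        (left_mem_Icc.2 hgt.le) (right_mem_Icc.2 hgt.le) hgt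
      refine mul_pos (by linarith [hz.1]) ?_
      rcases lt_or_ge 0 D with hD | hD
      · nlinarith [hz.2, mul_pos hD (by linarith [hz.2] : 0 < x - z)]
      · nlinarith [hz.1]
  refine h.lineMass_lt_full hμ |>.trans_le ?_
  rw [mem_Icc, div_le_iff₀ hs, le_div_iff₀ hs] at hx'
  rcases lt_or_gt_of_ne hne with hlt | hgt
  · have hD : D < 0 := by
      by_contra hcon
      nlinarith [not_lt.1 hcon]
    have hneg : ∀ z, z ≤ x → 2 * s * r - D * (z - T) < 0 := fun z hz => by nlinarith
    have hαx : max (-1) (-s - V) ≤ x := max_le hx.1 (by linarith [hx'.1])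
    have hα : max (-1) (-s - V) ∈ Icc (-1 : ℝ) 1 := ⟨le_max_left _ _, hαx.trans hx.2⟩
    have hα' : (max (-1) (-s - V) + V) / s ∈ Icc (-1 : ℝ) 1 := by
      rw [mem_Icc, div_le_iff₀ hs, le_div_iff₀ hs]
      exact ⟨by linarith [le_max_right (-1) (-s - V)], by linarith⟩
    have hmono : lineMass μ s V (max (-1) (-s - V)) ≤ lineMass μ s V x :=
      (h.lineMass_strictMonoOn hμ hp hα hx hα' (by rw [mem_Icc, div_le_iff₀ hs, le_div_iff₀ hs]
                                                   exact hx')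
        fun z hz => mul_pos_of_neg_of_neg (by linarith [hz.2]) (hneg z hz.2.le)).monotoneOn
        (left_mem_Icc.2 hαx) (right_mem_Icc.2 hαx) hαx
    refine le_trans ?_ hmono
    have hq : 0 < s ^ 2 * (p * (1 - max (-1) (-s - V) ^ 2) -
        (1 - ((max (-1) (-s - V) + V) / s) ^ 2)) := by
      rw [h.factor]
      exact mul_pos_of_neg_of_neg (by linarith) (hneg _ hαx)
    have hq' := (pos_iff_pos_of_mul_pos hq).1 (pow_pos hs 2)
    -- The left end is not x = -1, where the quadratic would be nonpositive. It is therefore y = -1,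
    -- where the right half alone carries a whole soliton.
    rcases max_choice (-1) (-s - V) with he | he
    · rw [he] at hq' hα'
      nlinarith [hα'.1, hα'.2]
    · rw [he, lineMass]
      have e : -((-s - V + V) / s) = 1 := by field_simp; ring
      rw [e]
      linarith [halfMass_nonneg hμ (he ▸ hα)]
  · have hD : 0 < D := by
      by_contra hcon
      nlinarith [not_lt.1 hcon]
    have hneg : ∀ z, x ≤ z → 2 * s * r - D * (z - T) < 0 := fun z hz => by nlinarith
    have hβx : x ≤ min 1 (s - V) := le_min hx.2 (by linarith [hx'.2])
    have hβ : min 1 (s - V) ∈ Icc (-1 : ℝ) 1 := ⟨hx.1.trans hβx, min_le_left _ _⟩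
    have hβ' : (min 1 (s - V) + V) / s ∈ Icc (-1 : ℝ) 1 := by
      rw [mem_Icc, div_le_iff₀ hs, le_div_iff₀ hs]
      exact ⟨by linarith, by linarith [min_le_right 1 (s - V)]⟩
    have hmono : lineMass μ s V (min 1 (s - V)) ≤ lineMass μ s V x :=
      (h.lineMass_strictAntiOn hμ hp hx hβ (by rw [mem_Icc, div_le_iff₀ hs, le_div_iff₀ hs]
                                               exact hx') hβ'
        fun z hz => mul_neg_of_pos_of_neg (by linarith [hz.1]) (hneg z hz.1.le)).antitoneOn
        (left_mem_Icc.2 hβx) (right_mem_Icc.2 hβx) hβx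
    refine le_trans ?_ hmono
    have hq : s ^ 2 * (p * (1 - min 1 (s - V) ^ 2) -
        (1 - ((min 1 (s - V) + V) / s) ^ 2)) < 0 := by
      rw [h.factor]
      exact mul_neg_of_pos_of_neg (by linarith) (hneg _ hβx)
    -- At the right end x = 1 the left half carries a whole soliton; the alternative y = 1 would
    -- make the quadratic nonnegative.
    rcases min_choice 1 (s - V) with he | he
    · rw [he, lineMass]
      rw [he] at hβ'
      linarith [halfMass_nonneg hμ (t := -((1 + V) / s)) ⟨by linarith [hβ'.2], by linarith [hβ'.1]⟩]
    · exfalso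
      rw [he] at hq hβ
      have e : (s - V + V) / s = 1 := by field_simp; ring
      rw [e] at hq
      have h1 : 0 ≤ s ^ 2 * (p * (1 - (s - V) ^ 2) - (1 - 1 ^ 2)) := by
        have h2 : 0 ≤ 1 - (s - V) ^ 2 := by nlinarith [hβ.1, hβ.2]
        have := mul_nonneg h.p_pos.le h2
        have := pow_pos hs 2
        nlinarith
      linarith

/-- Parameters whose mass does not exceed that of the root satisfy the jump inequality, strictly
unless they coincide with the root. -/
lemma jump_le_of_mass_le (h : RootData s p V r D T) (hμ : 0 < μ) (hp : p = s ^ μ) {x y : ℝ}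
    (hx : x ∈ Icc (-1 : ℝ) 1) (hy : y ∈ Icc (-1 : ℝ) 1)
    (hm : halfMass μ x + halfMass μ (-y) ≤ lineMass μ s V T) :
    V ≤ -x + s * y ∧ (V = -x + s * y → x = T ∧ y = (T + V) / s) := by
  have hs := h.s_pos
  have hline : ∀ x' y', x' ∈ Icc (-1 : ℝ) 1 → y' ∈ Icc (-1 : ℝ) 1 → V = -x' + s * y' →
      halfMass μ x' + halfMass μ (-y') ≤ lineMass μ s V T → x' = T ∧ y' = (T + V) / s := by
    intro x' y' hx' hy' he hm'
    have hy'' : y' = (x' + V) / s := by rw [he]; field_simp; ring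
    have : x' = T := by
      by_contra hne
      have := h.lineMass_lt hμ hp hx' (hy'' ▸ hy') hne
      rw [lineMass, lineMass, ← hy''] at this
      rw [lineMass] at hm'
      linarith
    exact ⟨this, this ▸ hy''⟩
  refine ⟨?_, fun he => hline x y hx hy he hm⟩
  by_contra hcon
  rw [not_le] at hcon
  -- Were -x + sy < V, move (x,y) straight towards the corner (-1,1), where the form equals 1 + s >
  -- V. Both masses decrease on the way; the line is met at time t, with k the total increase of the
  -- form. The minimum on the line then forces the displacement to vanish, a contradiction.
  set k := 1 + x + s * (1 - y) with hk
  have hk0 : 0 < k := by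
    have := h.V_lt
    linarith
  set t := (V - (-x + s * y)) / k with ht
  have htk : t * k = V - (-x + s * y) := div_mul_cancel₀ _ hk0.ne'
  have ht0 : 0 < t := div_pos (by linarith) hk0
  have ht1 : t < 1 := by rw [ht, div_lt_one hk0]; linarith [h.V_lt]
  have hx' : x - t * (1 + x) ∈ Icc (-1 : ℝ) 1 := ⟨by nlinarith [hx.1], by nlinarith [hx.1, hx.2]⟩
  have hy' : y + t * (1 - y) ∈ Icc (-1 : ℝ) 1 := ⟨by nlinarith [hy.1, hy.2], by nlinarith [hy.2]⟩
  have hmono := (strictMonoOn_halfMass hμ).monotoneOn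
  have hny : ∀ z ∈ Icc (-1 : ℝ) 1, -z ∈ Icc (-1 : ℝ) 1 := fun z hz =>
    ⟨by linarith [hz.2], by linarith [hz.1]⟩
  have hxle : x - t * (1 + x) ≤ x := by nlinarith [hx.1]
  have hyle : -(y + t * (1 - y)) ≤ -y := by nlinarith [hy.2]
  have h1 := hmono hx' hx hxle
  have h2 := hmono (hny _ hy') (hny _ hy) hyle
  obtain ⟨e1, e2⟩ := hline _ _ hx' hy' (by rw [hk] at htk; linear_combination -htk)
    (by linarith)
  have h3 : lineMass μ s V T = halfMass μ (x - t * (1 + x)) +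
      halfMass μ (-(y + t * (1 - y))) := by rw [lineMass, e1, e2]
  have h4 : x = x - t * (1 + x) :=
    (strictMonoOn_halfMass hμ).injOn hx hx' (by linarith)
  have h5 : -y = -(y + t * (1 - y)) :=
    (strictMonoOn_halfMass hμ).injOn (hny _ hy) (hny _ hy') (by linarith)
  have h6 : t * k = 0 := by rw [hk]; linear_combination h4 + s * h5
  rw [htk] at h6
  linarith

end RootData

/-! ### From the physical parameters to the normalized ones -/

section Parameters

variable {μ v τ ω : ℝ}

lemma omega_pos (hv : 0 < v) (hω : v ^ 2 / (τ ^ 2 + 1) ^ 2 < ω) : 0 < ω :=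
  lt_trans (by positivity) hω

lemma abs_rpow_two_mul : |τ| ^ (2 * μ) = (τ ^ 2) ^ μ := by
  rw [Real.rpow_mul (abs_nonneg _), Real.rpow_two, sq_abs]

lemma abs_rpow_add_four (hτ0 : τ ≠ 0) :
    |τ| ^ (2 * μ + 4) = |τ| ^ (2 * μ) * (τ ^ 2) ^ 2 := by
  rw [Real.rpow_add (abs_pos.2 hτ0), show (4 : ℝ) = ((4 : ℕ) : ℝ) by norm_num, Real.rpow_natCast,
    ← sq_abs τ]
  ring

lemma abs_rpow_add_two (hτ0 : τ ≠ 0) :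
    |τ| ^ (2 * μ + 2) = |τ| ^ (2 * μ) * τ ^ 2 := by
  rw [Real.rpow_add (abs_pos.2 hτ0), Real.rpow_two, sq_abs]

/-- Both frequency thresholds become bounds on V = v/√ω: k = τ² + 1 yields existence of the first
root pair, k = |τ² - 1| that of the second. -/
lemma div_sqrt_lt {k : ℝ} (hv : 0 < v) (hk : 0 < k) (hω : v ^ 2 / k ^ 2 < ω) : v / √ω < k := by
  have h0 : 0 < ω := lt_trans (by positivity) hω
  rw [div_lt_iff₀ (Real.sqrt_pos.2 h0)]
  refine lt_of_pow_lt_pow_left₀ 2 (by positivity) ?_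
  rw [mul_pow, Real.sq_sqrt h0.le]
  rw [div_lt_iff₀ (by positivity)] at hω
  linarith

lemma rootData (hμ : 0 < μ) (hv : 0 < v) (hτ0 : τ ≠ 0) (hτ1 : τ ≠ 1) (hτ1' : τ ≠ -1)
    (hω : v ^ 2 / (τ ^ 2 + 1) ^ 2 < ω) :
    RootData (τ ^ 2) (|τ| ^ (2 * μ)) (v / √ω) √(rootDisc μ v τ ω) (|τ| ^ (2 * μ + 4) - 1)
      (tildeMinus μ v τ ω) := by
  have hω0 := omega_pos hv hω
  have hs : 0 < τ ^ 2 := by positivity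
  have hsq := Real.sqrt_pos.2 hω0
  have hp : 0 < |τ| ^ (2 * μ) := Real.rpow_pos_of_pos (abs_pos.2 hτ0) _
  have hcases : (1 < τ ^ 2 ∧ 1 < |τ| ^ (2 * μ) ∧ 0 < |τ| ^ (2 * μ + 4) - 1) ∨
      (τ ^ 2 < 1 ∧ |τ| ^ (2 * μ) < 1 ∧ |τ| ^ (2 * μ + 4) - 1 < 0) := by
    have hne : |τ| ≠ 1 := fun h => by
      rcases (abs_eq zero_le_one).1 h with h | h
      · exact hτ1 h
      · exact hτ1' h
    rcases lt_or_gt_of_ne hne with h | h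
    · right
      exact ⟨by rw [← sq_abs]; exact pow_lt_one₀ (abs_nonneg _) h two_ne_zero,
        Real.rpow_lt_one (abs_nonneg _) h (by positivity),
        sub_neg.2 (Real.rpow_lt_one (abs_nonneg _) h (by positivity))⟩
    · left
      exact ⟨by rw [← sq_abs]; exact one_lt_pow₀ h two_ne_zero,
        Real.one_lt_rpow h (by positivity),
        sub_pos.2 (Real.one_lt_rpow h (by positivity))⟩
  have hA : 0 < rootDisc μ v τ ω := by
    have h1 : 0 < v ^ 2 / ω * |τ| ^ (2 * μ) := by positivity
    rw [rootDisc]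
    rcases hcases with ⟨_, h2, h3⟩ | ⟨_, h2, h3⟩
    · have := mul_pos h3 (sub_pos.2 h2)
      linarith
    · have := mul_pos_of_neg_of_neg h3 (sub_neg.2 h2)
      linarith
  have hD : |τ| ^ (2 * μ + 4) - 1 ≠ 0 := by
    rcases hcases with h | h
    · exact h.2.2.ne'
    · exact h.2.2.ne
  refine ⟨hs, hp, by positivity, ?_, Real.sqrt_pos.2 hA, ?_, ?_, ?_, hcases⟩
  · rw [add_comm]; exact div_sqrt_lt hv (by positivity) hω
  · rw [Real.sq_sqrt hA.le, rootDisc, div_pow, Real.sq_sqrt hω0.le]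
  · rw [abs_rpow_add_four hτ0]
  · rw [tildeMinus, sq_abs]
    field_simp

lemma tildePlus_eq (hτ0 : τ ≠ 0) (hD : |τ| ^ (2 * μ + 4) - 1 ≠ 0) :
    tildePlus μ v τ ω = (tildeMinus μ v τ ω + v / √ω) / τ ^ 2 := by
  have e : |τ| ^ (2 * μ + 4) - 1 = |τ| ^ (2 * μ) * (τ ^ 2) ^ 2 - 1 := by
    rw [abs_rpow_add_four hτ0]
  rw [tildePlus, tildeMinus, sq_abs, abs_rpow_add_two hτ0, eq_div_iff (pow_ne_zero 2 hτ0)]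
  field_simp
  linear_combination (-v / √ω) * e

lemma hatPlus_eq (hτ0 : τ ≠ 0) (hD : |τ| ^ (2 * μ + 4) - 1 ≠ 0) :
    hatPlus μ v τ ω = (hatMinus μ v τ ω + v / √ω) / τ ^ 2 := by
  have e : |τ| ^ (2 * μ + 4) - 1 = |τ| ^ (2 * μ) * (τ ^ 2) ^ 2 - 1 := by
    rw [abs_rpow_add_four hτ0]
  rw [hatPlus, hatMinus, sq_abs, abs_rpow_add_two hτ0, eq_div_iff (pow_ne_zero 2 hτ0)]
  field_simp
  linear_combination (-v / √ω) * e

lemma hatMinus_mul (hD : |τ| ^ (2 * μ + 4) - 1 ≠ 0) :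
    (|τ| ^ (2 * μ + 4) - 1) * hatMinus μ v τ ω = v / √ω + τ ^ 2 * √(rootDisc μ v τ ω) := by
  rw [hatMinus, sq_abs]
  field_simp

lemma isRootPair_of (hp : |τ| ^ (2 * μ) ≠ 1) (hp0 : 0 < |τ| ^ (2 * μ)) {Tm Tp : ℝ}
    (hm : Tm ∈ Ioo (-1 : ℝ) 1) (hpl : Tp ∈ Ioo (-1 : ℝ) 1) (h : Tp = (Tm + v / √ω) / τ ^ 2)
    (he : |τ| ^ (2 * μ) * (1 - Tm ^ 2) = 1 - Tp ^ 2) : IsRootPair μ v τ ω Tm Tp := by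
  refine ⟨hm, hpl, by rw [h]; ring, ?_⟩
  have h1 : |τ| ^ (2 * μ) - 1 ≠ 0 := sub_ne_zero.2 hp
  generalize |τ| ^ (2 * μ) = p at *
  have h2 : 1 - 1 / p = (p - 1) / p := by field_simp
  rw [h2]
  field_simp
  linarith

end Parameters

/-! ### Integrals of powers of sech and of 1 - t² -/

section Integrals

lemma continuous_tanh : Continuous Real.tanh :=
  continuous_iff_continuousAt.2 fun x => (hasDerivAt_tanh x).continuousAt

lemma strictMono_tanh : StrictMono Real.tanh := strictMono_of_deriv_pos fun x => by
  rw [(hasDerivAt_tanh x).deriv]; exact one_sub_tanh_sq_pos x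

lemma continuous_sech_rpow {r : ℝ} : Continuous fun y => (1 - Real.tanh y ^ 2) ^ r :=
  (continuous_const.sub (continuous_tanh.pow 2)).rpow_const
    fun y => Or.inl (one_sub_tanh_sq_pos y).ne'

lemma integrable_sech_rpow {r : ℝ} (hr : 0 < r) :
    Integrable fun y => (1 - Real.tanh y ^ 2) ^ r := by
  have hpos : IntegrableOn (fun y => (1 - Real.tanh y ^ 2) ^ r) (Ioi 0) := by
    refine Integrable.mono' ((exp_neg_integrableOn_Ioi 0 (b := 2 * r) (by positivity)).const_mul
      ((4 : ℝ) ^ r)) continuous_sech_rpow.aestronglyMeasurable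
      (Eventually.of_forall fun y => ?_)
    have h0 := one_sub_tanh_sq_pos y
    rw [Real.norm_of_nonneg (by positivity)]
    have h1 : Real.exp y / 2 ≤ Real.cosh y := by
      rw [Real.cosh_eq]; linarith [Real.exp_pos (-y)]
    have h2 : 1 - Real.tanh y ^ 2 ≤ 4 * Real.exp (-2 * y) := by
      rw [one_sub_tanh_sq]
      have h3 : (Real.exp y / 2) ^ 2 ≤ Real.cosh y ^ 2 := by gcongr
      have h4 : 4 * Real.exp (-2 * y) = ((Real.exp y / 2) ^ 2)⁻¹ := by
        rw [div_pow, ← Real.exp_nat_mul, inv_div, show (-2 * y) = -(((2 : ℕ) : ℝ) * y) by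
          push_cast; ring, Real.exp_neg]
        ring
      rw [h4]
      exact inv_anti₀ (by positivity) h3
    calc (1 - Real.tanh y ^ 2) ^ r ≤ (4 * Real.exp (-2 * y)) ^ r := by gcongr
      _ = 4 ^ r * Real.exp (-(2 * r) * y) := by
        rw [Real.mul_rpow (by norm_num) (Real.exp_pos _).le, ← Real.exp_mul]
        congr 2; ring
  have hneg : IntegrableOn (fun y => (1 - Real.tanh y ^ 2) ^ r) (Iio 0) := by
    have := ((Measure.measurePreserving_neg (volume : Measure ℝ)).integrableOn_comp_preimage
      (Homeomorph.neg ℝ).measurableEmbedding).2 hpos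
    have e : (Neg.neg ⁻¹' Ioi 0 : Set ℝ) = Iio 0 := by ext; simp
    rw [e] at this
    refine this.congr_fun (fun y _ => ?_) measurableSet_Iio
    simp [Real.tanh_neg]
  rw [← integrableOn_univ, ← Iic_union_Ioi (a := (0 : ℝ))]
  exact ((integrableOn_Iic_iff_integrableOn_Iio (by simp)).2 hneg).union hpos

variable {k : ℝ}

lemma hasDerivAt_tanh_affine (k c x : ℝ) :
    HasDerivAt (fun x => Real.tanh (k * (x + c))) (k * (1 - Real.tanh (k * (x + c)) ^ 2)) x := by
  have h1 : HasDerivAt (fun x => k * (x + c)) k x := by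
    simpa using ((hasDerivAt_id x).add_const c).const_mul k
  refine ((hasDerivAt_tanh _).comp x h1).congr_deriv (mul_comm _ _)

lemma strictMono_tanh_affine (hk : 0 < k) (c : ℝ) :
    StrictMono fun x => Real.tanh (k * (x + c)) :=
  fun x y h => strictMono_tanh (by gcongr)

lemma tanh_affine_artanh (hk : 0 < k) (c : ℝ) {t : ℝ} (ht : t ∈ Ioo (-1 : ℝ) 1) :
    Real.tanh (k * (Real.artanh t / k - c + c)) = t := by
  rw [sub_add_cancel, mul_div_cancel₀ _ hk.ne', Real.tanh_artanh ht]

lemma image_tanh_Ioi (hk : 0 < k) (c : ℝ) :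
    (fun x => Real.tanh (k * (x + c))) '' Ioi 0 = Ioo (Real.tanh (k * c)) 1 := by
  have hm := strictMono_tanh_affine hk c
  ext t
  constructor
  · rintro ⟨x, hx, rfl⟩
    have := hm hx
    simp only [zero_add] at this
    exact ⟨this, Real.tanh_lt_one _⟩
  · rintro ht
    have ht' : t ∈ Ioo (-1 : ℝ) 1 := ⟨(Real.neg_one_lt_tanh _).trans ht.1, ht.2⟩
    refine ⟨Real.artanh t / k - c, ?_, tanh_affine_artanh hk c ht'⟩
    refine hm.lt_iff_lt.1 ?_
    simp only [tanh_affine_artanh hk c ht', zero_add]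
    exact ht.1

lemma image_tanh_Iio (hk : 0 < k) (c : ℝ) :
    (fun x => Real.tanh (k * (x + c))) '' Iio 0 = Ioo (-1) (Real.tanh (k * c)) := by
  have hm := strictMono_tanh_affine hk c
  ext t
  constructor
  · rintro ⟨x, hx, rfl⟩
    have := hm hx
    simp only [zero_add] at this
    exact ⟨Real.neg_one_lt_tanh _, this⟩
  · rintro ht
    have ht' : t ∈ Ioo (-1 : ℝ) 1 := ⟨ht.1, ht.2.trans (Real.tanh_lt_one _)⟩
    refine ⟨Real.artanh t / k - c, ?_, tanh_affine_artanh hk c ht'⟩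
    refine hm.lt_iff_lt.1 ?_
    simp only [tanh_affine_artanh hk c ht', zero_add]
    exact ht.2

lemma abs_deriv_smul_sech (hk : 0 < k) (c r x : ℝ) :
    |k * (1 - Real.tanh (k * (x + c)) ^ 2)| •
      (1 - Real.tanh (k * (x + c)) ^ 2) ^ (r - 1) =
      k * (1 - Real.tanh (k * (x + c)) ^ 2) ^ r := by
  have h := one_sub_tanh_sq_pos (k * (x + c))
  rw [abs_of_pos (by positivity), smul_eq_mul, Real.rpow_sub_one h.ne']
  field_simp

/-- The substitution t = tanh(k(x + c)), with dt = k(1 - t²)dx, lowers the exponent by one. -/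
lemma integral_Ioi_sech_rpow (hk : 0 < k) (c r : ℝ) :
    ∫ x in Ioi 0, (1 - Real.tanh (k * (x + c)) ^ 2) ^ r =
      1 / k * ∫ t in (Real.tanh (k * c))..1, (1 - t ^ 2) ^ (r - 1) := by
  rw [intervalIntegral.integral_of_le (Real.tanh_lt_one _).le, integral_Ioc_eq_integral_Ioo,
    ← image_tanh_Ioi hk c, integral_image_eq_integral_abs_deriv_smul measurableSet_Ioi
      (fun x _ => (hasDerivAt_tanh_affine k c x).hasDerivWithinAt)
      (strictMono_tanh_affine hk c).injective.injOn]
  simp_rw [abs_deriv_smul_sech hk]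
  rw [integral_const_mul]
  field_simp

lemma integral_Iio_sech_rpow (hk : 0 < k) (c r : ℝ) :
    ∫ x in Iio 0, (1 - Real.tanh (k * (x + c)) ^ 2) ^ r =
      1 / k * ∫ t in (-1)..(Real.tanh (k * c)), (1 - t ^ 2) ^ (r - 1) := by
  rw [intervalIntegral.integral_of_le (Real.neg_one_lt_tanh _).le, integral_Ioc_eq_integral_Ioo,
    ← image_tanh_Iio hk c, integral_image_eq_integral_abs_deriv_smul measurableSet_Iio
      (fun x _ => (hasDerivAt_tanh_affine k c x).hasDerivWithinAt)
      (strictMono_tanh_affine hk c).injective.injOn]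
  simp_rw [abs_deriv_smul_sech hk]
  rw [integral_const_mul]
  field_simp

lemma integrable_sech_rpow_affine (hk : 0 < k) (c : ℝ) {r : ℝ} (hr : 0 < r) :
    Integrable fun x => (1 - Real.tanh (k * (x + c)) ^ 2) ^ r :=
  ((integrable_sech_rpow hr).comp_mul_left' hk.ne').comp_add_right c

/-- The exponent r - 1 may be negative, so the singularities at ±1 matter; pulling back by tanh
reduces to the exponential decay of sech^{2r}. -/
lemma intervalIntegrable_one_sub_sq_rpow {r : ℝ} (hr : 0 < r) {a b : ℝ}
    (ha : a ∈ Icc (-1 : ℝ) 1) (hb : b ∈ Icc (-1 : ℝ) 1) :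
    IntervalIntegrable (fun t : ℝ => (1 - t ^ 2) ^ (r - 1)) volume a b := by
  have himg : Real.tanh '' univ = Ioo (-1 : ℝ) 1 := Real.tanh_bijOn.image_eq
  have h : IntegrableOn (fun t : ℝ => (1 - t ^ 2) ^ (r - 1)) (Ioo (-1) 1) := by
    rw [← himg, integrableOn_image_iff_integrableOn_abs_deriv_smul MeasurableSet.univ
      (fun x _ => (hasDerivAt_tanh x).hasDerivWithinAt) Real.tanh_injective.injOn,
      integrableOn_univ]
    refine (integrable_sech_rpow hr).congr (Eventually.of_forall fun x => ?_)
    have := abs_deriv_smul_sech one_pos 0 r x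
    simpa using this.symm
  refine IntervalIntegrable.mono_set (a := -1) (b := 1) ?_ ?_
  · rw [intervalIntegrable_iff_integrableOn_Ioo_of_le (by norm_num)]
    exact h
  · rw [uIcc_of_le (a := (-1 : ℝ)) (b := 1) (by norm_num)]
    exact uIcc_subset_Icc ha hb

/-- The integrand is the derivative of t(1 - t²)^{1/μ}. This links the L² integral to the mass
integral. -/
lemma integral_by_parts {μ : ℝ} (hμ : 0 < μ) {a b : ℝ} (hab : a ≤ b) (ha : a ∈ Icc (-1 : ℝ) 1)
    (hb : b ∈ Icc (-1 : ℝ) 1) :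
    (1 + 2 / μ) * (∫ t in a..b, (1 - t ^ 2) ^ (1 / μ)) -
      2 / μ * (∫ t in a..b, (1 - t ^ 2) ^ (1 / μ - 1)) =
      b * (1 - b ^ 2) ^ (1 / μ) - a * (1 - a ^ 2) ^ (1 / μ) := by
  have i1 : IntervalIntegrable (fun t : ℝ => (1 - t ^ 2) ^ (1 / μ)) volume a b :=
    (continuous_massDensity hμ).intervalIntegrable _ _
  have i2 := intervalIntegrable_one_sub_sq_rpow (r := 1 / μ) (by positivity) ha hb
  rw [← intervalIntegral.integral_const_mul, ← intervalIntegral.integral_const_mul,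
    ← intervalIntegral.integral_sub (i1.const_mul _) (i2.const_mul _)]
  refine intervalIntegral.integral_eq_sub_of_hasDerivAt_of_le
    (f := fun t => t * (1 - t ^ 2) ^ (1 / μ)) hab
    (continuous_id.mul (continuous_massDensity hμ)).continuousOn (fun x hx => ?_)
    ((i1.const_mul _).sub (i2.const_mul _))
  have hz : 0 < 1 - x ^ 2 := one_sub_sq_pos ⟨ha.1.trans_lt hx.1, hx.2.trans_le hb.2⟩
  have h1 : HasDerivAt (fun t : ℝ => 1 - t ^ 2) (-(2 * x)) x := by
    simpa using (hasDerivAt_pow 2 x).const_sub 1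
  have h2 := (hasDerivAt_id x).mul (h1.rpow_const (p := 1 / μ) (Or.inl hz.ne'))
  refine h2.congr_deriv ?_
  simp only [id]
  have e : (1 - x ^ 2) ^ (1 / μ) = (1 - x ^ 2) * (1 - x ^ 2) ^ (1 / μ - 1) := by
    rw [Real.rpow_sub_one hz.ne']; field_simp
  rw [e]
  ring

end Integrals

/-! ### Functions glued at the origin -/

section Piecewise

/-- The complex-valued function equal to `f₁` on the left and to `f₂` on the right half-line. -/
def glue (f₁ f₂ : ℝ → ℝ) (x : ℝ) : ℂ := if x < 0 then (f₁ x : ℂ) else (f₂ x : ℂ)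

variable {f₁ f₂ g₁ g₂ : ℝ → ℝ}

lemma glue_of_neg {x : ℝ} (hx : x < 0) : glue f₁ f₂ x = f₁ x := if_pos hx

lemma glue_of_pos {x : ℝ} (hx : 0 < x) : glue f₁ f₂ x = f₂ x := if_neg hx.le.not_gt

lemma measurable_glue (h₁ : Continuous f₁) (h₂ : Continuous f₂) : Measurable (glue f₁ f₂) :=
  Measurable.ite measurableSet_Iio (Complex.continuous_ofReal.comp h₁).measurable
    (Complex.continuous_ofReal.comp h₂).measurable

lemma hasDerivAt_glue (h₁ : ∀ x, HasDerivAt f₁ (g₁ x) x) (h₂ : ∀ x, HasDerivAt f₂ (g₂ x) x)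
    {x : ℝ} (hx : x ≠ 0) : HasDerivAt (glue f₁ f₂) (glue g₁ g₂ x) x := by
  rcases lt_or_gt_of_ne hx with h | h
  · rw [glue_of_neg h]
    refine (h₁ x).ofReal_comp.congr_of_eventuallyEq ?_
    filter_upwards [Iio_mem_nhds h] with y hy using glue_of_neg hy
  · rw [glue_of_pos h]
    refine (h₂ x).ofReal_comp.congr_of_eventuallyEq ?_
    filter_upwards [Ioi_mem_nhds h] with y hy using glue_of_pos hy

lemma traceLeft_glue (h₁ : Continuous f₁) : traceLeft (glue f₁ f₂) = f₁ 0 :=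
  traceLeft_eq (U := fun x => (f₁ x : ℂ)) (Eventually.of_forall fun _ hx => glue_of_neg hx)
    (((Complex.continuous_ofReal.comp h₁).tendsto 0).mono_left nhdsWithin_le_nhds)

lemma traceRight_glue (h₂ : Continuous f₂) : traceRight (glue f₁ f₂) = f₂ 0 :=
  traceRight_eq (U := fun x => (f₂ x : ℂ)) (Eventually.of_forall fun _ hx => glue_of_pos hx)
    (((Complex.continuous_ofReal.comp h₂).tendsto 0).mono_left nhdsWithin_le_nhds)

lemma integral_eq_Iio_add_Ioi {Φ φ₁ φ₂ : ℝ → ℝ} (e₁ : ∀ x < 0, Φ x = φ₁ x)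
    (e₂ : ∀ x > 0, Φ x = φ₂ x) (i₁ : IntegrableOn φ₁ (Iio 0)) (i₂ : IntegrableOn φ₂ (Ioi 0)) :
    ∫ x, Φ x = (∫ x in Iio 0, φ₁ x) + ∫ x in Ioi 0, φ₂ x := by
  have j₁ : IntegrableOn Φ (Iic 0) := (integrableOn_Iic_iff_integrableOn_Iio (by simp)).2
    (i₁.congr_fun (fun x hx => (e₁ x hx).symm) measurableSet_Iio)
  have j₂ : IntegrableOn Φ (Ioi 0) := i₂.congr_fun (fun x hx => (e₂ x hx).symm) measurableSet_Ioi
  rw [← intervalIntegral.integral_Iic_add_Ioi j₁ j₂, integral_Iic_eq_integral_Iio,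
    setIntegral_congr_fun measurableSet_Iio fun x hx => e₁ x hx,
    setIntegral_congr_fun measurableSet_Ioi fun x hx => e₂ x hx]

end Piecewise

/-! ### The two-soliton profiles: regularity, traces and equation -/

section Profile

variable {μ ω : ℝ}

/-- The first derivative of the soliton. -/
def solitonDeriv (μ ω x : ℝ) : ℝ := -(√ω * Real.tanh (μ * √ω * x)) * soliton μ ω x

/-- The second derivative of the soliton. -/
def solitonDerivTwo (μ ω x : ℝ) : ℝ :=
  ω * soliton μ ω x - soliton μ ω x ^ (2 * μ) * soliton μ ω x

lemma hasDerivAt_solitonDeriv (hμ : 0 < μ) (hω : 0 < ω) (x : ℝ) :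
    HasDerivAt (solitonDeriv μ ω) (solitonDerivTwo μ ω x) x := by
  have h1 := hasDerivAt_tanh_affine (μ * √ω) 0 x
  simp only [add_zero] at h1
  have h2 := ((h1.const_mul √ω).fun_neg).fun_mul (hasDerivAt_soliton (ω := ω) hμ x)
  refine h2.congr_deriv ?_
  rw [solitonDerivTwo, soliton_rpow_two_mul hμ hω]
  have := Real.sq_sqrt hω.le
  linear_combination (Real.tanh (μ * √ω * x) ^ 2 - μ * (1 - Real.tanh (μ * √ω * x) ^ 2)) *
    soliton μ ω x * this

lemma continuous_solitonDeriv (hμ : 0 < μ) (hω : 0 < ω) : Continuous (solitonDeriv μ ω) :=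
  continuous_iff_continuousAt.2 fun x => (hasDerivAt_solitonDeriv hμ hω x).continuousAt

lemma continuous_solitonDerivTwo (hμ : 0 < μ) : Continuous (solitonDerivTwo μ ω) :=
  ((continuous_const.mul (continuous_soliton hμ)).sub (((continuous_soliton hμ).rpow_const
    fun _ => Or.inr (by positivity)).mul (continuous_soliton hμ)))

lemma abs_solitonDeriv_le (hμ : 0 < μ) (hω : 0 < ω) (x : ℝ) :
    |solitonDeriv μ ω x| ≤ √ω * soliton μ ω x := by
  rw [solitonDeriv, abs_mul, abs_neg, abs_mul, abs_of_pos (soliton_pos hμ hω x),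
    abs_of_nonneg (Real.sqrt_nonneg ω)]
  have := (Real.abs_tanh_lt_one (μ * √ω * x)).le
  have h2 := (soliton_pos hμ hω x).le
  gcongr
  exact mul_le_of_le_one_right (Real.sqrt_nonneg ω) this

lemma abs_solitonDerivTwo_le (hμ : 0 < μ) (hω : 0 < ω) (x : ℝ) :
    |solitonDerivTwo μ ω x| ≤ (ω + ω * (μ + 1)) * soliton μ ω x := by
  have h2 := soliton_pos hμ hω x
  have h3 : soliton μ ω x ^ (2 * μ) ≤ ω * (μ + 1) := by
    rw [soliton_rpow_two_mul hμ hω]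
    have h4 : 1 - Real.tanh (μ * √ω * x) ^ 2 ≤ 1 := by linarith [sq_nonneg (Real.tanh (μ * √ω * x))]
    exact mul_le_of_le_one_right (by positivity) h4
  have h4 : 0 ≤ soliton μ ω x ^ (2 * μ) := by positivity
  rw [solitonDerivTwo, ← sub_mul, abs_mul, abs_of_pos h2]
  gcongr
  rw [abs_le]
  constructor <;> nlinarith

lemma soliton_rpow_eq (hμ : 0 < μ) (hω : 0 < ω) (x r : ℝ) :
    soliton μ ω x ^ r = (ω * (μ + 1)) ^ (r / (2 * μ)) *
      (1 - Real.tanh (μ * √ω * x) ^ 2) ^ (r / (2 * μ)) := by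
  rw [soliton_rpow hμ hω, Real.mul_rpow (by positivity) (one_sub_tanh_sq_pos _).le]

lemma soliton_sq_eq (hμ : 0 < μ) (hω : 0 < ω) (x : ℝ) :
    soliton μ ω x ^ 2 = (ω * (μ + 1)) ^ (1 / μ) *
      (1 - Real.tanh (μ * √ω * x) ^ 2) ^ (1 / μ) := by
  have := soliton_rpow_eq hμ hω x 2
  rw [Real.rpow_two, show 2 / (2 * μ) = 1 / μ by field_simp] at this
  exact this

lemma integrable_soliton_sq (hμ : 0 < μ) (hω : 0 < ω) (c : ℝ) :
    Integrable fun x => soliton μ ω (x + c) ^ 2 := by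
  have hk : 0 < μ * √ω := mul_pos hμ (Real.sqrt_pos.2 hω)
  simp_rw [soliton_sq_eq hμ hω]
  exact (integrable_sech_rpow_affine hk c (by positivity)).const_mul _

lemma memLp_glue (hμ : 0 < μ) (hω : 0 < ω) {f₁ f₂ : ℝ → ℝ} (h₁ : Continuous f₁)
    (h₂ : Continuous f₂) {C c₁ c₂ : ℝ} (b₁ : ∀ x, |f₁ x| ≤ C * soliton μ ω (x + c₁))
    (b₂ : ∀ x, |f₂ x| ≤ C * soliton μ ω (x + c₂)) : MemLp (glue f₁ f₂) 2 volume := by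
  have hm := (measurable_glue h₁ h₂).aestronglyMeasurable (μ := volume)
  refine (memLp_two_iff_integrable_sq_norm hm).2 (Integrable.mono'
    (((integrable_soliton_sq hμ hω c₁).add (integrable_soliton_sq hμ hω c₂)).const_mul (C ^ 2))
    (hm.norm.pow 2) (Eventually.of_forall fun x => ?_))
  rw [Real.norm_of_nonneg (by positivity)]
  have e : ∀ y z w : ℝ, 0 ≤ w → |y| ≤ C * z → |y| ^ 2 ≤ C ^ 2 * (z ^ 2 + w) := fun y z w hw h => by
    have h1 : |y| ^ 2 ≤ (C * z) ^ 2 := by gcongr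
    nlinarith [mul_nonneg (sq_nonneg C) hw]
  simp only [Pi.add_apply]
  rcases lt_or_ge x 0 with hx | hx
  · rw [glue_of_neg hx, Complex.norm_real, Real.norm_eq_abs]
    exact e _ _ _ (by positivity) (b₁ x)
  · rw [glue, if_neg hx.not_gt, Complex.norm_real, Real.norm_eq_abs, add_comm (soliton μ ω _ ^ 2)]
    exact e _ _ _ (by positivity) (b₂ x)

variable (μ ω) in
/-- The weak derivative of a two-piece profile. -/
def profileDeriv (σ c₁ c₂ : ℝ) : ℝ → ℂ :=
  glue (fun x => solitonDeriv μ ω (x + c₁)) (fun x => σ * solitonDeriv μ ω (x + c₂))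

variable (μ ω) in
/-- The second weak derivative of a two-piece profile. -/
def profileDerivTwo (σ c₁ c₂ : ℝ) : ℝ → ℂ :=
  glue (fun x => solitonDerivTwo μ ω (x + c₁)) (fun x => σ * solitonDerivTwo μ ω (x + c₂))

variable (μ ω) in
/-- A two-piece soliton profile with sign `σ` on the right and given shifts. -/
def profileAt (σ c₁ c₂ : ℝ) : ℝ → ℂ :=
  glue (fun x => soliton μ ω (x + c₁)) (fun x => σ * soliton μ ω (x + c₂))

lemma profile_eq (τ Tm Tp : ℝ) :
    profile μ τ ω Tm Tp = profileAt μ ω (Real.sign τ) (shift μ ω Tm) (shift μ ω Tp) := rfl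

variable {σ c₁ c₂ : ℝ}

lemma memLp_glue_sign (hμ : 0 < μ) (hω : 0 < ω) (hσ : |σ| = 1) {f : ℝ → ℝ} (h : Continuous f)
    {C : ℝ} (b : ∀ x, |f x| ≤ C * soliton μ ω x) :
    MemLp (glue (fun x => f (x + c₁)) (fun x => σ * f (x + c₂))) 2 volume :=
  memLp_glue hμ hω (h.comp (continuous_id.add continuous_const))
    (continuous_const.mul (h.comp (continuous_id.add continuous_const)))
    (fun x => b (x + c₁)) (fun x => by rw [abs_mul, hσ, one_mul]; exact b (x + c₂))

lemma memLp_profileAt (hμ : 0 < μ) (hω : 0 < ω) (hσ : |σ| = 1) :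
    MemLp (profileAt μ ω σ c₁ c₂) 2 volume :=
  memLp_glue_sign hμ hω hσ (continuous_soliton hμ) (C := 1) fun x => by
    rw [one_mul, abs_of_pos (soliton_pos hμ hω x)]

lemma memLp_profileDeriv (hμ : 0 < μ) (hω : 0 < ω) (hσ : |σ| = 1) :
    MemLp (profileDeriv μ ω σ c₁ c₂) 2 volume :=
  memLp_glue_sign hμ hω hσ (continuous_solitonDeriv hμ hω) (abs_solitonDeriv_le hμ hω)

lemma memLp_profileDerivTwo (hμ : 0 < μ) (hω : 0 < ω) (hσ : |σ| = 1) :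
    MemLp (profileDerivTwo μ ω σ c₁ c₂) 2 volume :=
  memLp_glue_sign hμ hω hσ (continuous_solitonDerivTwo hμ) (abs_solitonDerivTwo_le hμ hω)

lemma isWeakDeriv_profileAt (hμ : 0 < μ) (hω : 0 < ω) (hσ : |σ| = 1) :
    IsWeakDeriv (profileAt μ ω σ c₁ c₂) (profileDeriv μ ω σ c₁ c₂) :=
  isWeakDeriv_of_hasDerivAt (locallyIntegrable_of_memLp_two (memLp_profileAt hμ hω hσ))
    (locallyIntegrable_of_memLp_two (memLp_profileDeriv hμ hω hσ)) fun _ hx =>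
    hasDerivAt_glue (fun x => (hasDerivAt_soliton hμ (x + c₁)).comp_add_const x c₁)
      (fun x => ((hasDerivAt_soliton hμ (x + c₂)).comp_add_const x c₂).const_mul σ) hx

lemma isWeakDeriv_profileDeriv (hμ : 0 < μ) (hω : 0 < ω) (hσ : |σ| = 1) :
    IsWeakDeriv (profileDeriv μ ω σ c₁ c₂) (profileDerivTwo μ ω σ c₁ c₂) :=
  isWeakDeriv_of_hasDerivAt (locallyIntegrable_of_memLp_two (memLp_profileDeriv hμ hω hσ))
    (locallyIntegrable_of_memLp_two (memLp_profileDerivTwo hμ hω hσ)) fun _ hx =>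
    hasDerivAt_glue (fun x => (hasDerivAt_solitonDeriv hμ hω (x + c₁)).comp_add_const x c₁)
      (fun x => ((hasDerivAt_solitonDeriv hμ hω (x + c₂)).comp_add_const x c₂).const_mul σ) hx

lemma memH1_profileAt (hμ : 0 < μ) (hω : 0 < ω) (hσ : |σ| = 1) :
    MemH1 (profileAt μ ω σ c₁ c₂) :=
  ⟨memLp_profileAt hμ hω hσ, _, memLp_profileDeriv hμ hω hσ, isWeakDeriv_profileAt hμ hω hσ⟩

lemma weakDeriv_profileAt (hμ : 0 < μ) (hω : 0 < ω) (hσ : |σ| = 1) :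
    weakDeriv (profileAt μ ω σ c₁ c₂) =ᵐ[volume] profileDeriv μ ω σ c₁ c₂ :=
  weakDeriv_ae_eq (memLp_profileAt hμ hω hσ) (memLp_profileDeriv hμ hω hσ)
    (isWeakDeriv_profileAt hμ hω hσ)

lemma isWeakDeriv_weakDeriv_profileAt (hμ : 0 < μ) (hω : 0 < ω) (hσ : |σ| = 1) :
    IsWeakDeriv (weakDeriv (profileAt μ ω σ c₁ c₂)) (profileDerivTwo μ ω σ c₁ c₂) :=
  (isWeakDeriv_profileDeriv hμ hω hσ).congr (weakDeriv_profileAt hμ hω hσ).symm EventuallyEq.rfl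

lemma memH2_profileAt (hμ : 0 < μ) (hω : 0 < ω) (hσ : |σ| = 1) :
    MemH2 (profileAt μ ω σ c₁ c₂) :=
  ⟨memH1_profileAt hμ hω hσ, (memH1_profileAt hμ hω hσ).weakDeriv_spec.1, _,
    memLp_profileDerivTwo hμ hω hσ, isWeakDeriv_weakDeriv_profileAt hμ hω hσ⟩

lemma weakDeriv_weakDeriv_profileAt (hμ : 0 < μ) (hω : 0 < ω) (hσ : |σ| = 1) :
    weakDeriv (weakDeriv (profileAt μ ω σ c₁ c₂)) =ᵐ[volume] profileDerivTwo μ ω σ c₁ c₂ :=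
  weakDeriv_ae_eq (memH1_profileAt hμ hω hσ).weakDeriv_spec.1 (memLp_profileDerivTwo hμ hω hσ)
    (isWeakDeriv_weakDeriv_profileAt hμ hω hσ)

lemma ae_ne_zero : ∀ᵐ x : ℝ, x ≠ 0 := by simp [ae_iff]

lemma profileAt_not_ae_zero (hμ : 0 < μ) (hω : 0 < ω) :
    ¬ profileAt μ ω σ c₁ c₂ =ᵐ[volume] 0 := fun h => by
  have h1 : ∀ᶠ x in 𝓝[<] (0 : ℝ) ⊓ ae volume, profileAt μ ω σ c₁ c₂ x = 0 :=
    h.filter_mono inf_le_right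
  have h2 : ∀ᶠ x in 𝓝[<] (0 : ℝ) ⊓ ae volume, x < 0 :=
    (eventually_mem_nhdsWithin).filter_mono inf_le_left
  obtain ⟨x, hx, hx0⟩ := (h1.and h2).exists
  rw [profileAt, glue_of_neg hx0] at hx
  exact (soliton_pos hμ hω (x + c₁)).ne' (by exact_mod_cast hx)

lemma traceLeft_profileAt (hμ : 0 < μ) :
    traceLeft (profileAt μ ω σ c₁ c₂) = (soliton μ ω c₁ : ℂ) := by
  have := traceLeft_glue (f₁ := fun x => soliton μ ω (x + c₁))
    (f₂ := fun x => σ * soliton μ ω (x + c₂))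
    ((continuous_soliton hμ).comp (continuous_id.add continuous_const))
  simpa [profileAt] using this

lemma traceRight_profileAt (hμ : 0 < μ) :
    traceRight (profileAt μ ω σ c₁ c₂) = ((σ * soliton μ ω c₂ : ℝ) : ℂ) := by
  have := traceRight_glue (f₁ := fun x => soliton μ ω (x + c₁))
    (f₂ := fun x => σ * soliton μ ω (x + c₂))
    (continuous_const.mul ((continuous_soliton hμ).comp (continuous_id.add continuous_const)))
  simpa [profileAt] using this

lemma traceLeft_profileDeriv (hμ : 0 < μ) (hω : 0 < ω) :
    traceLeft (profileDeriv μ ω σ c₁ c₂) = (solitonDeriv μ ω c₁ : ℂ) := by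
  have := traceLeft_glue (f₁ := fun x => solitonDeriv μ ω (x + c₁))
    (f₂ := fun x => σ * solitonDeriv μ ω (x + c₂))
    ((continuous_solitonDeriv hμ hω).comp (continuous_id.add continuous_const))
  simpa [profileDeriv] using this

lemma traceRight_profileDeriv (hμ : 0 < μ) (hω : 0 < ω) :
    traceRight (profileDeriv μ ω σ c₁ c₂) = ((σ * solitonDeriv μ ω c₂ : ℝ) : ℂ) := by
  have := traceRight_glue (f₁ := fun x => solitonDeriv μ ω (x + c₁))
    (f₂ := fun x => σ * solitonDeriv μ ω (x + c₂))
    (continuous_const.mul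
      ((continuous_solitonDeriv hμ hω).comp (continuous_id.add continuous_const)))
  simpa [profileDeriv] using this

lemma profileAt_stationary (hμ : 0 < μ) (hω : 0 < ω) (hσ : |σ| = 1) :
    ∀ᵐ x, -weakDeriv (weakDeriv (profileAt μ ω σ c₁ c₂)) x -
      ((‖profileAt μ ω σ c₁ c₂ x‖ ^ (2 * μ) : ℝ) : ℂ) * profileAt μ ω σ c₁ c₂ x +
        (ω : ℂ) * profileAt μ ω σ c₁ c₂ x = 0 := by
  filter_upwards [weakDeriv_weakDeriv_profileAt (c₁ := c₁) (c₂ := c₂) hμ hω hσ, ae_ne_zero]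
    with x hx hx0
  rw [hx]
  rcases lt_or_gt_of_ne hx0 with h | h
  · rw [profileDerivTwo, profileAt, glue_of_neg h, glue_of_neg h, Complex.norm_real,
      Real.norm_of_nonneg (soliton_pos hμ hω _).le, solitonDerivTwo]
    push_cast
    ring
  · rw [profileDerivTwo, profileAt, glue_of_pos h, glue_of_pos h, Complex.norm_real, norm_mul,
      Real.norm_eq_abs σ, hσ, one_mul, Real.norm_of_nonneg (soliton_pos hμ hω _).le,
      solitonDerivTwo]
    push_cast
    ring

/-! ### Norms of the profiles -/

section Norms

variable {Tm Tp : ℝ}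

lemma integral_Iio_const_mul_sech (hμ : 0 < μ) (hω : 0 < ω) (hm : Tm ∈ Ioo (-1 : ℝ) 1) (C r : ℝ) :
    ∫ x in Iio 0, C * (1 - Real.tanh (μ * √ω * (x + shift μ ω Tm)) ^ 2) ^ r =
      C / (μ * √ω) * ∫ t in (-1)..Tm, (1 - t ^ 2) ^ (r - 1) := by
  have hk : 0 < μ * √ω := mul_pos hμ (Real.sqrt_pos.2 hω)
  rw [integral_const_mul, integral_Iio_sech_rpow hk, tanh_mul_shift hμ hω hm]
  ring

lemma integral_Ioi_const_mul_sech (hμ : 0 < μ) (hω : 0 < ω) (hp : Tp ∈ Ioo (-1 : ℝ) 1) (C r : ℝ) :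
    ∫ x in Ioi 0, C * (1 - Real.tanh (μ * √ω * (x + shift μ ω Tp)) ^ 2) ^ r =
      C / (μ * √ω) * ∫ t in Tp..1, (1 - t ^ 2) ^ (r - 1) := by
  have hk : 0 < μ * √ω := mul_pos hμ (Real.sqrt_pos.2 hω)
  rw [integral_const_mul, integral_Ioi_sech_rpow hk, tanh_mul_shift hμ hω hp]
  ring

/-- The integral of a power of `1 - t²` over `(-1, T₋) ∪ (T₊, 1)`. -/
lemma integral_complement {r : ℝ} (hr : 0 < r) (hm : Tm ∈ Ioo (-1 : ℝ) 1)
    (hp : Tp ∈ Ioo (-1 : ℝ) 1) :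
    (∫ t in (-1 : ℝ)..Tm, (1 - t ^ 2) ^ (r - 1)) + (∫ t in Tp..1, (1 - t ^ 2) ^ (r - 1)) =
      (∫ t in (-1 : ℝ)..1, (1 - t ^ 2) ^ (r - 1)) - ∫ t in Tm..Tp, (1 - t ^ 2) ^ (r - 1) := by
  have hm' := Ioo_subset_Icc_self hm
  have hp' := Ioo_subset_Icc_self hp
  have h1 : (-1 : ℝ) ∈ Icc (-1 : ℝ) 1 := by simp
  have h2 : (1 : ℝ) ∈ Icc (-1 : ℝ) 1 := by simp
  have e1 := intervalIntegral.integral_add_adjacent_intervals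
    (intervalIntegrable_one_sub_sq_rpow hr h1 hm') (intervalIntegrable_one_sub_sq_rpow hr hm' hp')
  have e2 := intervalIntegral.integral_add_adjacent_intervals
    (intervalIntegrable_one_sub_sq_rpow hr h1 hp') (intervalIntegrable_one_sub_sq_rpow hr hp' h2)
  linarith

lemma integral_profile {Φ : ℝ → ℝ} (hμ : 0 < μ) (hω : 0 < ω) (hm : Tm ∈ Ioo (-1 : ℝ) 1)
    (hp : Tp ∈ Ioo (-1 : ℝ) 1) {C r : ℝ} (hr : 0 < r)
    (e₁ : ∀ x < 0, Φ x = C * (1 - Real.tanh (μ * √ω * (x + shift μ ω Tm)) ^ 2) ^ r)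
    (e₂ : ∀ x > 0, Φ x = C * (1 - Real.tanh (μ * √ω * (x + shift μ ω Tp)) ^ 2) ^ r) :
    ∫ x, Φ x = C / (μ * √ω) * ((∫ t in (-1 : ℝ)..1, (1 - t ^ 2) ^ (r - 1)) -
      ∫ t in Tm..Tp, (1 - t ^ 2) ^ (r - 1)) := by
  have hk : 0 < μ * √ω := mul_pos hμ (Real.sqrt_pos.2 hω)
  rw [integral_eq_Iio_add_Ioi e₁ e₂
    ((integrable_sech_rpow_affine hk _ hr).const_mul C).integrableOn
    ((integrable_sech_rpow_affine hk _ hr).const_mul C).integrableOn,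
    integral_Iio_const_mul_sech hμ hω hm, integral_Ioi_const_mul_sech hμ hω hp,
    ← integral_complement hr hm hp]
  ring

lemma norm_profileAt_of_neg (hμ : 0 < μ) (hω : 0 < ω) {x : ℝ} (hx : x < 0) :
    ‖profileAt μ ω σ c₁ c₂ x‖ = soliton μ ω (x + c₁) := by
  rw [profileAt, glue_of_neg hx, Complex.norm_real, Real.norm_of_nonneg (soliton_pos hμ hω _).le]

lemma norm_profileAt_of_pos (hμ : 0 < μ) (hω : 0 < ω) (hσ : |σ| = 1) {x : ℝ} (hx : 0 < x) :
    ‖profileAt μ ω σ c₁ c₂ x‖ = soliton μ ω (x + c₂) := by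
  rw [profileAt, glue_of_pos hx, Complex.norm_real, norm_mul, Real.norm_eq_abs σ, hσ, one_mul,
    Real.norm_of_nonneg (soliton_pos hμ hω _).le]

lemma const_normSq (hμ : 0 < μ) (hω : 0 < ω) : (ω * (μ + 1)) ^ (1 / μ) / (μ * √ω) =
    (μ + 1) ^ (1 / μ) / μ * ω ^ (1 / μ - 1 / 2) := by
  rw [Real.mul_rpow hω.le (by positivity), Real.rpow_sub hω, ← Real.sqrt_eq_rpow]
  have := Real.sqrt_pos.2 hω
  field_simp

lemma const_powNorm (hμ : 0 < μ) (hω : 0 < ω) : (ω * (μ + 1)) ^ (1 / μ + 1) / (μ * √ω) =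
    massConst μ ω := by
  rw [massConst, Real.mul_rpow hω.le (by positivity),
    show 1 / μ + 1 / 2 = 1 / μ + 1 - 1 / 2 by ring, Real.rpow_sub hω _ (1 / 2),
    ← Real.sqrt_eq_rpow]
  have := Real.sqrt_pos.2 hω
  field_simp

lemma normSq_profile (hμ : 0 < μ) (hω : 0 < ω) (hσ : |σ| = 1) (hm : Tm ∈ Ioo (-1 : ℝ) 1)
    (hp : Tp ∈ Ioo (-1 : ℝ) 1) :
    normSq (profileAt μ ω σ (shift μ ω Tm) (shift μ ω Tp)) =
      (μ + 1) ^ (1 / μ) / μ * ω ^ (1 / μ - 1 / 2) *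
      ((∫ t in (-1 : ℝ)..1, (1 - t ^ 2) ^ (1 / μ - 1))
        - ∫ t in Tm..Tp, (1 - t ^ 2) ^ (1 / μ - 1)) := by
  rw [normSq, ← const_normSq hμ hω]
  refine integral_profile hμ hω hm hp (by positivity) (fun x hx => ?_) (fun x hx => ?_)
  · rw [norm_profileAt_of_neg hμ hω hx, soliton_sq_eq hμ hω]
  · rw [norm_profileAt_of_pos hμ hω hσ hx, soliton_sq_eq hμ hω]

lemma powNorm_profile (hμ : 0 < μ) (hω : 0 < ω) (hσ : |σ| = 1) (hm : Tm ∈ Ioo (-1 : ℝ) 1)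
    (hp : Tp ∈ Ioo (-1 : ℝ) 1) :
    powNorm μ (profileAt μ ω σ (shift μ ω Tm) (shift μ ω Tp)) = massConst μ ω *
      ((∫ t in (-1 : ℝ)..1, (1 - t ^ 2) ^ (1 / μ)) - ∫ t in Tm..Tp, (1 - t ^ 2) ^ (1 / μ)) := by
  have e : (2 * μ + 2) / (2 * μ) = 1 / μ + 1 := by field_simp; ring
  have h := integral_profile (Φ := fun x => ‖profileAt μ ω σ (shift μ ω Tm) (shift μ ω Tp) x‖ ^
    (2 * μ + 2)) (C := (ω * (μ + 1)) ^ (1 / μ + 1)) (r := 1 / μ + 1) hμ hω hm hp (by positivity)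
    (fun x hx => by rw [norm_profileAt_of_neg hμ hω hx, soliton_rpow_eq hμ hω, e])
    (fun x hx => by rw [norm_profileAt_of_pos hμ hω hσ hx, soliton_rpow_eq hμ hω, e])
  rw [powNorm, h, const_powNorm hμ hω]
  simp only [add_sub_cancel_right]

lemma solitonDeriv_sq (hω : 0 < ω) (x : ℝ) : |solitonDeriv μ ω x| ^ 2 =
    ω * soliton μ ω x ^ 2 - ω * ((1 - Real.tanh (μ * √ω * x) ^ 2) * soliton μ ω x ^ 2) := by
  rw [sq_abs, solitonDeriv]
  linear_combination Real.tanh (μ * √ω * x) ^ 2 * soliton μ ω x ^ 2 * Real.sq_sqrt hω.le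

lemma derivNormSq_profile_aux (hμ : 0 < μ) (hω : 0 < ω) (hσ : |σ| = 1) (hm : Tm ∈ Ioo (-1 : ℝ) 1)
    (hp : Tp ∈ Ioo (-1 : ℝ) 1) :
    derivNormSq (profileAt μ ω σ (shift μ ω Tm) (shift μ ω Tp)) =
      ω * ((μ + 1) ^ (1 / μ) / μ * ω ^ (1 / μ - 1 / 2)) *
      (((∫ t in (-1 : ℝ)..1, (1 - t ^ 2) ^ (1 / μ - 1))
        - ∫ t in Tm..Tp, (1 - t ^ 2) ^ (1 / μ - 1)) -
       ((∫ t in (-1 : ℝ)..1, (1 - t ^ 2) ^ (1 / μ)) - ∫ t in Tm..Tp, (1 - t ^ 2) ^ (1 / μ))) := by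
  set C := (ω * (μ + 1)) ^ (1 / μ) with hC
  have hk : 0 < μ * √ω := mul_pos hμ (Real.sqrt_pos.2 hω)
  have hW : ∀ c x, |solitonDeriv μ ω (x + c)| ^ 2 =
      ω * C * (1 - Real.tanh (μ * √ω * (x + c)) ^ 2) ^ (1 / μ) -
        ω * C * (1 - Real.tanh (μ * √ω * (x + c)) ^ 2) ^ (1 / μ + 1) := fun c x => by
    rw [solitonDeriv_sq hω, soliton_sq_eq hμ hω, Real.rpow_add_one (one_sub_tanh_sq_pos _).ne']
    ring
  have hi := fun c => (integrable_sech_rpow_affine hk c (r := 1 / μ) (by positivity)).const_mul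
    (ω * C)
  have hi' := fun c => (integrable_sech_rpow_affine hk c (r := 1 / μ + 1) (by positivity)).const_mul
    (ω * C)
  have j : ∀ c, Integrable fun x => ω * C * (1 - Real.tanh (μ * √ω * (x + c)) ^ 2) ^ (1 / μ) -
      ω * C * (1 - Real.tanh (μ * √ω * (x + c)) ^ 2) ^ (1 / μ + 1) := fun c => (hi c).sub (hi' c)
  have h1 : derivNormSq (profileAt μ ω σ (shift μ ω Tm) (shift μ ω Tp)) =
      ∫ x, ‖profileDeriv μ ω σ (shift μ ω Tm) (shift μ ω Tp) x‖ ^ 2 :=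
    integral_congr_ae (by
      filter_upwards [weakDeriv_profileAt (c₁ := shift μ ω Tm) (c₂ := shift μ ω Tp) hμ hω hσ]
        with x hx
      rw [hx])
  rw [h1, integral_eq_Iio_add_Ioi
    (fun x hx => by
      rw [profileDeriv, glue_of_neg hx, Complex.norm_real, Real.norm_eq_abs]
      exact hW (shift μ ω Tm) x)
    (fun x hx => by
      rw [profileDeriv, glue_of_pos hx, Complex.norm_real, Real.norm_eq_abs, abs_mul, hσ, one_mul]
      exact hW (shift μ ω Tp) x)
    (j _).integrableOn (j _).integrableOn,
    integral_sub (hi _).integrableOn (hi' _).integrableOn,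
    integral_sub (hi _).integrableOn (hi' _).integrableOn,
    integral_Iio_const_mul_sech hμ hω hm, integral_Iio_const_mul_sech hμ hω hm,
    integral_Ioi_const_mul_sech hμ hω hp, integral_Ioi_const_mul_sech hμ hω hp,
    ← integral_complement (r := 1 / μ) (by positivity) hm hp, ← const_normSq hμ hω]
  have h2 := integral_complement (r := 1 / μ + 1) (by positivity) hm hp
  simp only [add_sub_cancel_right] at h2 ⊢
  rw [← h2]
  ring

/-- `integral_by_parts` on (-1,T₋) and on (T₊,1); the boundary terms at ±1 vanish because 0^{1/μ} =
0. -/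
lemma integral_relation (hμ : 0 < μ) (hm : Tm ∈ Ioo (-1 : ℝ) 1) (hp : Tp ∈ Ioo (-1 : ℝ) 1) :
    2 / μ * ((∫ t in (-1 : ℝ)..1, (1 - t ^ 2) ^ (1 / μ - 1))
        - ∫ t in Tm..Tp, (1 - t ^ 2) ^ (1 / μ - 1)) =
      (1 + 2 / μ) * ((∫ t in (-1 : ℝ)..1, (1 - t ^ 2) ^ (1 / μ)) -
        ∫ t in Tm..Tp, (1 - t ^ 2) ^ (1 / μ)) +
      (Tp * (1 - Tp ^ 2) ^ (1 / μ) - Tm * (1 - Tm ^ 2) ^ (1 / μ)) := by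
  have hz : (0 : ℝ) ^ (1 / μ) = 0 := Real.zero_rpow (by positivity)
  have e1 := integral_by_parts hμ hm.1.le (by simp) (Ioo_subset_Icc_self hm)
  have e2 := integral_by_parts hμ hp.2.le (Ioo_subset_Icc_self hp) (by simp)
  have h1 := integral_complement (r := 1 / μ) (by positivity) hm hp
  have h2 := integral_complement (r := 1 / μ + 1) (by positivity) hm hp
  simp only [add_sub_cancel_right] at h2
  rw [← h1, ← h2]
  norm_num [hz] at e1 e2
  simp only [one_div] at *
  linarith

lemma traceLeft_normSq_profile (hμ : 0 < μ) (hω : 0 < ω) (hm : Tm ∈ Ioo (-1 : ℝ) 1) :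
    ‖traceLeft (profileAt μ ω σ (shift μ ω Tm) (shift μ ω Tp))‖ ^ 2 =
      (μ + 1) ^ (1 / μ) * ω ^ (1 / μ) * (1 - Tm ^ 2) ^ (1 / μ) := by
  rw [traceLeft_profileAt hμ, Complex.norm_real, Real.norm_of_nonneg (soliton_pos hμ hω _).le,
    soliton_sq_eq hμ hω, tanh_mul_shift hμ hω hm, Real.mul_rpow hω.le (by positivity)]
  ring

lemma normIdentities_profile (hμ : 0 < μ) (hω : 0 < ω) (hσ : |σ| = 1) (hm : Tm ∈ Ioo (-1 : ℝ) 1)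
    (hp : Tp ∈ Ioo (-1 : ℝ) 1) :
    NormIdentities μ ω Tm Tp (profileAt μ ω σ (shift μ ω Tm) (shift μ ω Tp)) := by
  refine ⟨?_, normSq_profile hμ hω hσ hm hp, powNorm_profile hμ hω hσ hm hp,
    traceLeft_normSq_profile hμ hω hm⟩
  rw [derivNormSq_profile_aux hμ hω hσ hm hp]
  have h := integral_relation hμ hm hp
  have e : ω ^ (1 / μ + 1 / 2) = ω * ω ^ (1 / μ - 1 / 2) := by
    rw [← Real.rpow_one_add' hω.le (by
      have : 0 < 1 / μ := by positivity
      intro h0; linarith)]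
    congr 1; ring
  rw [e]
  generalize (∫ t in (-1 : ℝ)..1, (1 - t ^ 2) ^ (1 / μ - 1))
        - ∫ t in Tm..Tp, (1 - t ^ 2) ^ (1 / μ - 1) = J at *
  generalize (∫ t in (-1 : ℝ)..1, (1 - t ^ 2) ^ (1 / μ)) -
        ∫ t in Tm..Tp, (1 - t ^ 2) ^ (1 / μ) = K at *
  have hJ : J - K = μ / 2 * (K + (Tp * (1 - Tp ^ 2) ^ (1 / μ) - Tm * (1 - Tm ^ 2) ^ (1 / μ))) := by
    field_simp at h
    linarith
  rw [hJ]
  field_simp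
  ring

end Norms

end Profile

/-! ### Root pairs give stationary states on the Nehari manifold -/

section StationaryProfile

variable {μ v τ ω Tm Tp : ℝ}

lemma abs_sign (hτ0 : τ ≠ 0) : |Real.sign τ| = 1 := by
  rcases Real.sign_apply_eq_of_ne_zero τ hτ0 with h | h <;> simp [h]

lemma mul_sign_eq_abs : τ * Real.sign τ = |τ| := by
  rcases lt_trichotomy τ 0 with h | h | h
  · rw [Real.sign_of_neg h, abs_of_neg h, mul_neg_one]
  · simp [h]
  · rw [Real.sign_of_pos h, abs_of_pos h, mul_one]

lemma sign_mul_abs_eq : Real.sign τ * |τ| = τ := by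
  rcases lt_trichotomy τ 0 with h | h | h
  · rw [Real.sign_of_neg h, abs_of_neg h, neg_one_mul, neg_neg]
  · simp [h]
  · rw [Real.sign_of_pos h, abs_of_pos h, one_mul]

lemma soliton_shift_eq (hμ : 0 < μ) (hω : 0 < ω) (hm : Tm ∈ Ioo (-1 : ℝ) 1)
    (hp : Tp ∈ Ioo (-1 : ℝ) 1) (he : |τ| ^ (2 * μ) * (1 - Tm ^ 2) = 1 - Tp ^ 2) :
    soliton μ ω (shift μ ω Tp) = |τ| * soliton μ ω (shift μ ω Tm) := by
  have h1 := (soliton_pos hμ hω (shift μ ω Tm)).le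
  rw [← Real.rpow_left_inj (z := 2 * μ) (soliton_pos hμ hω _).le (by positivity) (by positivity),
    Real.mul_rpow (abs_nonneg _) h1, soliton_rpow_two_mul hμ hω, soliton_rpow_two_mul hμ hω,
    tanh_mul_shift hμ hω hm, tanh_mul_shift hμ hω hp, ← he]
  ring

/-- The equation p(1 - T₋²) = 1 - T₊² is the trace condition raised to the power 2μ. Since φ' =
-√ωTφ at the origin, the linear relation between T₋ and T₊ is then the derivative condition. -/
lemma isStationaryState_profile (hμ : 0 < μ) (hω : 0 < ω) (hτ0 : τ ≠ 0)
    (hm : Tm ∈ Ioo (-1 : ℝ) 1) (hp : Tp ∈ Ioo (-1 : ℝ) 1) (h : Tp = (Tm + v / √ω) / τ ^ 2)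
    (he : |τ| ^ (2 * μ) * (1 - Tm ^ 2) = 1 - Tp ^ 2) :
    IsStationaryState μ v τ ω (profile μ τ ω Tm Tp) := by
  have hs := abs_sign hτ0
  have hj := soliton_shift_eq hμ hω hm hp he
  have hτs : τ * Real.sign τ = |τ| := mul_sign_eq_abs
  have hsq := Real.sqrt_pos.2 hω
  have hV : τ ^ 2 * Tp = Tm + v / √ω := by rw [h]; field_simp
  have hV' : √ω * (τ ^ 2 * Tp - Tm) = v := by rw [hV]; field_simp; ring
  rw [profile_eq]
  refine ⟨memH2_profileAt hμ hω hs, profileAt_not_ae_zero hμ hω, profileAt_stationary hμ hω hs,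
    ?_, ?_⟩
  · rw [traceRight_profileAt hμ, traceLeft_profileAt hμ, hj, ← mul_assoc, sign_mul_abs_eq, Complex.ofReal_mul]
  · have hd := weakDeriv_profileAt (c₁ := shift μ ω Tm) (c₂ := shift μ ω Tp) hμ hω hs
    rw [traceLeft_congr hd, traceRight_congr hd, traceLeft_profileDeriv hμ hω,
      traceRight_profileDeriv hμ hω, traceLeft_profileAt hμ, solitonDeriv, solitonDeriv,
      tanh_mul_shift hμ hω hm, tanh_mul_shift hμ hω hp, hj]
    norm_cast
    linear_combination soliton μ ω (shift μ ω Tm) * hV' +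
      √ω * Tp * soliton μ ω (shift μ ω Tm) * (|τ| * hτs + sq_abs τ)

/-- The functional is evaluated from the explicit norms: `integral_relation` removes the L²
integral, and the boundary terms cancel because v = √ω(τ²T₊ - T₋). -/
lemma memNehari_profile (hμ : 0 < μ) (hω : 0 < ω) (hτ0 : τ ≠ 0)
    (hm : Tm ∈ Ioo (-1 : ℝ) 1) (hp : Tp ∈ Ioo (-1 : ℝ) 1) (h : Tp = (Tm + v / √ω) / τ ^ 2)
    (he : |τ| ^ (2 * μ) * (1 - Tm ^ 2) = 1 - Tp ^ 2) :
    MemNehari μ v τ ω (profile μ τ ω Tm Tp) := by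
  obtain ⟨h1, h2, -, h3, -⟩ := isStationaryState_profile hμ hω hτ0 hm hp h he
  refine ⟨⟨h1.1, h3⟩, h2, ?_⟩
  obtain ⟨e1, e2, e3, e4⟩ := normIdentities_profile hμ hω (abs_sign hτ0) hm hp
  have hr := integral_relation hμ hm hp
  have hsq := Real.sqrt_pos.2 hω
  have hV : τ ^ 2 * Tp = Tm + v / √ω := by rw [h]; field_simp
  have hy := one_sub_sq_pos hm
  have hb : (1 - Tp ^ 2) ^ (1 / μ) = τ ^ 2 * (1 - Tm ^ 2) ^ (1 / μ) := by
    rw [← he, Real.mul_rpow (by positivity) hy.le, ← Real.rpow_mul (abs_nonneg τ),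
      show 2 * μ * (1 / μ) = 2 by field_simp, Real.rpow_two, sq_abs]
  have hw : ω ^ (1 / μ + 1 / 2) = ω ^ (1 / μ) * √ω := by
    rw [Real.rpow_add hω, ← Real.sqrt_eq_rpow]
  have hw' : ω * ω ^ (1 / μ - 1 / 2) = ω ^ (1 / μ) * √ω := by
    rw [Real.rpow_sub hω, ← Real.sqrt_eq_rpow]
    have := Real.mul_self_sqrt hω.le
    field_simp
    linarith
  have hc : (μ + 1) ^ (1 / μ + 1) = (μ + 1) ^ (1 / μ) * (μ + 1) :=
    Real.rpow_add_one (by positivity) _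
  rw [nehari, profile_eq, e1, e2, e3, e4, hc, hw]
  rw [hb] at hr ⊢
  generalize (∫ t in (-1 : ℝ)..1, (1 - t ^ 2) ^ (1 / μ - 1))
        - ∫ t in Tm..Tp, (1 - t ^ 2) ^ (1 / μ - 1) = J at *
  generalize (∫ t in (-1 : ℝ)..1, (1 - t ^ 2) ^ (1 / μ)) -
        ∫ t in Tm..Tp, (1 - t ^ 2) ^ (1 / μ) = K at *
  have hv : v = √ω * (τ ^ 2 * Tp - Tm) := by rw [hV]; field_simp; ring
  have hJ : J = μ / 2 * ((1 + 2 / μ) * K + (Tp * (τ ^ 2 * (1 - Tm ^ 2) ^ (1 / μ)) -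
      Tm * (1 - Tm ^ 2) ^ (1 / μ))) := by
    rw [← hr]; field_simp
  have e5 : ω * ((μ + 1) ^ (1 / μ) / μ * ω ^ (1 / μ - 1 / 2) * J) =
      (μ + 1) ^ (1 / μ) / μ * (ω ^ (1 / μ) * √ω) * J := by rw [← hw']; ring
  rw [e5, hJ, hv]
  field_simp
  ring

lemma action_eq_of_nehari {u : ℝ → ℂ} (hμ : 0 < μ) (h : nehari μ v ω u = 0) :
    action μ v ω u = reducedAction μ u := by
  rw [nehari] at h
  rw [action, energy, reducedAction]
  have : derivNormSq u = powNorm μ u + v * ‖traceLeft u‖ ^ 2 - ω * normSq u := by linarith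
  rw [this]
  field_simp
  ring

end StationaryProfile

/-! ### Invariance under constant phases and a.e. equality -/

section Invariance

variable {μ v τ ω : ℝ} {u w : ℝ → ℂ} {c : ℂ}

lemma MemH1.congr (h : MemH1 u) (e : u =ᵐ[volume] w) : MemH1 w :=
  ⟨h.1.ae_eq e, weakDeriv u, h.weakDeriv_spec.1, h.weakDeriv_spec.2.congr e EventuallyEq.rfl⟩

lemma MemH1.const_mul (h : MemH1 u) (c : ℂ) : MemH1 fun x => c * u x :=
  ⟨h.1.const_mul c, _, h.weakDeriv_spec.1.const_mul c, h.weakDeriv_spec.2.const_mul c⟩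

lemma MemH1.weakDeriv_phase (h : MemH1 u) (c : ℂ) (e : w =ᵐ[volume] fun x => c * u x) :
    weakDeriv w =ᵐ[volume] fun x => c * weakDeriv u x :=
  weakDeriv_ae_eq ((h.const_mul c).congr e.symm).1 (h.weakDeriv_spec.1.const_mul c)
    ((h.weakDeriv_spec.2.const_mul c).congr e.symm EventuallyEq.rfl)

lemma MemH1.tendsto_traceRight (h : MemH1 u) :
    Tendsto u (𝓝[>] (0 : ℝ) ⊓ ae volume) (𝓝 (traceRight u)) := by
  have hc := (continuous_prim (locallyIntegrable_of_memLp_two h.weakDeriv_spec.1)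
    (traceRight u)).tendsto 0
  rw [prim_zero] at hc
  refine (hc.mono_left (inf_le_left.trans nhdsWithin_le_nhds)).congr' ?_
  have h1 : ∀ᶠ x in 𝓝[>] (0 : ℝ) ⊓ ae volume, 0 < x :=
    (eventually_mem_nhdsWithin).filter_mono inf_le_left
  filter_upwards [h1, h.exists_prim.1.filter_mono inf_le_right] with x hx hx'
  exact (hx' hx).symm

lemma MemH1.tendsto_traceLeft (h : MemH1 u) :
    Tendsto u (𝓝[<] (0 : ℝ) ⊓ ae volume) (𝓝 (traceLeft u)) := by
  have hl := LocallyIntegrable.comp_neg_real (locallyIntegrable_of_memLp_two h.weakDeriv_spec.1)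
  have hc := ((continuous_prim hl.neg (traceLeft u)).comp continuous_neg).tendsto 0
  rw [Function.comp_apply, neg_zero, prim_zero] at hc
  refine (hc.mono_left (inf_le_left.trans nhdsWithin_le_nhds)).congr' ?_
  have h1 : ∀ᶠ x in 𝓝[<] (0 : ℝ) ⊓ ae volume, x < 0 :=
    (eventually_mem_nhdsWithin).filter_mono inf_le_left
  filter_upwards [h1, (ae_comp_neg h.exists_prim.2).filter_mono inf_le_right] with x hx hx'
  have := hx' (neg_pos.2 hx)
  rw [neg_neg] at this
  exact this.symm

lemma MemH1.trace_phase (h : MemH1 u) (c : ℂ) (e : w =ᵐ[volume] fun x => c * u x) :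
    traceLeft w = c * traceLeft u ∧ traceRight w = c * traceRight u := by
  rw [traceLeft_congr e, traceRight_congr e]
  exact ⟨(h.tendsto_traceLeft.const_mul c).limUnder_eq,
    (h.tendsto_traceRight.const_mul c).limUnder_eq⟩

lemma powNorm_phase (hc : ‖c‖ = 1) (e : w =ᵐ[volume] fun x => c * u x) :
    powNorm μ w = powNorm μ u :=
  integral_congr_ae (by filter_upwards [e] with x hx; rw [hx, norm_mul, hc, one_mul])

lemma normSq_phase (hc : ‖c‖ = 1) (e : w =ᵐ[volume] fun x => c * u x) : normSq w = normSq u :=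
  integral_congr_ae (by filter_upwards [e] with x hx; rw [hx, norm_mul, hc, one_mul])

lemma MemNehari.phase (h : MemNehari μ v τ ω u) (hc : ‖c‖ = 1)
    (e : w =ᵐ[volume] fun x => c * u x) : MemNehari μ v τ ω w := by
  obtain ⟨⟨h1, h2⟩, h3, h4⟩ := h
  obtain ⟨t1, t2⟩ := h1.trace_phase c e
  refine ⟨⟨(h1.const_mul c).congr e.symm, by rw [t1, t2, h2]; ring⟩, fun h0 => h3 ?_, ?_⟩
  · filter_upwards [h0, e] with x hx he
    rw [hx] at he
    have hc0 : c ≠ 0 := fun h => by simp [h] at hc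
    exact (mul_eq_zero.1 he.symm).resolve_left hc0
  · have hd : derivNormSq w = derivNormSq u := normSq_phase hc (h1.weakDeriv_phase c e)
    rw [nehari, hd, powNorm_phase hc e, normSq_phase hc e, t1, norm_mul, hc, one_mul]
    exact h4

end Invariance

/-! ### Splitting the functionals into two half-line problems -/

section HalfLines

variable {μ v τ ω : ℝ} {w : ℝ → ℂ}

lemma integral_eq_add_of_half {Φ φ₁ φ₂ : ℝ → ℝ} (e₁ : ∀ᵐ x : ℝ, 0 < x → Φ (-x) = φ₁ x)
    (e₂ : ∀ᵐ x : ℝ, 0 < x → Φ x = φ₂ x) (i₁ : IntegrableOn φ₁ (Ioi 0))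
    (i₂ : IntegrableOn φ₂ (Ioi 0)) :
    ∫ x, Φ x = (∫ x in Ioi 0, φ₁ x) + ∫ x in Ioi 0, φ₂ x := by
  have f₁ : (fun x => Φ (-x)) =ᵐ[volume.restrict (Ioi 0)] φ₁ :=
    (ae_restrict_iff' measurableSet_Ioi).2 e₁
  have f₂ : Φ =ᵐ[volume.restrict (Ioi 0)] φ₂ := (ae_restrict_iff' measurableSet_Ioi).2 e₂
  have j₁ : IntegrableOn (fun x => Φ (-x)) (Ioi 0) := i₁.congr f₁.symm
  have j₂ : IntegrableOn Φ (Ioi 0) := i₂.congr f₂.symm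
  have j₃ : IntegrableOn Φ (Iic 0) := by
    rw [integrableOn_Iic_iff_integrableOn_Iio (by simp)]
    have := (Measure.measurePreserving_neg (volume : Measure ℝ)).integrableOn_comp_preimage
      (Homeomorph.neg ℝ).measurableEmbedding (f := Φ) (s := Iio 0)
    rw [← this]
    simpa [Function.comp_def] using j₁
  rw [← intervalIntegral.integral_Iic_add_Ioi j₃ j₂, ← integral_congr_ae f₁, ← integral_congr_ae f₂,
    integral_comp_neg_Ioi, neg_zero]

/-- The derivative of the reflection of `w`. -/
def reflectedDeriv (w : ℝ → ℂ) (y : ℝ) : ℂ := -weakDeriv w (-y)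

lemma MemH1.memLp_reflectedDeriv (h : MemH1 w) : MemLp (reflectedDeriv w) 2 volume :=
  (h.weakDeriv_spec.1.comp_measurePreserving (Measure.measurePreserving_neg volume)).neg

lemma MemH1.memLp_prim_right (h : MemH1 w) :
    MemLp (prim (traceRight w) (weakDeriv w)) 2 (volume.restrict (Ioi 0)) :=
  (h.1.restrict _).ae_eq ((ae_restrict_iff' measurableSet_Ioi).2 h.exists_prim.1)

lemma MemH1.memLp_prim_left (h : MemH1 w) :
    MemLp (prim (traceLeft w) (reflectedDeriv w)) 2 (volume.restrict (Ioi 0)) :=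
  ((h.1.comp_measurePreserving (Measure.measurePreserving_neg volume)).restrict _).ae_eq
    ((ae_restrict_iff' measurableSet_Ioi).2 h.exists_prim.2)

lemma MemH1.powNorm_eq_add (h : MemH1 w) (hμ : 0 < μ) :
    powNorm μ w = (∫ x in Ioi 0, ‖prim (traceLeft w) (reflectedDeriv w) x‖ ^ (2 * μ + 2)) +
      ∫ x in Ioi 0, ‖prim (traceRight w) (weakDeriv w) x‖ ^ (2 * μ + 2) :=
  integral_eq_add_of_half
    (by filter_upwards [h.exists_prim.2] with x hx h0; rw [hx h0]; rfl)
    (by filter_upwards [h.exists_prim.1] with x hx h0; rw [hx h0])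
    (integrableOn_norm_prim_rpow hμ h.memLp_reflectedDeriv h.memLp_prim_left)
    (integrableOn_norm_prim_rpow hμ h.weakDeriv_spec.1 h.memLp_prim_right)

lemma MemH1.quadratic_eq_add (h : MemH1 w) :
    derivNormSq w + ω * normSq w =
      (∫ x in Ioi 0, density ω (traceLeft w) (reflectedDeriv w) x) +
      ∫ x in Ioi 0, density ω (traceRight w) (weakDeriv w) x := by
  rw [derivNormSq, normSq, ← integral_const_mul, ← integral_add
    (h.weakDeriv_spec.1.integrable_norm_pow (by norm_num))
    ((h.1.integrable_norm_pow (by norm_num)).const_mul ω)]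
  exact integral_eq_add_of_half
    (by
      filter_upwards [h.exists_prim.2] with x hx h0
      rw [hx h0, density, reflectedDeriv, norm_neg]; rfl)
    (by filter_upwards [h.exists_prim.1] with x hx h0; rw [hx h0]; rfl)
    (integrableOn_density h.memLp_reflectedDeriv h.memLp_prim_left)
    (integrableOn_density h.weakDeriv_spec.1 h.memLp_prim_right)

lemma normSq_eq_zero (hw : MemLp w 2 volume) (h : normSq w = 0) : w =ᵐ[volume] 0 := by
  have := (integral_eq_zero_iff_of_nonneg (fun x => by positivity)
    (hw.integrable_norm_pow (by norm_num))).1 h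
  filter_upwards [this] with x hx
  simpa using hx

end HalfLines

/-! ### Competitors of no larger mass -/

section Minimizer

variable {μ v τ ω T r D : ℝ} {w : ℝ → ℂ}

/-- An element of the Nehari manifold whose mass does not exceed that of the profile attached to
the root `T` is that profile up to a phase. -/
lemma eq_phase_of_powNorm_le (hμ : 0 < μ) (hω : 0 < ω) (hτ0 : τ ≠ 0)
    (hR : RootData (τ ^ 2) (|τ| ^ (2 * μ)) (v / √ω) r D T) (hw : MemNehari μ v τ ω w)
    (hN : powNorm μ w ≤ massConst μ ω * RootData.lineMass μ (τ ^ 2) (v / √ω) T) :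
    ∃ c : ℂ, ‖c‖ = 1 ∧
      w =ᵐ[volume] fun x => c * profile μ τ ω T ((T + v / √ω) / τ ^ 2) x := by
  obtain ⟨⟨h1, htr⟩, hne, hneh⟩ := hw
  have hκ := massConst_pos hμ hω
  have hs := Real.sqrt_pos.2 hω
  have hpow := h1.powNorm_eq_add hμ
  have hquad := h1.quadratic_eq_add (ω := ω)
  have hgl := h1.memLp_reflectedDeriv
  have hfl := h1.memLp_prim_left
  have hgr := h1.weakDeriv_spec.1
  have hfr := h1.memLp_prim_right
  set a := traceLeft w with ha
  set b := traceRight w with hb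
  set g := reflectedDeriv w
  set g' := weakDeriv w
  set m := ∫ x in Ioi 0, ‖prim a g x‖ ^ (2 * μ + 2) with hm
  set m' := ∫ x in Ioi 0, ‖prim b g' x‖ ^ (2 * μ + 2) with hm'
  have hm0 : 0 ≤ m := integral_nonneg fun x => by positivity
  have hm0' : 0 ≤ m' := integral_nonneg fun x => by positivity
  -- The total mass is below that of a whole soliton, so each half has a mass parameter θ, θ' in
  -- [-1,1).
  have hlt := mul_lt_mul_of_pos_left (hR.lineMass_lt_full hμ) hκ
  obtain ⟨θ, hθ, hθm⟩ := exists_halfMass_eq hμ (div_nonneg hm0 hκ.le)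
    ((div_lt_iff₀' hκ).2 (by linarith))
  obtain ⟨θ', hθ', hθm'⟩ := exists_halfMass_eq hμ (div_nonneg hm0' hκ.le)
    ((div_lt_iff₀' hκ).2 (by linarith))
  have e : m = massConst μ ω * halfMass μ θ := by rw [hθm]; field_simp
  have e' : m' = massConst μ ω * halfMass μ θ' := by rw [hθm']; field_simp
  have i := halfLine_inequality hμ hω hgl hfl hθ e
  have i' := halfLine_inequality hμ hω hgr hfr hθ' e'
  have hba : ‖b‖ ^ 2 = τ ^ 2 * ‖a‖ ^ 2 := by
    rw [htr, norm_mul, mul_pow, Complex.norm_real, Real.norm_eq_abs, sq_abs]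
  obtain ⟨hj, hj'⟩ := hR.jump_le_of_mass_le hμ abs_rpow_two_mul (x := θ) (y := -θ')
    (Ico_subset_Icc_self hθ) ⟨by linarith [hθ'.2], by linarith [hθ'.1]⟩ (by
      rw [neg_neg]
      refine le_of_mul_le_mul_left ?_ hκ
      rw [mul_add, ← e, ← e', ← hpow]
      exact hN)
  have hQ : (∫ x in Ioi 0, density ω a g x) + (∫ x in Ioi 0, density ω b g' x) =
      m + m' + v * ‖a‖ ^ 2 := by
    rw [nehari] at hneh
    rw [← hpow, ← hquad]
    linarith
  have hv : v = √ω * (v / √ω) := by field_simp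
  have hvj : v * ‖a‖ ^ 2 ≤ √ω * (-θ - τ ^ 2 * θ') * ‖a‖ ^ 2 := by
    refine mul_le_mul_of_nonneg_right ?_ (by positivity)
    rw [hv]
    exact mul_le_mul_of_nonneg_left (by linarith) hs.le
  rw [hba] at i'
  -- The Nehari identity and the jump inequality give the reverse of the sum of the two half-line
  -- inequalities, so each of them is an equality.
  have k : ∫ x in Ioi 0, density ω a g x ≤ m - √ω * θ * ‖a‖ ^ 2 := by linarith
  have k' : ∫ x in Ioi 0, density ω b g' x ≤ m' - √ω * θ' * ‖b‖ ^ 2 := by rw [hba]; linarith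
  have rig := fun h : -1 < θ => halfLine_rigidity hμ hω hgl hfl ⟨h, hθ.2⟩ e k
  have rig' := fun h : -1 < θ' => halfLine_rigidity hμ hω hgr hfr ⟨h, hθ'.2⟩ e' k'
  have hval : ∀ {a : ℂ} {g : ℝ → ℂ} {θ : ℝ}, (∃ C : ℂ, ‖C‖ = 1 ∧
      ∀ x, 0 ≤ x → prim a g x = C * (soliton μ ω (x + shift μ ω (-θ)) : ℂ)) → a ≠ 0 := by
    rintro a g θ ⟨C, hC, h⟩ rfl
    have h0 := congrArg norm (h 0 le_rfl)
    rw [prim_zero, norm_mul, hC, norm_zero, one_mul, Complex.norm_real, zero_add] at h0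
    exact (soliton_pos hμ hω _).ne' (norm_eq_zero.1 h0.symm)
  -- Optimizers of positive mass are solitons up to phase and do not vanish at 0. Zero traces thus
  -- force both masses, hence the whole energy, to vanish.
  by_cases ha0 : a = 0
  · exfalso
    have hb0 : b = 0 := by rw [htr, ha0, mul_zero]
    have t : θ = -1 := (hθ.1.eq_or_lt.resolve_right fun h => hval (rig h) ha0).symm
    have t' : θ' = -1 := (hθ'.1.eq_or_lt.resolve_right fun h => hval (rig' h) hb0).symm
    rw [t, halfMass_neg_one, mul_zero] at e
    rw [t', halfMass_neg_one, mul_zero] at e'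
    rw [← hquad, e, e', ha0, norm_zero] at hQ
    have q1 : 0 ≤ derivNormSq w := integral_nonneg fun x => by positivity
    have q2 : 0 ≤ normSq w := integral_nonneg fun x => by positivity
    refine hne (normSq_eq_zero h1.1 (le_antisymm ?_ q2))
    by_contra! hpos
    have := mul_pos hω hpos
    linarith
  · have hapos : 0 < ‖a‖ ^ 2 := by positivity
    have hV : v / √ω = -θ + τ ^ 2 * -θ' := by
      refine le_antisymm hj ?_
      have : √ω * (-θ - τ ^ 2 * θ') * ‖a‖ ^ 2 ≤ v * ‖a‖ ^ 2 := by linarith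
      have := le_of_mul_le_mul_right this hapos
      rw [le_div_iff₀ hs]
      linarith
    obtain ⟨hT, hT'⟩ := hj' hV
    have hmT := hR.mem_Ioo
    have hmT' := hR.snd_mem
    obtain ⟨C, hC, hCx⟩ := rig (by rw [hT]; exact hmT.1)
    obtain ⟨C', -, hCx'⟩ := rig' (by linarith [hmT'.2])
    rw [hT'] at hCx'
    rw [hT] at hCx
    have e0 := hCx 0 le_rfl
    have e0' := hCx' 0 le_rfl
    rw [prim_zero, zero_add] at e0 e0'
    rw [shift_neg, soliton_neg] at e0
    rw [soliton_shift_eq hμ hω hmT hmT' hR.factor_zero, htr, e0] at e0'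
    have hsol := (soliton_pos hμ hω (shift μ ω T)).ne'
    -- The two phases are independent until the trace condition at the origin ties them together.
    have hCC : C' = (Real.sign τ : ℂ) * C := by
      have h2 : ((|τ| * soliton μ ω (shift μ ω T) : ℝ) : ℂ) ≠ 0 := by
        exact_mod_cast mul_ne_zero (abs_ne_zero.2 hτ0) hsol
      refine mul_right_cancel₀ h2 ?_
      rw [← e0']
      nth_rewrite 1 [← sign_mul_abs_eq (τ := τ)]
      push_cast
      ring
    refine ⟨C, hC, ?_⟩
    have hl := ae_comp_neg h1.exists_prim.2
    filter_upwards [hl, h1.exists_prim.1, ae_ne_zero] with x hx hx' hx0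
    rw [profile_eq, profileAt]
    rcases lt_or_gt_of_ne hx0 with h | h
    · have := hx (neg_pos.2 h)
      rw [neg_neg] at this
      rw [this, glue_of_neg h]
      refine (hCx (-x) (neg_pos.2 h).le).trans ?_
      rw [shift_neg, ← neg_add, soliton_neg]
    · rw [hx' h, glue_of_pos h]
      refine (hCx' x (le_of_lt h)).trans ?_
      rw [hCC]
      push_cast
      ring

end Minimizer

/-! ### Ground states and the main theorem -/

section GroundState

variable {μ v τ ω T r D : ℝ} {w : ℝ → ℂ}

lemma powNorm_profile_eq_lineMass {V s : ℝ} (hμ : 0 < μ) (hω : 0 < ω) (hτ0 : τ ≠ 0)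
    (hT : T ∈ Ioo (-1 : ℝ) 1) (hT' : (T + V) / s ∈ Ioo (-1 : ℝ) 1) :
    powNorm μ (profile μ τ ω T ((T + V) / s)) = massConst μ ω * RootData.lineMass μ s V T := by
  rw [profile_eq, powNorm_profile hμ hω (abs_sign hτ0) hT hT', RootData.lineMass,
    halfMass_add_halfMass_neg' hμ]

lemma reducedAction_le_iff (hμ : 0 < μ) {u w : ℝ → ℂ} :
    reducedAction μ u ≤ reducedAction μ w ↔ powNorm μ u ≤ powNorm μ w :=
  mul_le_mul_iff_right₀ (by positivity)

lemma RootData.memNehari (hR : RootData (τ ^ 2) (|τ| ^ (2 * μ)) (v / √ω) r D T) (hμ : 0 < μ)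
    (hω : 0 < ω) (hτ0 : τ ≠ 0) :
    MemNehari μ v τ ω (profile μ τ ω T ((T + v / √ω) / τ ^ 2)) :=
  memNehari_profile hμ hω hτ0 hR.mem_Ioo hR.snd_mem rfl hR.factor_zero

/-- A competitor of strictly smaller mass would be the profile up to a phase, hence of the same
mass. -/
lemma RootData.powNorm_le (hR : RootData (τ ^ 2) (|τ| ^ (2 * μ)) (v / √ω) r D T) (hμ : 0 < μ)
    (hω : 0 < ω) (hτ0 : τ ≠ 0) (hw : MemNehari μ v τ ω w) :
    powNorm μ (profile μ τ ω T ((T + v / √ω) / τ ^ 2)) ≤ powNorm μ w := by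
  by_contra! hlt
  obtain ⟨c, hc, he⟩ := eq_phase_of_powNorm_le hμ hω hτ0 hR hw
    (hlt.le.trans_eq (powNorm_profile_eq_lineMass hμ hω hτ0 hR.mem_Ioo hR.snd_mem))
  exact hlt.ne (powNorm_phase hc he)

lemma RootData.isGroundState_iff (hR : RootData (τ ^ 2) (|τ| ^ (2 * μ)) (v / √ω) r D T)
    (hμ : 0 < μ) (hω : 0 < ω) (hτ0 : τ ≠ 0) :
    IsGroundState μ v τ ω w ↔ ∃ θ : ℝ, w =ᵐ[volume] fun x =>
      Complex.exp (θ * Complex.I) * profile μ τ ω T ((T + v / √ω) / τ ^ 2) x := by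
  have hu := hR.memNehari hμ hω hτ0
  constructor
  · rintro ⟨hw, hmin⟩
    have h1 := hmin _ hu
    rw [action_eq_of_nehari hμ hw.2.2, action_eq_of_nehari hμ hu.2.2, reducedAction_le_iff hμ,
      powNorm_profile_eq_lineMass hμ hω hτ0 hR.mem_Ioo hR.snd_mem] at h1
    obtain ⟨c, hc, he⟩ := eq_phase_of_powNorm_le hμ hω hτ0 hR hw h1
    obtain ⟨θ, rfl⟩ := (Complex.norm_eq_one_iff c).1 hc
    exact ⟨θ, he⟩
  · rintro ⟨θ, he⟩
    have hc := Complex.norm_exp_ofReal_mul_I θ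
    have hw := hu.phase hc he
    refine ⟨hw, fun z hz => ?_⟩
    rw [action_eq_of_nehari hμ hw.2.2, action_eq_of_nehari hμ hz.2.2, reducedAction_le_iff hμ,
      powNorm_phase hc he]
    exact hR.powNorm_le hμ hω hτ0 hz

lemma RootData.isGroundState (hR : RootData (τ ^ 2) (|τ| ^ (2 * μ)) (v / √ω) r D T)
    (hμ : 0 < μ) (hω : 0 < ω) (hτ0 : τ ≠ 0) :
    IsGroundState μ v τ ω (profile μ τ ω T ((T + v / √ω) / τ ^ 2)) :=
  (hR.isGroundState_iff hμ hω hτ0).2 ⟨0, by simp⟩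

end GroundState

end

end FulopTsutsui

theorem mainTheorem4 (μ v τ ω : ℝ) (hμ : 0 < μ) (hv : 0 < v)
    (hτ0 : τ ≠ 0) (hτ1 : τ ≠ 1) (hτ1' : τ ≠ -1) (hω : v ^ 2 / (τ ^ 2 + 1) ^ 2 < ω) :
    -- the pair `(T̃₋, T̃₊)` is admissible and `u_{T̃}` is a stationary state
    FulopTsutsui.IsRootPair μ v τ ω
        (FulopTsutsui.tildeMinus μ v τ ω) (FulopTsutsui.tildePlus μ v τ ω) ∧
    FulopTsutsui.IsStationaryState μ v τ ω (FulopTsutsui.uTilde μ v τ ω) ∧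
    FulopTsutsui.NormIdentities μ ω
        (FulopTsutsui.tildeMinus μ v τ ω) (FulopTsutsui.tildePlus μ v τ ω)
        (FulopTsutsui.uTilde μ v τ ω) ∧
    -- `u_{T̃}` is the ground state, and the only one up to a constant phase
    FulopTsutsui.IsGroundState μ v τ ω (FulopTsutsui.uTilde μ v τ ω) ∧
    (∀ w : ℝ → ℂ, FulopTsutsui.IsGroundState μ v τ ω w ↔
      ∃ θ : ℝ, w =ᵐ[MeasureTheory.volume]
        fun x => Complex.exp (θ * Complex.I) * FulopTsutsui.uTilde μ v τ ω x) ∧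
    -- comparison with the second stationary state, when it exists
    (v ^ 2 / (τ ^ 2 - 1) ^ 2 < ω →
      FulopTsutsui.IsRootPair μ v τ ω
          (FulopTsutsui.hatMinus μ v τ ω) (FulopTsutsui.hatPlus μ v τ ω) ∧
      FulopTsutsui.IsStationaryState μ v τ ω (FulopTsutsui.uHat μ v τ ω) ∧
      FulopTsutsui.NormIdentities μ ω
          (FulopTsutsui.hatMinus μ v τ ω) (FulopTsutsui.hatPlus μ v τ ω)
          (FulopTsutsui.uHat μ v τ ω) ∧
      FulopTsutsui.reducedAction μ (FulopTsutsui.uTilde μ v τ ω) <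
        FulopTsutsui.reducedAction μ (FulopTsutsui.uHat μ v τ ω)) := by
  have hω0 := FulopTsutsui.omega_pos hv hω
  have hR := FulopTsutsui.rootData hμ hv hτ0 hτ1 hτ1' hω
  have hD := hR.D_ne
  have hp0 := hR.p_pos
  have hp1 : |τ| ^ (2 * μ) ≠ 1 := by
    rcases hR.cases with h | h
    · exact h.2.1.ne'
    · exact h.2.1.ne
  have hs := FulopTsutsui.abs_sign hτ0
  have hT := FulopTsutsui.tildePlus_eq (v := v) (ω := ω) hτ0 hD
  have hu : FulopTsutsui.uTilde μ v τ ω = FulopTsutsui.profile μ τ ω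
      (FulopTsutsui.tildeMinus μ v τ ω) ((FulopTsutsui.tildeMinus μ v τ ω + v / √ω) / τ ^ 2) := by
    rw [FulopTsutsui.uTilde, hT]
  refine ⟨?_, ?_, ?_, ?_, fun w => ?_, fun hω' => ?_⟩
  · rw [hT]
    exact FulopTsutsui.isRootPair_of hp1 hp0 hR.mem_Ioo hR.snd_mem rfl hR.factor_zero
  · rw [hu]
    exact FulopTsutsui.isStationaryState_profile hμ hω0 hτ0 hR.mem_Ioo hR.snd_mem rfl
      hR.factor_zero
  · rw [hu, hT]
    exact FulopTsutsui.normIdentities_profile hμ hω0 hs hR.mem_Ioo hR.snd_mem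
  · rw [hu]
    exact hR.isGroundState hμ hω0 hτ0
  · rw [hu]
    exact hR.isGroundState_iff hμ hω0 hτ0
  · have hH := FulopTsutsui.hatMinus_mul (v := v) (ω := ω) hD
    have hk : 0 < |τ ^ 2 - 1| := by
      rw [abs_pos, sub_ne_zero]
      rcases hR.cases with h | h
      · exact h.1.ne'
      · exact h.1.ne
    have hHm := hR.hat_mem_Ioo hH (FulopTsutsui.div_sqrt_lt hv hk (by rwa [sq_abs]))
    have he := hR.factor_hat_zero hH
    have hHp := FulopTsutsui.RootData.snd_mem_Ioo hp0 hHm he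
    have hP := FulopTsutsui.hatPlus_eq (v := v) (ω := ω) hτ0 hD
    have huH : FulopTsutsui.uHat μ v τ ω = FulopTsutsui.profile μ τ ω
        (FulopTsutsui.hatMinus μ v τ ω) ((FulopTsutsui.hatMinus μ v τ ω + v / √ω) / τ ^ 2) := by
      rw [FulopTsutsui.uHat, hP]
    refine ⟨?_, ?_, ?_, ?_⟩
    · rw [hP]
      exact FulopTsutsui.isRootPair_of hp1 hp0 hHm hHp rfl he
    · rw [huH]
      exact FulopTsutsui.isStationaryState_profile hμ hω0 hτ0 hHm hHp rfl he
    · rw [huH, hP]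
      exact FulopTsutsui.normIdentities_profile hμ hω0 hs hHm hHp
    -- The two roots differ because D(H - T) = 2sr > 0. Both pairs lie on the same line, so the
    -- strict minimum of the mass at the first root is the strict inequality between reduced
    -- actions.
    · have hne : FulopTsutsui.hatMinus μ v τ ω ≠ FulopTsutsui.tildeMinus μ v τ ω := fun h => by
        have h1 := hR.eq_add_of_hat hH
        rw [h, sub_self, mul_zero] at h1
        have := mul_pos (mul_pos two_pos hR.s_pos) hR.r_pos
        linarith
      rw [← not_le, FulopTsutsui.reducedAction_le_iff hμ, not_le, hu, huH,
        FulopTsutsui.powNorm_profile_eq_lineMass hμ hω0 hτ0 hR.mem_Ioo hR.snd_mem,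
        FulopTsutsui.powNorm_profile_eq_lineMass hμ hω0 hτ0 hHm hHp]
      exact mul_lt_mul_of_pos_left (hR.lineMass_lt hμ FulopTsutsui.abs_rpow_two_mul
        (Ioo_subset_Icc_self hHm) (Ioo_subset_Icc_self hHp) hne)
        (FulopTsutsui.massConst_pos hμ hω0)
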